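/- Let $J_1,\dots,J_n\subseteq\mathbb R$ be nonempty open intervals, $U=J_1\times\cdots\times J_n$, and let $g=\sum_{i=1}^n g_i(x)\,dx_i^2$ be a smooth pseudo-Riemannian metric on $U$ (each $g_i$ is $C^\infty$ and nowhere zero, of arbitrary sign). Call $g$ \emph{orthogonally separable} if near every point of $U$ the geodesic Hamilton–Jacobi equation $\tfrac12\sum_i g_i^{-1}(\partial_iW)^2=E$ has a complete integral $W(x,c)=\sum_i W_i(x_i,c)$, with $c$ in a nonempty open subset of $\mathbb R^n$ and $\det(\partial^2W/\partial x_i\partial c_j)\ne0$. Say that $g$ has \emph{diagonal curvature} if its Riemann tensor satisfies $R_{ijik}=0$ whenever $j\neq k$. For a set $S$ of coordinates, a tensor $g=\sum_{i\in S}g_i\,dx_i^2$ is of \emph{concircular-tensor form} if there are $M\subseteq S$ and a partition $P$ of $S\setminus M$ into nonempty sets such that $$g=\sum_{a\in M}\Phi_a\prod_{b\in M,\,b\ne a}(\sigma_a-\sigma_b)\,dx_a^2+\sum_{I\in P}\Big(\prod_{a\in M}(e_I-\sigma_a)\Big)g^I ,$$ where $\Phi_a,\sigma_a$ are smooth functions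 of $x_a$ only, $\sigma_a$ is nonconstant, the $e_I$ are constants, and each $g^I=\sum_{i\in I}g^I_i\,dx_i^2$ has coefficients depending only on $x_I=(x_i)_{i\in I}$. It is \emph{irreducible} if $M=S$, a \emph{product} if $M=\emptyset$ and $|P|\ge2$, and a \emph{warped product} if $M\neq\emptyset\ne P$. It is \emph{exceptional} if for some $a\in S$ and some nonempty partition $P$ of $S\setminus\{a\}$, $$g=\Phi\,dx_a^2+\sum_{I\in P}\sigma^I g^I ,$$ where $\Phi,\sigma^I$ are smooth functions of $x_a$ only, each $\sigma^I$ is nonconstant, and the $g^I$ are as before. Call $g$ \emph{classified} if it is irreducible, or if it can be written as a product, a warped product or an exceptional metric all of whose blocks $g^I$ are again classified (recursively). (1) If $g$ is orthogonally separable with diagonal curvature, then $g$ is classified. Moreover, whenever such a $g$ is written as a product, a warped product or an exceptional metric, each block $g^I$ pulls back to an orthogonally separable metric with diagonal curvature on the coordinate submanifolds on which only $x_I$ varies. (2) Conversely, if $g$ is classified, then with $H_i^2=|g_i|$ it satisfies the Levi-Civita equations $$\partial_i\partial_j\log H_i^2+\partial_j\log H_i^2\;\partial_i\log H_j^2=0\quad(i\ne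 j),$$ $$\partial_j\partial_k\log H_i^2-\partial_j\log H_i^2\,\partial_k\log H_i^2+\partial_j\log H_i^2\,\partial_k\log H_j^2+\partial_k\log H_i^2\,\partial_j\log H_k^2=0\quad(i,j,k\text{ distinct}),$$ and $g$ is orthogonally separable with diagonal curvature. -/

import Mathlib

open scoped ContDiff

noncomputable section

namespace OrthSep

universe u

variable {ι : Type u}

/-! ### Coordinate boxes and partial derivatives -/

/-- A nonempty open interval of the real line (possibly unbounded). -/
def IsOpenInterval (s : Set ℝ) : Prop :=
  IsOpen s ∧ s.OrdConnected ∧ s.Nonempty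

/-- The coordinate box `{x | x i ∈ J i for all i}`. -/
def box (J : ι → Set ℝ) : Set (ι → ℝ) :=
  Set.univ.pi J

/-- `f` takes two different values on `s`. -/
def NonconstOn (f : ℝ → ℝ) (s : Set ℝ) : Prop :=
  ∃ t ∈ s, ∃ t' ∈ s, f t ≠ f t'

/-- The partial derivative `∂f/∂xᵢ` at `x`. -/
def pd [Fintype ι] [DecidableEq ι] (i : ι) (f : (ι → ℝ) → ℝ) (x : ι → ℝ) : ℝ :=
  fderiv ℝ f x (Pi.single i 1)

/-! ### Levi-Civita connection and curvature of a metric in coordinates -/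

section Curvature

variable [Fintype ι] [DecidableEq ι]

/-- Christoffel symbols `Γᵏᵢⱼ` of the metric `g`. -/
def christoffel (g : (ι → ℝ) → Matrix ι ι ℝ) (k i j : ι) (x : ι → ℝ) : ℝ :=
  (1 / 2) * ∑ l, (g x)⁻¹ k l *
    (pd i (fun y => g y j l) x + pd j (fun y => g y i l) x - pd l (fun y => g y i j) x)

/-- The components `Rˡₖᵢⱼ = dxˡ(R(∂ᵢ, ∂ⱼ) ∂ₖ)` of the curvature tensor. -/
def riemannUp (g : (ι → ℝ) → Matrix ι ι ℝ) (l k i j : ι) (x : ι → ℝ) : ℝ :=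
  pd i (christoffel g l j k) x - pd j (christoffel g l i k) x
    + ∑ m, (christoffel g l i m x * christoffel g m j k x
      - christoffel g l j m x * christoffel g m i k x)

/-- The components `Rₗₖᵢⱼ = ⟨R(∂ᵢ, ∂ⱼ) ∂ₖ, ∂ₗ⟩` of the Riemann curvature tensor. -/
def riemann (g : (ι → ℝ) → Matrix ι ι ℝ) (l k i j : ι) (x : ι → ℝ) : ℝ :=
  ∑ m, g x l m * riemannUp g m k i j x

/-- Diagonal curvature: `Rᵢⱼᵢₖ = 0` on `U` whenever `j ≠ k`. -/
def HasDiagonalCurvature (U : Set (ι → ℝ)) (g : (ι → ℝ) → Matrix ι ι ℝ) : Prop :=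
  ∀ x ∈ U, ∀ i j k : ι, j ≠ k → riemann g i j i k x = 0

end Curvature

/-! ### Separability of the Hamilton-Jacobi equation -/

section HamiltonJacobi

variable [Fintype ι] [DecidableEq ι]

/-- The geodesic Hamiltonian `½ ∑ gⁱʲ(x) pᵢ pⱼ`. -/
def hamiltonian (g : (ι → ℝ) → Matrix ι ι ℝ) (x p : ι → ℝ) : ℝ :=
  (1 / 2) * ∑ i, ∑ j, (g x)⁻¹ i j * p i * p j

/-- The coordinates are separable for `g` on `U`: near every point of `U` the geodesic
Hamilton-Jacobi equation `H(x, ∂W/∂x) = E` has a complete integral of the form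
`W(x, c) = ∑ᵢ Wᵢ(xᵢ, c)`, where the parameter `c` ranges over a nonempty open subset `C` of `ℝⁿ`;
completeness is the condition `det (∂²W/∂xᵢ∂cⱼ) ≠ 0`. -/
def IsSeparable (U : Set (ι → ℝ)) (g : (ι → ℝ) → Matrix ι ι ℝ) : Prop :=
  ∀ x₀ ∈ U, ∃ (K : ι → Set ℝ) (C : Set (ι → ℝ)) (W : ι → ℝ → (ι → ℝ) → ℝ)
    (E : (ι → ℝ) → ℝ),
    (∀ i, IsOpenInterval (K i)) ∧ x₀ ∈ box K ∧ box K ⊆ U ∧ IsOpen C ∧ C.Nonempty ∧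
    (∀ i, ContDiffOn ℝ ∞ (fun q : ℝ × (ι → ℝ) => W i q.1 q.2) (K i ×ˢ C)) ∧
    ∀ x ∈ box K, ∀ c ∈ C,
      hamiltonian g x (fun i => deriv (fun t => W i t c) (x i)) = E c ∧
      (Matrix.of fun i j : ι =>
        pd j (fun c' => deriv (fun t => W i t c') (x i)) c).det ≠ 0

end HamiltonJacobi

/-! ### Orthogonal metrics

In orthogonal coordinates the metric is `g = ∑ᵢ gᵢ(x) dxᵢ²`, and it is given by the functions
`g i`, which are smooth and nowhere zero, of either sign. -/

/-- The matrix field of `∑ᵢ gᵢ dxᵢ²`. -/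
def diagMetric [DecidableEq ι] (g : ι → (ι → ℝ) → ℝ) (x : ι → ℝ) : Matrix ι ι ℝ :=
  Matrix.diagonal fun i => g i x

/-- `∑ᵢ gᵢ dxᵢ²` is a smooth pseudo-Riemannian metric on `U`. -/
def IsOrthMetric [Fintype ι] (U : Set (ι → ℝ)) (g : ι → (ι → ℝ) → ℝ) : Prop :=
  ∀ i, ContDiffOn ℝ ∞ (g i) U ∧ ∀ x ∈ U, g i x ≠ 0

/-- `∑ᵢ gᵢ dxᵢ²` is an orthogonally separable metric with diagonal curvature on `U`. -/
def IsOrthSepDiag [Fintype ι] [DecidableEq ι] (U : Set (ι → ℝ)) (g : ι → (ι → ℝ) → ℝ) : Prop :=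
  IsOrthMetric U g ∧ IsSeparable U (diagMetric g) ∧ HasDiagonalCurvature U (diagMetric g)

/-- The Levi-Civita equations for `Hᵢ² = |gᵢ|`. -/
def LeviCivitaEquations [Fintype ι] [DecidableEq ι]
    (U : Set (ι → ℝ)) (g : ι → (ι → ℝ) → ℝ) : Prop :=
  let L : ι → (ι → ℝ) → ℝ := fun i x => Real.log |g i x|
  ∀ x ∈ U,
    (∀ i j, i ≠ j → pd i (pd j (L i)) x + pd j (L i) x * pd i (L j) x = 0) ∧
    (∀ i j k, i ≠ j → i ≠ k → j ≠ k →
      pd j (pd k (L i)) x - pd j (L i) x * pd k (L i) x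
        + pd j (L i) x * pd k (L j) x + pd k (L i) x * pd j (L k) x = 0)

/-! ### The types of metrics

Let `S` be a set of coordinates. A tensor `∑_{i ∈ S} gᵢ dxᵢ²` is given by the functions `g i`
with `i ∈ S` (the other `g i` are ignored). -/

/-- `∑_{i ∈ I} hᵢ dxᵢ²` is, on the box, a tensor in the coordinates `x_I` only. -/
def DependsOnlyOn (J : ι → Set ℝ) (I : Finset ι) (h : ι → (ι → ℝ) → ℝ) : Prop :=
  ∀ i ∈ I, ∀ x ∈ box J, ∀ y ∈ box J, (∀ j ∈ I, x j = y j) → h i x = h i y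

/-- The pullback of `∑_{i ∈ I} hᵢ dxᵢ²` to the coordinate submanifold through `x₀` along which
only the coordinates `x_I` vary. -/
def pullback [DecidableEq ι] (I : Finset ι) (x₀ : ι → ℝ) (h : ι → (ι → ℝ) → ℝ) :
    I → (I → ℝ) → ℝ :=
  fun i y => h i fun j => if hj : j ∈ I then y ⟨j, hj⟩ else x₀ j

/-- The tensor `∑_{i ∈ I} hᵢ dxᵢ²` pulls back to an orthogonally separable metric with diagonal
curvature on the submanifolds with coordinates `x_I`. -/
def BlockIsOrthSepDiag [DecidableEq ι] (J : ι → Set ℝ) (I : Finset ι)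
    (h : ι → (ι → ℝ) → ℝ) : Prop :=
  ∀ x₀ ∈ box J, IsOrthSepDiag (box fun i : I => J i) (pullback I x₀ h)

variable [DecidableEq ι]

/-- The concircular-tensor form
`g = ∑_{a ∈ M} Φₐ ∏_{b ∈ M, b ≠ a} (σₐ - σ_b) dxₐ² + ∑_{I ∈ P} (∏_{a ∈ M} (e_I - σₐ)) g^I`,
where `M ⊆ S`, `P` is a partition of `S \ M`, `Φₐ` and `σₐ` are functions of `xₐ` with `σₐ`
nonconstant, the `e_I` are constants and each `g^I = ∑_{i ∈ I} (h I)ᵢ dxᵢ²` is a tensor in the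
coordinates `x_I`. -/
def IsConcircularForm (J : ι → Set ℝ) (S M : Finset ι) (P : Finpartition (S \ M))
    (h : Finset ι → ι → (ι → ℝ) → ℝ) (g : ι → (ι → ℝ) → ℝ) : Prop :=
  M ⊆ S ∧ ∃ (Φ σ : ι → ℝ → ℝ) (e : Finset ι → ℝ),
    (∀ a ∈ M, ContDiffOn ℝ ∞ (Φ a) (J a) ∧ ContDiffOn ℝ ∞ (σ a) (J a) ∧
      NonconstOn (σ a) (J a)) ∧
    (∀ I ∈ P.parts, DependsOnlyOn J I (h I)) ∧
    (∀ x ∈ box J, ∀ a ∈ M,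
      g a x = Φ a (x a) * ∏ b ∈ M.erase a, (σ a (x a) - σ b (x b))) ∧
    (∀ x ∈ box J, ∀ I ∈ P.parts, ∀ i ∈ I,
      g i x = (∏ a ∈ M, (e I - σ a (x a))) * h I i x)

/-- Irreducible metrics: the concircular-tensor form with `M = S` (and so `P` empty). -/
def IsIrreducible (J : ι → Set ℝ) (S : Finset ι) (g : ι → (ι → ℝ) → ℝ) : Prop :=
  ∃ P h, IsConcircularForm J S S P h g

/-- Product metrics: the concircular-tensor form with `M` empty, and at least two blocks. -/
def IsProduct (J : ι → Set ℝ) (S : Finset ι) (P : Finpartition (S \ ∅))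
    (h : Finset ι → ι → (ι → ℝ) → ℝ) (g : ι → (ι → ℝ) → ℝ) : Prop :=
  1 < P.parts.card ∧ IsConcircularForm J S ∅ P h g

/-- Warped product metrics: the concircular-tensor form with `M` and `P` nonempty. -/
def IsWarpedProduct (J : ι → Set ℝ) (S M : Finset ι) (P : Finpartition (S \ M))
    (h : Finset ι → ι → (ι → ℝ) → ℝ) (g : ι → (ι → ℝ) → ℝ) : Prop :=
  M.Nonempty ∧ P.parts.Nonempty ∧ IsConcircularForm J S M P h g

/-- Exceptional metrics `g = Φ dxₐ² + ∑_{I ∈ P} σ^I g^I`, where `P` is a nonempty partition of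
`S \ {a}`, `Φ` and `σ^I` are functions of `xₐ` with each `σ^I` nonconstant, and each `g^I` is a
tensor in the coordinates `x_I`. -/
def IsExceptional (J : ι → Set ℝ) (S : Finset ι) (a : ι) (P : Finpartition (S \ {a}))
    (h : Finset ι → ι → (ι → ℝ) → ℝ) (g : ι → (ι → ℝ) → ℝ) : Prop :=
  a ∈ S ∧ P.parts.Nonempty ∧ ∃ (Φ : ℝ → ℝ) (σ : Finset ι → ℝ → ℝ),
    ContDiffOn ℝ ∞ Φ (J a) ∧
    (∀ I ∈ P.parts, ContDiffOn ℝ ∞ (σ I) (J a) ∧ NonconstOn (σ I) (J a) ∧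
      DependsOnlyOn J I (h I)) ∧
    (∀ x ∈ box J, g a x = Φ (x a)) ∧
    (∀ x ∈ box J, ∀ I ∈ P.parts, ∀ i ∈ I, g i x = σ I (x a) * h I i x)

/-- In every way of writing `g` as a product, warped product or exceptional metric, all the blocks
`g^I` are orthogonally separable metrics with diagonal curvature. -/
def BlocksAreOrthSepDiag (J : ι → Set ℝ) (S : Finset ι) (g : ι → (ι → ℝ) → ℝ) : Prop :=
  (∀ P h, IsProduct J S P h g → ∀ I ∈ P.parts, BlockIsOrthSepDiag J I (h I)) ∧
  (∀ M P h, IsWarpedProduct J S M P h g → ∀ I ∈ P.parts, BlockIsOrthSepDiag J I (h I)) ∧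
  (∀ a P h, IsExceptional J S a P h g → ∀ I ∈ P.parts, BlockIsOrthSepDiag J I (h I))

/-- `g` is recursively of one of the four types: it is of one of the types, the blocks `g^I` that
occur are again of one of the types, and so on until only irreducible blocks are left. -/
inductive IsClassified (J : ι → Set ℝ) : Finset ι → (ι → (ι → ℝ) → ℝ) → Prop
  | irreducible {S : Finset ι} {g : ι → (ι → ℝ) → ℝ}
      (hg : IsIrreducible J S g) : IsClassified J S g
  | product {S : Finset ι} {g : ι → (ι → ℝ) → ℝ} (P : Finpartition (S \ ∅))
      (h : Finset ι → ι → (ι → ℝ) → ℝ) (hg : IsProduct J S P h g)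
      (hP : ∀ I ∈ P.parts, IsClassified J I (h I)) : IsClassified J S g
  | warped {S : Finset ι} {g : ι → (ι → ℝ) → ℝ} (M : Finset ι) (P : Finpartition (S \ M))
      (h : Finset ι → ι → (ι → ℝ) → ℝ) (hg : IsWarpedProduct J S M P h g)
      (hP : ∀ I ∈ P.parts, IsClassified J I (h I)) : IsClassified J S g
  | exceptional {S : Finset ι} {g : ι → (ι → ℝ) → ℝ} (a : ι) (P : Finpartition (S \ {a}))
      (h : Finset ι → ι → (ι → ℝ) → ℝ) (hg : IsExceptional J S a P h g)
      (hP : ∀ I ∈ P.parts, IsClassified J I (h I)) : IsClassified J S g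

end OrthSep

end

open scoped ContDiff

namespace OrthSep

/-! ### Boxes and partial derivatives -/

section Basics

variable {ι : Type*} {J : ι → Set ℝ} {x y b : ι → ℝ}

/-! Write A_ij = ∂_j log|g_i| (`logpd`). Separating the Hamilton–Jacobi equation means having, near
each point, a Stäckel system: functions u_ji(x_i), nondegenerate as a matrix, with ∑_i u_ji(x_i)/g_i
constant for every j. Differentiating these identities twice and eliminating the derivatives of u
gives the Levi-Civita equations (`StaeckelAt.leviCivita`). For distinct i, j, k they equate ∂_k A_ij
with a quadratic expression Q in A, while diagonal curvature says 2 ∂_k A_ij = -Q. So both vanish,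
and what remains is `SepDiagSystem`: A_ij is a function of (x_i, x_j), ∂_i A_ij = -A_ij A_ji, and
A_ij A_ik = A_ij A_jk + A_ik A_kj.

To classify, draw an arrow i → j when A_ij is not identically zero (`Involves`). Since A_ij g_j is
independent of x_i, the zeros of A_ij are decided by x_j alone; the quadratic relation then makes
arrows transitive and any two targets of one source comparable. Choose o such that every arrow
leaving o is answered by an arrow back. The coordinates equal to or pointing at o have no arrows to
or from the rest, so if there is a rest, g is a product. Otherwise everything points at o. If o
points nowhere, each A_io is a function of x_o, and grouping coordinates by these functions gives an
exceptional metric. If o → j₀, then all other coordinates point at j₀ too, and there are functions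
σ_i(x_i) with A_ik (σ_i - σ_k) = -σ_k' (`SepDiagSystem.exists_sigma`). The nonconstant σ_i form M,
the constant ones are grouped by value, and the equation integrates to the concircular form. Blocks
satisfy the same system, so one inducts on the set of coordinates.

Conversely, Lagrange interpolation supplies an explicit Stäckel system for the Vandermonde part M,
and partial fractions glue to it the systems of the blocks (`HasStaeckelSystem.assemble`). Such a
system is integrated to a complete integral by taking square roots and primitives. Each component of
a classified metric is a product of functions of two variables, so ∂_k A_ij = 0, and with
Levi-Civita this gives diagonal curvature. Separability of the blocks in (1) is obtained by the same
road: a block satisfies the system, hence is classified, hence has Stäckel systems. -/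

lemma mem_box : x ∈ box J ↔ ∀ i, x i ∈ J i := by simp [box]

lemma update_mem_box [DecidableEq ι] (hx : x ∈ box J) {i : ι} {t : ℝ} (ht : t ∈ J i) :
    Function.update x i t ∈ box J := by
  rw [mem_box] at *
  intro j
  by_cases h : j = i
  · subst h; simpa using ht
  · simpa [h] using hx j

lemma isOpen_box [Finite ι] (hJ : ∀ i, IsOpenInterval (J i)) : IsOpen (box J) :=
  isOpen_set_pi Set.finite_univ fun i _ => (hJ i).1

lemma box_nonempty (hJ : ∀ i, IsOpenInterval (J i)) : (box J).Nonempty :=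
  Set.univ_pi_nonempty_iff.2 fun i => (hJ i).2.2

lemma convex_box (hJ : ∀ i, IsOpenInterval (J i)) : Convex ℝ (box J) :=
  convex_pi fun i _ => (hJ i).2.1.convex

/-- A function on the box depends only on `x_T`. -/
def Dep (J : ι → Set ℝ) (T : Finset ι) (f : (ι → ℝ) → ℝ) : Prop :=
  ∀ x ∈ box J, ∀ y ∈ box J, (∀ j ∈ T, x j = y j) → f x = f y

lemma dep_prod_comp_eval {M : Finset ι} (f : ι → ℝ → ℝ) :
    Dep J M fun x => ∏ a ∈ M, f a (x a) :=
  fun _ _ _ _ h => Finset.prod_congr rfl fun a ha => by rw [h a ha]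

lemma contDiffOn_comp_eval [Fintype ι] {φ : ℝ → ℝ} {i : ι} (hφ : ContDiffOn ℝ ∞ φ (J i)) :
    ContDiffOn ℝ ∞ (fun x : ι → ℝ => φ (x i)) (box J) :=
  hφ.comp (contDiff_apply ℝ ℝ i).contDiffOn fun _ hx => mem_box.1 hx i

lemma differentiableAt_comp_eval [Fintype ι] {i : ι} {φ : ℝ → ℝ} (hφ : DifferentiableAt ℝ φ (x i)) :
    DifferentiableAt ℝ (fun y : ι → ℝ => φ (y i)) x :=
  DifferentiableAt.comp x hφ (differentiableAt_apply i x)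

variable [Fintype ι] [DecidableEq ι] {f h : (ι → ℝ) → ℝ}

lemma hasDerivAt_comp_update (i : ι) (hf : DifferentiableAt ℝ f x) :
    HasDerivAt (fun t => f (Function.update x i t)) (pd i f x) (x i) := by
  have h1 : HasFDerivAt f (fderiv ℝ f x) (Function.update x i (x i)) := by
    simpa using hf.hasFDerivAt
  exact h1.comp_hasDerivAt (x i) (hasDerivAt_update x i (x i))

lemma hasDerivAt_comp_update' (i : ι) {t : ℝ} (hf : DifferentiableAt ℝ f (Function.update x i t)) :
    HasDerivAt (fun t => f (Function.update x i t)) (pd i f (Function.update x i t)) t := by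
  simpa using hasDerivAt_comp_update i hf

lemma pd_congr_of_eqOn {U : Set (ι → ℝ)} (hU : IsOpen U) (hx : x ∈ U) (hfh : Set.EqOn f h U)
    (i : ι) : pd i f x = pd i h x := by
  unfold pd
  rw [(Filter.eventuallyEq_of_mem (hU.mem_nhds hx) hfh).fderiv_eq]

lemma pd_mul (i : ι) (hf : DifferentiableAt ℝ f x) (hh : DifferentiableAt ℝ h x) :
    pd i (fun y => f y * h y) x = pd i f x * h x + f x * pd i h x := by
  unfold pd
  rw [fderiv_fun_mul hf hh]
  simp
  ring

lemma pd_add (i : ι) (hf : DifferentiableAt ℝ f x) (hh : DifferentiableAt ℝ h x) :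
    pd i (fun y => f y + h y) x = pd i f x + pd i h x := by
  unfold pd
  rw [fderiv_fun_add hf hh]
  simp

lemma pd_sub (i : ι) (hf : DifferentiableAt ℝ f x) (hh : DifferentiableAt ℝ h x) :
    pd i (fun y => f y - h y) x = pd i f x - pd i h x := by
  unfold pd
  rw [fderiv_fun_sub hf hh]
  simp

lemma pd_neg (i : ι) : pd i (fun y => -f y) x = -pd i f x := by
  unfold pd
  rw [fderiv_fun_neg]
  simp

lemma pd_const (i : ι) (c : ℝ) : pd i (fun _ => c) x = 0 := by
  unfold pd
  simp

lemma pd_const_mul (i : ι) (c : ℝ) (hf : DifferentiableAt ℝ f x) :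
    pd i (fun y => c * f y) x = c * pd i f x := by
  unfold pd
  rw [fderiv_const_mul hf]
  simp

lemma pd_inv (i : ι) (hf : DifferentiableAt ℝ f x) (h0 : f x ≠ 0) :
    pd i (fun y => (f y)⁻¹) x = -pd i f x / f x ^ 2 := by
  have h1 := (hasDerivAt_comp_update i hf).fun_inv (by simpa using h0)
  have h2 := hasDerivAt_comp_update i (hf.fun_inv h0)
  simpa using h2.unique h1

lemma pd_div (i : ι) (hf : DifferentiableAt ℝ f x) (hh : DifferentiableAt ℝ h x) (h0 : h x ≠ 0) :
    pd i (fun y => f y / h y) x = (pd i f x * h x - f x * pd i h x) / h x ^ 2 := by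
  simp only [div_eq_mul_inv]
  rw [pd_mul i hf (hh.fun_inv h0), pd_inv i hh h0]
  field_simp
  ring

lemma pd_sum {κ : Type*} (s : Finset κ) {F : κ → (ι → ℝ) → ℝ} (i : ι)
    (hF : ∀ k ∈ s, DifferentiableAt ℝ (F k) x) :
    pd i (fun y => ∑ k ∈ s, F k y) x = ∑ k ∈ s, pd i (F k) x := by
  unfold pd
  rw [fderiv_fun_sum hF]
  simp

lemma pd_comp_eval_self (i : ι) {φ : ℝ → ℝ} (hφ : DifferentiableAt ℝ φ (x i)) :
    pd i (fun y => φ (y i)) x = deriv φ (x i) := by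
  have h1 : DifferentiableAt ℝ (fun y : ι → ℝ => φ (y i)) x := differentiableAt_comp_eval hφ
  have h2 := hasDerivAt_comp_update i h1
  simp only [Function.update_self] at h2
  exact h2.deriv.symm

lemma pd_comp_eval_of_ne {i k : ι} (hik : k ≠ i) {φ : ℝ → ℝ} (hφ : DifferentiableAt ℝ φ (x i)) :
    pd k (fun y => φ (y i)) x = 0 := by
  have h1 : DifferentiableAt ℝ (fun y : ι → ℝ => φ (y i)) x := differentiableAt_comp_eval hφ
  have h2 := hasDerivAt_comp_update k h1
  simp only [Function.update_of_ne hik.symm] at h2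
  exact h2.unique (hasDerivAt_const _ _)

lemma contDiffOn_pd {U : Set (ι → ℝ)} (hU : IsOpen U) (hf : ContDiffOn ℝ ∞ f U) (i : ι) :
    ContDiffOn ℝ ∞ (pd i f) U :=
  (((contDiffOn_infty_iff_fderiv_of_isOpen hU).1 hf).2).clm_apply contDiffOn_const

lemma differentiableAt_of_contDiffOn {E F : Type*} [NormedAddCommGroup E] [NormedSpace ℝ E]
    [NormedAddCommGroup F] [NormedSpace ℝ F] {U : Set E} (hU : IsOpen U) {f : E → F}
    (hf : ContDiffOn ℝ ∞ f U) {x : E} (hx : x ∈ U) : DifferentiableAt ℝ f x :=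
  (hf.contDiffAt (hU.mem_nhds hx)).differentiableAt (by simp)

lemma pd_comm {U : Set (ι → ℝ)} (hU : IsOpen U) (hf : ContDiffOn ℝ ∞ f U) (hx : x ∈ U)
    (i j : ι) : pd i (pd j f) x = pd j (pd i f) x := by
  have hs : IsSymmSndFDerivAt ℝ f x :=
    (hf.contDiffAt (hU.mem_nhds hx)).isSymmSndFDerivAt
      (by simpa using (WithTop.coe_le_coe.2 (le_top : (2 : ℕ∞) ≤ ⊤)))
  have hd : DifferentiableAt ℝ (fderiv ℝ f) x :=
    differentiableAt_of_contDiffOn hU ((contDiffOn_infty_iff_fderiv_of_isOpen hU).1 hf).2 hx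
  have key : ∀ k l : ι, pd k (pd l f) x =
      fderiv ℝ (fderiv ℝ f) x (Pi.single k 1) (Pi.single l 1) := by
    intro k l
    change fderiv ℝ (fun y => fderiv ℝ f y (Pi.single l 1)) x (Pi.single k 1) = _
    rw [fderiv_clm_apply hd (differentiableAt_const _)]
    simp
  rw [key, key]
  exact hs _ _

/-- A function all of whose partial derivatives outside `T` vanish depends only on `x_T`. -/
lemma eq_of_pd_eq_zero (hJ : ∀ i, IsOpenInterval (J i)) (hf : ContDiffOn ℝ ∞ f (box J))
    {T : Finset ι} (h0 : ∀ j ∉ T, ∀ z ∈ box J, pd j f z = 0) (hx : x ∈ box J) (hy : y ∈ box J)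
    (hxy : ∀ j ∈ T, x j = y j) : f x = f y := by
  have hd : ∀ z ∈ box J, DifferentiableAt ℝ f z := fun z hz =>
    differentiableAt_of_contDiffOn (isOpen_box hJ) hf hz
  have hseg : ∀ t ∈ Set.Icc (0 : ℝ) 1, x + t • (y - x) ∈ box J := fun t ht =>
    (convex_box hJ).add_smul_sub_mem hx hy ht
  have hder : ∀ t ∈ Set.Icc (0 : ℝ) 1,
      HasDerivAt (fun t : ℝ => f (x + t • (y - x))) 0 t := by
    intro t ht
    have h1 : HasDerivAt (fun t : ℝ => x + t • (y - x)) (y - x) t := by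
      simpa using ((hasDerivAt_id t).smul_const (y - x)).const_add x
    have h2 := (hd _ (hseg t ht)).hasFDerivAt.comp_hasDerivAt t h1
    suffices h : (fderiv ℝ f (x + t • (y - x))) (y - x) = 0 by rwa [h] at h2
    have h3 : y - x = ∑ j, (y j - x j) • (Pi.single j (1 : ℝ) : ι → ℝ) := by
      ext k
      simp [Finset.sum_apply, Pi.single_apply]
    have hz := hseg t ht
    generalize x + t • (y - x) = z at hz
    rw [h3, map_sum]
    refine Finset.sum_eq_zero fun j _ => ?_
    rw [map_smul]
    by_cases hj : j ∈ T
    · simp [hxy j hj]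
    · have := h0 j hj _ hz
      unfold pd at this
      rw [this, smul_zero]
  have h4 := constant_of_has_deriv_right_zero (f := fun t : ℝ => f (x + t • (y - x)))
    (a := 0) (b := 1)
    (fun t ht => (hder t ht).continuousAt.continuousWithinAt)
    (fun t ht => (hder t ⟨ht.1, ht.2.le⟩).hasDerivWithinAt) 1 (by simp)
  simpa using h4.symm

lemma Dep.pd_eq_zero (hJ : ∀ i, IsOpenInterval (J i)) (hf : ContDiffOn ℝ ∞ f (box J))
    {T : Finset ι} (hT : Dep J T f) {i : ι} (hi : i ∉ T) (hx : x ∈ box J) :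
    OrthSep.pd i f x = 0 := by
  have h1 := hasDerivAt_comp_update i (differentiableAt_of_contDiffOn (isOpen_box hJ) hf hx)
  refine h1.unique ((hasDerivAt_const _ (f x)).congr_of_eventuallyEq ?_)
  filter_upwards [(hJ i).1.mem_nhds (mem_box.1 hx i)] with t ht
  refine hT _ (update_mem_box hx ht) _ hx fun j hj => ?_
  have : j ≠ i := fun h => hi (h ▸ hj)
  simp [this]

lemma dep_of_pd_eq_zero (hJ : ∀ i, IsOpenInterval (J i)) (hf : ContDiffOn ℝ ∞ f (box J))
    {T : Finset ι} (h0 : ∀ j ∉ T, ∀ z ∈ box J, pd j f z = 0) : Dep J T f :=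
  fun _ hx _ hy hxy => eq_of_pd_eq_zero hJ hf h0 hx hy hxy

/-- If `∂ⱼ f = 0` on the box then `f` does not depend on `xⱼ`. -/
lemma update_eq_of_pd_eq_zero (hJ : ∀ i, IsOpenInterval (J i)) (hf : ContDiffOn ℝ ∞ f (box J))
    {j : ι} (h0 : ∀ z ∈ box J, pd j f z = 0) (hx : x ∈ box J) {t : ℝ} (ht : t ∈ J j) :
    f (Function.update x j t) = f x := by
  refine eq_of_pd_eq_zero hJ hf (T := Finset.univ.erase j) ?_ (update_mem_box hx ht) hx ?_
  · intro k hk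
    have : k = j := by simpa using hk
    subst this; exact h0
  · intro k hk
    have : k ≠ j := by simpa using hk
    simp [this]

lemma contDiffOn_comp_update (hf : ContDiffOn ℝ ∞ f (box J)) (hx : x ∈ box J) (i : ι) :
    ContDiffOn ℝ ∞ (fun t => f (Function.update x i t)) (J i) :=
  hf.comp (contDiff_update ∞ x i).contDiffOn fun _ ht => update_mem_box hx ht

end Basics

end OrthSep

namespace OrthSep

/-! ### Stäckel systems and the Levi-Civita equations -/

section Staeckel

variable {ι : Type*} [Fintype ι] [DecidableEq ι]

/-- The logarithmic derivative `∂ⱼ log |gᵢ|`. -/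
noncomputable def logpd (g : ι → (ι → ℝ) → ℝ) (i j : ι) (x : ι → ℝ) : ℝ :=
  pd j (g i) x / g i x

/-- Near `x₀` the inverse metric is, up to constants, a row of the inverse of a Stäckel matrix:
a matrix whose `i`-th row depends on `xᵢ` only. -/
def StaeckelAt (U : Set (ι → ℝ)) (g : ι → (ι → ℝ) → ℝ) (x₀ : ι → ℝ) : Prop :=
  ∃ (K : ι → Set ℝ) (u : ι → ι → ℝ → ℝ) (E : ι → ℝ),
    (∀ i, IsOpenInterval (K i)) ∧ x₀ ∈ box K ∧ box K ⊆ U ∧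
    (∀ j i, ContDiffOn ℝ ∞ (u j i) (K i)) ∧
    (∀ j, ∀ x ∈ box K, ∑ i, (g i x)⁻¹ * u j i (x i) = E j) ∧
    ∀ c : ι → ℝ, (∀ i, ∑ j, c j * u j i (x₀ i) = 0) → c = 0

lemma det_ne_zero_of_mulVec {M : Matrix ι ι ℝ}
    (h : ∀ c : ι → ℝ, (∀ i, ∑ j, c j * M i j = 0) → c = 0) : M.det ≠ 0 := by
  intro hdet
  obtain ⟨v, hv, hMv⟩ := Matrix.exists_mulVec_eq_zero_iff.2 hdet
  refine hv (h v fun i => ?_)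
  have := congrFun hMv i
  simp only [Matrix.mulVec, dotProduct, Pi.zero_apply] at this
  rw [← this]
  exact Finset.sum_congr rfl fun j _ => mul_comm _ _

lemma eq_zero_of_vecMul {M : Matrix ι ι ℝ} (hM : M.det ≠ 0) {v : ι → ℝ}
    (h : ∀ j, ∑ i, v i * M i j = 0) : v = 0 := by
  by_contra hv
  exact hM (Matrix.exists_vecMul_eq_zero_iff.1 ⟨v, hv, funext fun j => h j⟩)

variable {U : Set (ι → ℝ)} {g : ι → (ι → ℝ) → ℝ} {x x₀ : ι → ℝ}

lemma contDiffOn_logpd (hU : IsOpen U) {i : ι} (hg : ContDiffOn ℝ ∞ (g i) U)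
    (h0 : ∀ x ∈ U, g i x ≠ 0) (j : ι) : ContDiffOn ℝ ∞ (logpd g i j) U :=
  (contDiffOn_pd hU hg j).div hg h0

lemma pd_inv_eq_logpd {i : ι} (hg : DifferentiableAt ℝ (g i) x) (h0 : g i x ≠ 0) (k : ι) :
    pd k (fun y => (g i y)⁻¹) x = -logpd g i k x * (g i x)⁻¹ := by
  rw [pd_inv k hg h0, logpd]
  field_simp

lemma pd_eq_logpd {i : ι} (h0 : g i x ≠ 0) (k : ι) : pd k (g i) x = logpd g i k x * g i x := by
  rw [logpd]
  field_simp

/-- Both sides are the mixed second derivative of log|g_i|; the quotient rule reduces the claim to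
the symmetry of the second derivatives of g_i. -/
lemma pd_logpd_comm (hU : IsOpen U) {i : ι} (hg : ContDiffOn ℝ ∞ (g i) U)
    (h0 : ∀ x ∈ U, g i x ≠ 0) (hx : x ∈ U) (j k : ι) :
    pd j (logpd g i k) x = pd k (logpd g i j) x := by
  have hgd := differentiableAt_of_contDiffOn hU hg hx
  have e : ∀ a b, pd a (logpd g i b) x = (pd a (pd b (g i)) x * g i x
      - pd b (g i) x * pd a (g i) x) / g i x ^ 2 := fun a b =>
    pd_div a (differentiableAt_of_contDiffOn hU (contDiffOn_pd hU hg b) hx) hgd (h0 x hx)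
  rw [e, e, pd_comm hU hg hx]
  ring

lemma pd_sum_mul_comp_eval {K : ι → Set ℝ} (hK : ∀ i, IsOpenInterval (K i))
    {F : ι → (ι → ℝ) → ℝ} (hF : ∀ i, ContDiffOn ℝ ∞ (F i) (box K)) {u : ι → ℝ → ℝ}
    (hu : ∀ i, ContDiffOn ℝ ∞ (u i) (K i)) (hx : x ∈ box K) (k : ι) :
    pd k (fun y => ∑ i, F i y * u i (y i)) x =
      ∑ i, pd k (F i) x * u i (x i) + F k x * deriv (u k) (x k) := by
  have hV := isOpen_box hK
  have hF' : ∀ i, DifferentiableAt ℝ (F i) x := fun i => differentiableAt_of_contDiffOn hV (hF i) hx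
  have hu' : ∀ i, DifferentiableAt ℝ (u i) (x i) := fun i =>
    differentiableAt_of_contDiffOn (hK i).1 (hu i) (mem_box.1 hx i)
  have hu'' : ∀ i, DifferentiableAt ℝ (fun y : ι → ℝ => u i (y i)) x := fun i =>
    differentiableAt_comp_eval (hu' i)
  rw [pd_sum _ _ fun i _ => (hF' i).fun_mul (hu'' i),
    Finset.sum_congr rfl fun i _ => pd_mul k (hF' i) (hu'' i), Finset.sum_add_distrib]
  congr 1
  rw [Finset.sum_eq_single k]
  · rw [pd_comp_eval_self k (hu' k)]
  · intro i _ hi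
    rw [pd_comp_eval_of_ne hi.symm (hu' i), mul_zero]
  · simp

/-- A Stäckel system forces the Levi-Civita equations. -/
theorem StaeckelAt.leviCivita (hU : IsOpen U) (hg : IsOrthMetric U g) (hx₀ : x₀ ∈ U)
    (hS : StaeckelAt U g x₀) (i : ι) {k l : ι} (hkl : k ≠ l) :
    pd l (logpd g i k) x₀ = logpd g i k x₀ * logpd g i l x₀
      - logpd g l k x₀ * logpd g i l x₀ - logpd g k l x₀ * logpd g i k x₀ := by
  obtain ⟨K, u, E, hK, hxK, hKU, hu, hE, hker⟩ := hS
  have hV := isOpen_box hK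
  set f : ι → (ι → ℝ) → ℝ := fun i y => (g i y)⁻¹ with hf
  have hfs : ∀ i, ContDiffOn ℝ ∞ (f i) (box K) := fun i =>
    ((hg i).1.inv (hg i).2).mono hKU
  have hfne : ∀ i, f i x₀ ≠ 0 := fun i => inv_ne_zero ((hg i).2 _ hx₀)
  have hder : ∀ j k, ∀ x ∈ box K,
      ∑ i, pd k (f i) x * u j i (x i) + f k x * deriv (u j k) (x k) = 0 := by
    intro j k x hx
    rw [← pd_sum_mul_comp_eval hK hfs (hu j) hx k, pd_congr_of_eqOn hV hx (hE j) k, pd_const]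
  have hdd : ∀ j, ∑ i, pd l (pd k (f i)) x₀ * u j i (x₀ i) + pd k (f l) x₀ * deriv (u j l) (x₀ l)
      + pd l (f k) x₀ * deriv (u j k) (x₀ k) = 0 := by
    intro j
    have hu' : ContDiffOn ℝ ∞ (deriv (u j k)) (K k) :=
      ((contDiffOn_infty_iff_deriv_of_isOpen (hK k).1).1 (hu j k)).2
    have hu'd : DifferentiableAt ℝ (deriv (u j k)) (x₀ k) :=
      differentiableAt_of_contDiffOn (hK k).1 hu' (mem_box.1 hxK k)
    have hpf : ∀ i, ContDiffOn ℝ ∞ (pd k (f i)) (box K) := fun i => contDiffOn_pd hV (hfs i) k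
    have h1 := pd_congr_of_eqOn hV hxK (hder j k) l
    have hu'e : DifferentiableAt ℝ (fun y : ι → ℝ => deriv (u j k) (y k)) x₀ :=
      differentiableAt_comp_eval hu'd
    have hfk := differentiableAt_of_contDiffOn hV (hfs k) hxK
    have hue : ∀ i, DifferentiableAt ℝ (fun y : ι → ℝ => u j i (y i)) x₀ := fun i =>
      differentiableAt_comp_eval (differentiableAt_of_contDiffOn (hK i).1 (hu j i)
        (mem_box.1 hxK i))
    have hsum : DifferentiableAt ℝ (fun y => ∑ i, pd k (f i) y * u j i (y i)) x₀ :=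
      DifferentiableAt.fun_sum fun i _ =>
        (differentiableAt_of_contDiffOn hV (hpf i) hxK).fun_mul (hue i)
    rw [pd_const, pd_add l hsum (hfk.fun_mul hu'e), pd_sum_mul_comp_eval hK hpf (hu j) hxK,
      pd_mul l hfk hu'e, pd_comp_eval_of_ne hkl.symm hu'd, mul_zero, add_zero] at h1
    exact h1
  -- The once-differentiated identities determine the derivatives of `u j l` and `u j k`.
  -- Substituted into the twice-differentiated one, they leave ∑_i v_i u_ji = 0 with a vector v that
  -- does not depend on j, so nondegeneracy gives v = 0. This is the Levi-Civita equation written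
  -- for 1/g_i.
  have hv : (fun i => pd l (pd k (f i)) x₀ - pd k (f l) x₀ / f l x₀ * pd l (f i) x₀
      - pd l (f k) x₀ / f k x₀ * pd k (f i) x₀) = 0 := by
    refine eq_zero_of_vecMul (M := Matrix.of fun i j => u j i (x₀ i))
      (det_ne_zero_of_mulVec hker) fun j => ?_
    have h1 := hdd j
    have h2 := hder j l x₀ hxK
    have h3 := hder j k x₀ hxK
    simp only [Matrix.of_apply, sub_mul, Finset.sum_sub_distrib, mul_assoc, ← Finset.mul_sum]
    have h4 : deriv (u j l) (x₀ l) = -(∑ i, pd l (f i) x₀ * u j i (x₀ i)) / f l x₀ := by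
      rw [eq_div_iff (hfne l)]; linarith
    have h5 : deriv (u j k) (x₀ k) = -(∑ i, pd k (f i) x₀ * u j i (x₀ i)) / f k x₀ := by
      rw [eq_div_iff (hfne k)]; linarith
    rw [h4, h5] at h1
    linear_combination h1
  have hvi := congrFun hv i
  simp only [Pi.zero_apply] at hvi
  have hgd : ∀ i, ∀ y ∈ U, DifferentiableAt ℝ (g i) y := fun i y hy =>
    differentiableAt_of_contDiffOn hU (hg i).1 hy
  have hfd : ∀ i k, ∀ y ∈ U, pd k (f i) y = -logpd g i k y * f i y := fun i k y hy =>
    pd_inv_eq_logpd (hgd i y hy) ((hg i).2 y hy) k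
  have hA : DifferentiableAt ℝ (logpd g i k) x₀ :=
    differentiableAt_of_contDiffOn hU (contDiffOn_logpd hU (hg i).1 (hg i).2 k) hx₀
  have hff : pd l (pd k (f i)) x₀
      = -pd l (logpd g i k) x₀ * f i x₀ + logpd g i k x₀ * logpd g i l x₀ * f i x₀ := by
    rw [pd_congr_of_eqOn hU hx₀ (hfd i k) l,
      pd_mul l hA.fun_neg ((hgd i x₀ hx₀).fun_inv ((hg i).2 x₀ hx₀)), pd_neg, hfd i l x₀ hx₀]
    ring
  rw [hff, hfd l k x₀ hx₀, hfd i l x₀ hx₀, hfd k l x₀ hx₀, hfd i k x₀ hx₀,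
    mul_div_assoc, mul_div_assoc, div_self (hfne l), div_self (hfne k)] at hvi
  have h6 := mul_left_cancel₀ (hfne i) (a := f i x₀) (b := -pd l (logpd g i k) x₀ +
    (logpd g i k x₀ * logpd g i l x₀
      - logpd g l k x₀ * logpd g i l x₀ - logpd g k l x₀ * logpd g i k x₀)) (c := 0) (by
      linear_combination hvi)
  linarith

end Staeckel

end OrthSep

namespace OrthSep

/-! ### Separable coordinates have a Stäckel system -/

section Separable

variable {ι : Type*} [Fintype ι] [DecidableEq ι]
  {U : Set (ι → ℝ)} {g : ι → (ι → ℝ) → ℝ} {x x₀ : ι → ℝ}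

lemma diagMetric_inv (h0 : ∀ i, g i x ≠ 0) :
    (diagMetric g x)⁻¹ = Matrix.diagonal fun i => (g i x)⁻¹ := by
  refine Matrix.inv_eq_right_inv ?_
  rw [diagMetric, Matrix.diagonal_mul_diagonal, ← Matrix.diagonal_one]
  congr 1
  funext i
  exact mul_inv_cancel₀ (h0 i)

lemma hamiltonian_diagMetric (h0 : ∀ i, g i x ≠ 0) (p : ι → ℝ) :
    hamiltonian (diagMetric g) x p = (1 / 2) * ∑ i, (g i x)⁻¹ * p i ^ 2 := by
  rw [hamiltonian, diagMetric_inv h0]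
  congr 1
  refine Finset.sum_congr rfl fun i _ => ?_
  rw [Finset.sum_eq_single i]
  · rw [Matrix.diagonal_apply_eq]; ring
  · intro j _ hj
    rw [Matrix.diagonal_apply_ne _ hj.symm]; ring
  · simp

/-- For a jointly smooth `W`, the derivative in the real variable is jointly smooth. -/
lemma contDiffOn_deriv_fst {E : Type*} [NormedAddCommGroup E] [NormedSpace ℝ E] {K : Set ℝ}
    {C : Set E} (hK : IsOpen K) (hC : IsOpen C) {W : ℝ → E → ℝ}
    (hW : ContDiffOn ℝ ∞ (fun q : ℝ × E => W q.1 q.2) (K ×ˢ C)) :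
    ContDiffOn ℝ ∞ (fun q : ℝ × E => deriv (fun t => W t q.2) q.1) (K ×ˢ C) := by
  have h1 : ContDiffOn ℝ ∞ (fun q : ℝ × E =>
      fderiv ℝ (fun q : ℝ × E => W q.1 q.2) q ((1 : ℝ), (0 : E))) (K ×ˢ C) :=
    ((contDiffOn_infty_iff_fderiv_of_isOpen (hK.prod hC)).1 hW).2.clm_apply contDiffOn_const
  refine h1.congr fun q hq => ?_
  have h2 := (differentiableAt_of_contDiffOn (hK.prod hC) hW hq).hasFDerivAt
  have h3 : HasDerivAt (fun t : ℝ => (t, q.2)) ((1 : ℝ), (0 : E)) q.1 :=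
    (hasDerivAt_id q.1).prodMk (hasDerivAt_const _ _)
  exact (HasFDerivAt.comp_hasDerivAt (f := fun t : ℝ => (t, q.2)) q.1 h2 h3).deriv

/-- A map with invertible derivative takes a value with no vanishing coordinate. -/
lemma exists_forall_ne_zero {C : Set (ι → ℝ)} (hC : IsOpen C) (hne : C.Nonempty)
    {p : ι → (ι → ℝ) → ℝ} (hp : ∀ i, ContDiffOn ℝ ∞ (p i) C)
    (hdet : ∀ c ∈ C, (Matrix.of fun i j => pd j (p i) c).det ≠ 0) :
    ∃ c ∈ C, ∀ i, p i c ≠ 0 := by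
  obtain ⟨c, hc⟩ := hne
  have hP : ContDiffAt ℝ ∞ (fun c i => p i c) c :=
    contDiffAt_pi.2 fun i => (hp i).contDiffAt (hC.mem_nhds hc)
  have hs : HasStrictFDerivAt (fun c i => p i c) (fderiv ℝ (fun c i => p i c) c) c :=
    hP.hasStrictFDerivAt (by simp)
  have hentry : ∀ v i, fderiv ℝ (fun c i => p i c) c v i
      = ∑ j, pd j (p i) c * v j := by
    intro v i
    have hpi : ∀ i, DifferentiableAt ℝ (p i) c := fun i =>
      differentiableAt_of_contDiffOn hC (hp i) hc
    rw [fderiv_pi hpi]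
    have hv : v = ∑ j, v j • (Pi.single j (1 : ℝ) : ι → ℝ) := by
      ext k
      simp [Finset.sum_apply, Pi.single_apply]
    change fderiv ℝ (p i) c v = _
    conv_lhs => rw [hv]
    rw [map_sum]
    refine Finset.sum_congr rfl fun j _ => ?_
    rw [map_smul, smul_eq_mul, mul_comm]
    rfl
  have hinj : Function.Injective (fderiv ℝ (fun c i => p i c) c) := by
    rw [injective_iff_map_eq_zero]
    intro v hv
    by_contra hv0
    refine hdet c hc (Matrix.exists_mulVec_eq_zero_iff.1 ⟨v, hv0, ?_⟩)
    funext i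
    rw [← hv, hentry]
    rfl
  have hsurj : Function.Surjective (fderiv ℝ (fun c i => p i c) c) :=
    LinearMap.injective_iff_surjective (f := (fderiv ℝ (fun c i => p i c) c).toLinearMap) |>.1 hinj
  -- A strictly differentiable map with surjective derivative is locally open, so the image of `C`
  -- is a neighbourhood and meets the dense complement of the coordinate hyperplanes.
  have hmap := hs.map_nhds_eq_of_surj (LinearMap.range_eq_top.2 hsurj)
  have himg : (fun c i => p i c) '' C ∈ nhds (fun i => p i c) := by
    rw [← hmap]
    exact Filter.image_mem_map (hC.mem_nhds hc)
  have hdense : Dense {v : ι → ℝ | ∀ i, v i ≠ 0} := by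
    have := dense_pi (Set.univ : Set ι) (s := fun _ : ι => ({0}ᶜ : Set ℝ))
      fun i _ => dense_compl_singleton 0
    convert this using 1
    ext v
    simp
  obtain ⟨v, ⟨c', hc', rfl⟩, hv⟩ := hdense.inter_nhds_nonempty himg |>.imp fun v hv => hv.symm
  exact ⟨c', hc', hv⟩

/-- With p_i = ∂W_i/∂x_i, differentiating ½ ∑ p_i²/g_i = E(c) in c_j gives ∑_i (1/g_i) p_i ∂p_i/∂c_j
= ∂E/∂c_j, whence u_ji = p_i ∂p_i/∂c_j at one fixed c. The resulting matrix at x₀ is the mixed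
Hessian of W with row i multiplied by p_i, so c has to be chosen with every p_i(x₀_i, c) nonzero. -/
theorem staeckelAt_of_isSeparable (hg : IsOrthMetric U g)
    (hsep : IsSeparable U (diagMetric g)) (hx₀ : x₀ ∈ U) : StaeckelAt U g x₀ := by
  obtain ⟨K, C, W, E, hK, hxK, hKU, hC, hCne, hW, hHJ⟩ := hsep x₀ hx₀
  set p : ι → ℝ → (ι → ℝ) → ℝ := fun i t c => deriv (fun t => W i t c) t with hpdef
  have hp : ∀ i, ContDiffOn ℝ ∞ (fun q : ℝ × (ι → ℝ) => p i q.1 q.2) (K i ×ˢ C) := fun i =>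
    contDiffOn_deriv_fst (hK i).1 hC (hW i)
  have hpc : ∀ i, ∀ t ∈ K i, ContDiffOn ℝ ∞ (p i t) C := fun i t ht =>
    (hp i).comp (contDiff_prodMk_right t).contDiffOn fun c hc => ⟨ht, hc⟩
  obtain ⟨c, hc, hne⟩ := exists_forall_ne_zero hC hCne (p := fun i => p i (x₀ i))
    (fun i => hpc i _ (mem_box.1 hxK i)) fun c hc => (hHJ x₀ hxK c hc).2
  refine ⟨K, fun j i t => p i t c * pd j (p i t) c, fun j => pd j E c, hK, hxK, hKU, ?_, ?_, ?_⟩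
  · intro j i
    have hin : ContDiffOn ℝ ∞ (fun t : ℝ => (t, c)) (K i) :=
      (contDiff_prodMk_left c).contDiffOn
    have h1 : ContDiffOn ℝ ∞ (fun t => p i t c) (K i) :=
      (hp i).comp hin fun t ht => ⟨ht, hc⟩
    have h2 : ContDiffOn ℝ ∞ (fun q : ℝ × (ι → ℝ) =>
        fderiv ℝ (fun q : ℝ × (ι → ℝ) => p i q.1 q.2) q ((0 : ℝ), Pi.single j (1 : ℝ)))
        (K i ×ˢ C) :=
      ((contDiffOn_infty_iff_fderiv_of_isOpen ((hK i).1.prod hC)).1 (hp i)).2.clm_apply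
        contDiffOn_const
    have h3 : ContDiffOn ℝ ∞ (fun t => pd j (p i t) c) (K i) := by
      refine (h2.comp hin fun t ht => ⟨ht, hc⟩).congr fun t ht => ?_
      have h4 := (differentiableAt_of_contDiffOn ((hK i).1.prod hC) (hp i)
        (x := (t, c)) ⟨ht, hc⟩).hasFDerivAt
      have h5 : HasFDerivAt (fun c' : ι → ℝ => (t, c')) (ContinuousLinearMap.inr ℝ ℝ (ι → ℝ)) c :=
        hasFDerivAt_prodMk_right t c
      have h6 := HasFDerivAt.comp (f := fun c' : ι → ℝ => (t, c')) c h4 h5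
      have h7 : fderiv ℝ (p i t) c = _ := h6.fderiv
      rw [pd, h7]
      simp
    exact h1.mul h3
  · intro j x hx
    have hx0 : ∀ i, g i x ≠ 0 := fun i => (hg i).2 x (hKU hx)
    have hpd : ∀ i, DifferentiableAt ℝ (p i (x i)) c := fun i =>
      differentiableAt_of_contDiffOn hC (hpc i _ (mem_box.1 hx i)) hc
    have h1 : Set.EqOn E (fun c => (1 / 2) * ∑ i, (g i x)⁻¹ * p i (x i) c ^ 2) C := by
      intro c hc
      rw [← (hHJ x hx c hc).1, hamiltonian_diagMetric hx0]
    have hd : ∀ i, DifferentiableAt ℝ (fun c => (g i x)⁻¹ * p i (x i) c ^ 2) c := fun i =>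
      ((hpd i).fun_pow 2).const_mul _
    beta_reduce
    rw [pd_congr_of_eqOn hC hc h1 j, pd_const_mul _ _ (DifferentiableAt.fun_sum fun i _ => hd i),
      pd_sum _ _ fun i _ => hd i, Finset.mul_sum]
    refine Finset.sum_congr rfl fun i _ => ?_
    rw [pd_const_mul _ _ ((hpd i).fun_pow 2)]
    simp only [pow_two]
    rw [pd_mul _ (hpd i) (hpd i)]
    ring
  · intro v hv
    by_contra hv0
    refine (hHJ x₀ hxK c hc).2 (Matrix.exists_mulVec_eq_zero_iff.1 ⟨v, hv0, ?_⟩)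
    funext i
    refine mul_left_cancel₀ (hne i) ?_
    rw [Pi.zero_apply, mul_zero, ← hv i, Matrix.mulVec, dotProduct, Finset.mul_sum]
    refine Finset.sum_congr rfl fun j _ => ?_
    rw [Matrix.of_apply]
    ring

end Separable

end OrthSep

namespace OrthSep

/-! ### Curvature of orthogonal metrics -/

section Curvature

variable {ι : Type*} [Fintype ι] [DecidableEq ι]
  {U : Set (ι → ℝ)} {g : ι → (ι → ℝ) → ℝ} {x : ι → ℝ}

lemma pd_diagMetric (l i j : ι) :
    pd l (fun y => diagMetric g y i j) x = if i = j then pd l (g i) x else 0 := by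
  by_cases h : i = j
  · subst h; simp [diagMetric]
  · simp [diagMetric, h, pd_const]

lemma christoffel_diagMetric (h0 : ∀ i, g i x ≠ 0) (k i j : ι) :
    christoffel (diagMetric g) k i j x = (1 / 2) * ((g k x)⁻¹ *
      ((if j = k then pd i (g j) x else 0) + (if i = k then pd j (g i) x else 0)
        - (if i = j then pd k (g i) x else 0))) := by
  rw [christoffel, diagMetric_inv h0, Finset.sum_eq_single k]
  · rw [Matrix.diagonal_apply_eq]
    simp only [pd_diagMetric]
  · intro l _ hl
    rw [Matrix.diagonal_apply_ne _ hl.symm, zero_mul]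
  · simp

lemma christoffel_of_distinct (h0 : ∀ i, g i x ≠ 0) {k i j : ι} (hki : k ≠ i) (hkj : k ≠ j)
    (hij : i ≠ j) : christoffel (diagMetric g) k i j x = 0 := by
  rw [christoffel_diagMetric h0]
  simp [hki.symm, hkj.symm, hij]

lemma christoffel_left (h0 : ∀ i, g i x ≠ 0) (k j : ι) :
    christoffel (diagMetric g) k k j x = (1 / 2) * logpd g k j x := by
  rw [christoffel_diagMetric h0, logpd]
  by_cases h : j = k
  · subst h; simp; ring
  · simp [h, Ne.symm h]; ring

lemma christoffel_right (h0 : ∀ i, g i x ≠ 0) (k j : ι) :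
    christoffel (diagMetric g) k j k x = (1 / 2) * logpd g k j x := by
  rw [christoffel_diagMetric h0, logpd]
  by_cases h : j = k
  · subst h; simp; ring
  · simp [h]; ring

lemma christoffel_lower_eq (h0 : ∀ i, g i x ≠ 0) {k j : ι} (h : k ≠ j) :
    christoffel (diagMetric g) k j j x = -(1 / 2) * ((g k x)⁻¹ * pd k (g j) x) := by
  rw [christoffel_diagMetric h0]
  simp [h.symm]

lemma riemann_diagMetric (l k i j : ι) :
    riemann (diagMetric g) l k i j x = g l x * riemannUp (diagMetric g) l k i j x := by
  rw [riemann, Finset.sum_eq_single l]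
  · simp [diagMetric]
  · intro m _ hm
    simp [diagMetric, hm.symm]
  · simp

lemma sum_eq_add_pair {i j : ι} (hij : i ≠ j) {f : ι → ℝ} (h : ∀ m, m ≠ i → m ≠ j → f m = 0) :
    ∑ m, f m = f i + f j := by
  rw [← Finset.sum_pair hij]
  refine (Finset.sum_subset (Finset.subset_univ _) fun m _ hm => ?_).symm
  simp only [Finset.mem_insert, Finset.mem_singleton, not_or] at hm
  exact h m hm.1 hm.2

/-- Christoffel symbols with three distinct indices vanish for an orthogonal metric, so only m = j
and m = k survive in the first quadratic sum and only m = i in the second. -/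
lemma riemannUp_of_distinct (hU : IsOpen U) (hg : IsOrthMetric U g) (hx : x ∈ U) {i j k : ι}
    (hij : i ≠ j) (hik : i ≠ k) (hjk : j ≠ k) :
    riemannUp (diagMetric g) i j i k x = -(1 / 2) * pd k (logpd g i j) x +
      (1 / 4) * (logpd g i k x * logpd g k j x + logpd g i j x * logpd g j k x
        - logpd g i k x * logpd g i j x) := by
  have h0 : ∀ y ∈ U, ∀ i, g i y ≠ 0 := fun y hy i => (hg i).2 y hy
  have hx0 := h0 x hx
  have hA : DifferentiableAt ℝ (logpd g i j) x :=
    differentiableAt_of_contDiffOn hU (contDiffOn_logpd hU (hg i).1 (hg i).2 j) hx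
  have h1 : pd i (christoffel (diagMetric g) i k j) x = 0 := by
    rw [pd_congr_of_eqOn hU hx (h := fun _ => 0)
      (fun y hy => christoffel_of_distinct (h0 y hy) hik hij hjk.symm), pd_const]
  have h2 : pd k (christoffel (diagMetric g) i i j) x = (1 / 2) * pd k (logpd g i j) x := by
    rw [pd_congr_of_eqOn hU hx (h := fun y => (1 / 2) * logpd g i j y)
      (fun y hy => christoffel_left (h0 y hy) i j), pd_const_mul k _ hA]
  have h3 : ∑ m, christoffel (diagMetric g) i i m x * christoffel (diagMetric g) m k j x
      = (1 / 4) * (logpd g i k x * logpd g k j x + logpd g i j x * logpd g j k x) := by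
    rw [sum_eq_add_pair hjk]
    · rw [christoffel_left hx0, christoffel_left hx0, christoffel_left hx0,
        christoffel_right hx0]
      ring
    · intro m hmj hmk
      rw [christoffel_of_distinct hx0 hmk hmj hjk.symm, mul_zero]
  have h4 : ∑ m, christoffel (diagMetric g) i k m x * christoffel (diagMetric g) m i j x
      = (1 / 4) * (logpd g i k x * logpd g i j x) := by
    rw [Finset.sum_eq_single i]
    · rw [christoffel_left hx0, christoffel_right hx0]
      ring
    · intro m _ hmi
      by_cases hmk : m = k
      · subst hmk
        rw [christoffel_of_distinct hx0 hmi hjk.symm hij, mul_zero]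
      · rw [christoffel_of_distinct hx0 hik hmi.symm (Ne.symm hmk), zero_mul]
    · simp
  rw [riemannUp, h1, h2, Finset.sum_sub_distrib, h3, h4]
  ring

/-- Diagonal curvature as defined also quantifies over components with a repeated index in the first
pair; these vanish by antisymmetry and impose nothing. -/
lemma riemannUp_self_left (hU : IsOpen U) (hg : IsOrthMetric U g) (hx : x ∈ U) {i k : ι}
    (hik : i ≠ k) : riemannUp (diagMetric g) i i i k x = 0 := by
  have h0 : ∀ y ∈ U, ∀ i, g i y ≠ 0 := fun y hy i => (hg i).2 y hy
  have hx0 := h0 x hx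
  have hA : ∀ k, DifferentiableAt ℝ (logpd g i k) x := fun k =>
    differentiableAt_of_contDiffOn hU (contDiffOn_logpd hU (hg i).1 (hg i).2 k) hx
  have h1 : pd i (christoffel (diagMetric g) i k i) x = (1 / 2) * pd i (logpd g i k) x := by
    rw [pd_congr_of_eqOn hU hx (h := fun y => (1 / 2) * logpd g i k y)
      (fun y hy => christoffel_right (h0 y hy) i k), pd_const_mul i _ (hA k)]
  have h2 : pd k (christoffel (diagMetric g) i i i) x = (1 / 2) * pd k (logpd g i i) x := by
    rw [pd_congr_of_eqOn hU hx (h := fun y => (1 / 2) * logpd g i i y)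
      (fun y hy => christoffel_right (h0 y hy) i i), pd_const_mul k _ (hA i)]
  have h3 := pd_logpd_comm hU (hg i).1 (hg i).2 hx i k
  rw [riemannUp, h1, h2, h3, sum_eq_add_pair hik]
  · rw [christoffel_right hx0, christoffel_right hx0, christoffel_left hx0,
      christoffel_left hx0, christoffel_lower_eq hx0 hik, christoffel_lower_eq hx0 hik.symm]
    simp only [logpd]
    ring
  · intro m hmi hmk
    rw [christoffel_of_distinct hx0 hmk hmi hik.symm,
      christoffel_of_distinct hx0 hik hmi.symm hmk.symm]
    ring

/-- Diagonal curvature of an orthogonal metric in terms of logarithmic derivatives. -/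
theorem hasDiagonalCurvature_iff (hU : IsOpen U) (hg : IsOrthMetric U g) :
    HasDiagonalCurvature U (diagMetric g) ↔ ∀ x ∈ U, ∀ i j k : ι, i ≠ j → i ≠ k → j ≠ k →
      2 * pd k (logpd g i j) x = logpd g i k x * logpd g k j x + logpd g i j x * logpd g j k x
        - logpd g i k x * logpd g i j x := by
  refine forall₂_congr fun x hx => ⟨fun h i j k hij hik hjk => ?_, fun h i j k hjk => ?_⟩
  · have h1 := h i j k hjk
    rw [riemann_diagMetric, riemannUp_of_distinct hU hg hx hij hik hjk] at h1
    have h2 := (mul_eq_zero.1 h1).resolve_left ((hg i).2 x hx)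
    linarith
  · rw [riemann_diagMetric]
    by_cases hij : i = j
    · subst hij
      rw [riemannUp_self_left hU hg hx hjk, mul_zero]
    by_cases hik : i = k
    · subst hik
      simp [riemannUp]
    · rw [riemannUp_of_distinct hU hg hx hij hik hjk]
      have := h i j k hij hik hjk
      rw [show -(1 / 2) * pd k (logpd g i j) x + (1 / 4) * (logpd g i k x * logpd g k j x
        + logpd g i j x * logpd g j k x - logpd g i k x * logpd g i j x) = 0 by linarith, mul_zero]

end Curvature

end OrthSep

namespace OrthSep

/-! ### Smooth dependence of integrals on parameters -/

section Primitive

open MeasureTheory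

universe v

/-- Differentiation under the integral sign: the derivative of the integrand is bounded on the
compact product of a closed ball with [0, 1], and a constant serves as dominating function. -/
lemma hasFDerivAt_integral_param {H F : Type*} [NormedAddCommGroup H] [NormedSpace ℝ H]
    [FiniteDimensional ℝ H] [NormedAddCommGroup F] [NormedSpace ℝ F] {V : Set H}
    (hV : IsOpen V) {Ω : Set (H × ℝ)} (hΩ : IsOpen Ω)
    (hVΩ : ∀ q ∈ V, ∀ s ∈ Set.Icc (0 : ℝ) 1, (q, s) ∈ Ω) {P : H × ℝ → F}
    (hP : ContDiffOn ℝ ∞ P Ω) {q : H} (hq : q ∈ V) :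
    HasFDerivAt (fun q => ∫ s in (0 : ℝ)..1, P (q, s))
      (∫ s in (0 : ℝ)..1, (fderiv ℝ P (q, s)).comp (ContinuousLinearMap.inl ℝ H ℝ)) q := by
  have hP' : ContDiffOn ℝ ∞
      (fun z => (fderiv ℝ P z).comp (ContinuousLinearMap.inl ℝ H ℝ)) Ω :=
    ((contDiffOn_infty_iff_fderiv_of_isOpen hΩ).1 hP).2.clm_comp contDiffOn_const
  have : ProperSpace H := FiniteDimensional.proper ℝ H
  obtain ⟨ε, hε, hball⟩ := Metric.nhds_basis_closedBall.mem_iff.1 (hV.mem_nhds hq)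
  have hcomp : IsCompact (Metric.closedBall q ε ×ˢ Set.Icc (0 : ℝ) 1) :=
    (isCompact_closedBall q ε).prod isCompact_Icc
  obtain ⟨B, hB⟩ := hcomp.exists_bound_of_continuousOn
    (hP'.continuousOn.mono fun z hz => hVΩ z.1 (hball hz.1) z.2 hz.2)
  have hIoc : ∀ {t : ℝ}, t ∈ Set.uIoc (0 : ℝ) 1 → t ∈ Set.Icc (0 : ℝ) 1 := fun {t} ht => by
    rw [Set.uIoc_of_le zero_le_one] at ht
    exact ⟨ht.1.le, ht.2⟩
  refine intervalIntegral.hasFDerivAt_integral_of_dominated_of_fderiv_le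
    (F' := fun q s => (fderiv ℝ P (q, s)).comp (ContinuousLinearMap.inl ℝ H ℝ))
    (bound := fun _ => B)
    (Metric.closedBall_mem_nhds q hε) ?_ ?_ ?_ ?_ ?_ ?_
  · filter_upwards [hV.mem_nhds hq] with y hy
    exact ((hP.continuousOn.comp (Continuous.prodMk_right y).continuousOn
      fun s hs => hVΩ y hy s hs).mono fun _ => hIoc).aestronglyMeasurable measurableSet_uIoc
  · refine ContinuousOn.intervalIntegrable ?_
    rw [Set.uIcc_of_le zero_le_one]
    exact hP.continuousOn.comp (Continuous.prodMk_right q).continuousOn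
      fun s hs => hVΩ q hq s hs
  · exact ((hP'.continuousOn.comp (Continuous.prodMk_right q).continuousOn
      fun s hs => hVΩ q hq s hs).mono fun _ => hIoc).aestronglyMeasurable measurableSet_uIoc
  · exact Filter.Eventually.of_forall fun t ht y hy => hB (y, t) ⟨hy, hIoc ht⟩
  · exact intervalIntegrable_const
  · refine Filter.Eventually.of_forall fun t ht y hy => ?_
    have h1 := (differentiableAt_of_contDiffOn hΩ hP (hVΩ y (hball hy) t (hIoc ht))).hasFDerivAt
    exact HasFDerivAt.comp (f := fun y : H => (y, t)) y h1 (hasFDerivAt_prodMk_left y t)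

/-- The derivative is again a parametric integral, with values in H →L F, so the induction
quantifies over the target space. Putting `H` and `F` in one universe keeps that space admissible as
a new target. -/
lemma contDiffOn_integral_param_nat {H : Type v} [NormedAddCommGroup H] [NormedSpace ℝ H]
    [FiniteDimensional ℝ H] {V : Set H} (hV : IsOpen V) {Ω : Set (H × ℝ)} (hΩ : IsOpen Ω)
    (hVΩ : ∀ q ∈ V, ∀ s ∈ Set.Icc (0 : ℝ) 1, (q, s) ∈ Ω) (n : ℕ) :
    ∀ {F : Type v} [NormedAddCommGroup F] [NormedSpace ℝ F] {P : H × ℝ → F},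
      ContDiffOn ℝ ∞ P Ω → ContDiffOn ℝ n (fun q => ∫ s in (0 : ℝ)..1, P (q, s)) V := by
  induction n with
  | zero =>
    intro F _ _ P hP
    rw [Nat.cast_zero, contDiffOn_zero]
    exact fun q hq =>
      (hasFDerivAt_integral_param hV hΩ hVΩ hP hq).continuousAt.continuousWithinAt
  | succ n ih =>
    intro F _ _ P hP
    rw [Nat.cast_succ, contDiffOn_succ_iff_fderiv_of_isOpen hV]
    refine ⟨fun q hq => (hasFDerivAt_integral_param hV hΩ hVΩ hP
      hq).differentiableAt.differentiableWithinAt, by simp, ?_⟩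
    have hP' : ContDiffOn ℝ ∞
        (fun z => (fderiv ℝ P z).comp (ContinuousLinearMap.inl ℝ H ℝ)) Ω :=
      ((contDiffOn_infty_iff_fderiv_of_isOpen hΩ).1 hP).2.clm_comp contDiffOn_const
    exact (ih hP').congr fun q hq => (hasFDerivAt_integral_param hV hΩ hVΩ hP hq).fderiv

/-- The substitution s = a + (t - a) r moves the variable endpoint into the integrand, leaving an
integral over [0, 1] with parameter (t, c). The target being ℝ, the shared universe above forces `E
: Type`. -/
lemma contDiffOn_primitive {E : Type} [NormedAddCommGroup E] [NormedSpace ℝ E]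
    [FiniteDimensional ℝ E] {K : Set ℝ} {C : Set E} (hK : IsOpenInterval K) (hC : IsOpen C)
    {p : ℝ × E → ℝ} (hp : ContDiffOn ℝ ∞ p (K ×ˢ C)) {a : ℝ} (ha : a ∈ K) :
    ContDiffOn ℝ ∞ (fun q : ℝ × E => ∫ s in a..q.1, p (s, q.2)) (K ×ˢ C) := by
  have hm : ContDiff ℝ ∞ fun z : (ℝ × E) × ℝ => (a + (z.1.1 - a) * z.2, z.1.2) := by fun_prop
  have h1 : ContDiffOn ℝ ∞
      (fun q : ℝ × E => ∫ s in (0 : ℝ)..1, p (a + (q.1 - a) * s, q.2)) (K ×ˢ C) := by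
    refine contDiffOn_infty.2 fun n => contDiffOn_integral_param_nat (hK.1.prod hC)
      (Ω := (fun z : (ℝ × E) × ℝ => (a + (z.1.1 - a) * z.2, z.1.2)) ⁻¹' (K ×ˢ C))
      ((hK.1.prod hC).preimage hm.continuous) ?_ n
      (P := fun z => p (a + (z.1.1 - a) * z.2, z.1.2))
      (hp.comp hm.contDiffOn fun z hz => hz)
    intro q hq s hs
    refine ⟨?_, hq.2⟩
    have := hK.2.1.convex.add_smul_sub_mem ha hq.1 hs
    simpa [mul_comm] using this
  have h2 : ContDiffOn ℝ ∞ (fun q : ℝ × E => q.1 - a) (K ×ˢ C) :=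
    (contDiff_fst.sub contDiff_const).contDiffOn
  refine (h2.mul h1).congr fun q hq => ?_
  have := intervalIntegral.smul_integral_comp_add_mul (a := 0) (b := 1)
    (fun s => p (s, q.2)) (q.1 - a) a
  simp only [smul_eq_mul, mul_zero, add_zero, mul_one, add_sub_cancel] at this
  exact this.symm

lemma hasDerivAt_primitive {K : Set ℝ} (hK : IsOpenInterval K) {p : ℝ → ℝ}
    (hp : ContinuousOn p K) {a t : ℝ} (ha : a ∈ K) (ht : t ∈ K) :
    HasDerivAt (fun t => ∫ s in a..t, p s) (p t) t := by
  refine intervalIntegral.integral_hasDerivAt_right ?_ ?_ (hp.continuousAt (hK.1.mem_nhds ht))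
  · exact (hp.mono (hK.2.1.uIcc_subset ha ht)).intervalIntegrable
  · exact hp.stronglyMeasurableAtFilter hK.1 t ht

end Primitive

/-! ### Complete integrals from Stäckel systems -/

section StaeckelSeparable

lemma box_ball {ι : Type*} [Fintype ι] (x₀ : ι → ℝ) {ε : ℝ} (hε : 0 < ε) :
    box (fun i => Metric.ball (x₀ i) ε) = Metric.ball x₀ ε :=
  (ball_pi x₀ hε).symm

lemma isOpenInterval_ball (a : ℝ) {ε : ℝ} (hε : 0 < ε) : IsOpenInterval (Metric.ball a ε) := by
  refine ⟨Metric.isOpen_ball, ?_, Metric.nonempty_ball.2 hε⟩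
  rw [Real.ball_eq_Ioo]
  exact Set.ordConnected_Ioo

variable {ι : Type} [Fintype ι] [DecidableEq ι] {U : Set (ι → ℝ)} {g : ι → (ι → ℝ) → ℝ}

lemma pd_sum_mul_const (a c : ι → ℝ) (j : ι) : pd j (fun c : ι → ℝ => ∑ k, c k * a k) c = a j := by
  have hd : ∀ k, DifferentiableAt ℝ (fun t : ℝ => t * a k) (c k) := fun k => by fun_prop
  rw [pd_sum _ _ fun k _ => differentiableAt_comp_eval (hd k), Finset.sum_eq_single j]
  · rw [pd_comp_eval_self (φ := fun t => t * a j) j (hd j)]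
    simp
  · intro k _ hk
    exact pd_comp_eval_of_ne (φ := fun t => t * a k) hk.symm (hd k)
  · simp

/-- Put q_i(t, c) = ∑_j c_j u_ji(t) and W_i = ∫ √(2 q_i). Then ½ ∑ (∂_i W_i)²/g_i = ∑_i q_i/g_i =
∑_j c_j E_j, and the mixed Hessian is the Stäckel matrix with row i divided by √(2 q_i). -/
theorem isSeparable_of_staeckelAt (hg : IsOrthMetric U g)
    (hS : ∀ x₀ ∈ U, StaeckelAt U g x₀) : IsSeparable U (diagMetric g) := by
  intro x₀ hx₀
  obtain ⟨K, u, E, hK, hxK, hKU, hu, hE, hker⟩ := hS x₀ hx₀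
  set M : (ι → ℝ) → Matrix ι ι ℝ := fun x => Matrix.of fun i j => u j i (x i) with hMdef
  have hM₀ : (M x₀).det ≠ 0 := det_ne_zero_of_mulVec hker
  set q : ι → ℝ × (ι → ℝ) → ℝ := fun i z => ∑ j, z.2 j * u j i z.1 with hqdef
  -- Invertibility of the Stäckel matrix at x₀ allows all radicands to be made equal to 1 there,
  -- hence positive for (x, c) near (x₀, c₀).
  obtain ⟨c₀, hc₀⟩ : ∃ c₀ : ι → ℝ, ∀ i, q i (x₀ i, c₀) = 1 := by
    refine ⟨(M x₀)⁻¹.mulVec 1, fun i => ?_⟩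
    have h1 : (M x₀).mulVec ((M x₀)⁻¹.mulVec 1) = 1 := by
      rw [Matrix.mulVec_mulVec, Matrix.mul_nonsing_inv _ (isUnit_iff_ne_zero.2 hM₀),
        Matrix.one_mulVec]
    have h2 := congrFun h1 i
    rw [Pi.one_apply] at h2
    rw [← h2]
    exact Finset.sum_congr rfl fun j _ => mul_comm _ _
  have hq : ∀ i, ContDiffOn ℝ ∞ (q i) (K i ×ˢ Set.univ) := fun i =>
    ContDiffOn.sum fun j _ => ContDiffOn.mul
      ((contDiff_apply ℝ ℝ j).comp contDiff_snd).contDiffOn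
      ((hu j i).comp contDiff_fst.contDiffOn fun z hz => hz.1)
  have hMc : ContinuousOn (fun x => (M x).det) (box K) := by
    refine Continuous.comp_continuousOn (f := M) (g := Matrix.det) (continuous_id.matrix_det) ?_
    refine continuousOn_pi.2 fun i => continuousOn_pi.2 fun j => ?_
    exact (hu j i).continuousOn.comp (continuous_apply i).continuousOn
      fun x hx => mem_box.1 hx i
  have hV := isOpen_box hK
  have ev1 : ∀ᶠ x in nhds x₀, (M x).det ≠ 0 :=
    (hMc.continuousAt (hV.mem_nhds hxK)).eventually_ne hM₀
  have ev2 : ∀ i, ∀ᶠ z in nhds (x₀, c₀), 0 < q i (z.1 i, z.2) := by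
    intro i
    have h1 : ContinuousAt (q i) (x₀ i, c₀) := (hq i).continuousOn.continuousAt
      (((hK i).1.prod isOpen_univ).mem_nhds ⟨mem_box.1 hxK i, trivial⟩)
    have h2 : Filter.Tendsto (fun z : (ι → ℝ) × (ι → ℝ) => (z.1 i, z.2)) (nhds (x₀, c₀))
        (nhds (x₀ i, c₀)) :=
      (((continuous_apply i).comp continuous_fst).prodMk continuous_snd).tendsto (x₀, c₀)
    refine h2.eventually (h1.eventually (lt_mem_nhds ?_))
    rw [hc₀]
    exact one_pos
  have ev : ∀ᶠ z in nhds (x₀, c₀), (z.1 ∈ box K ∧ (M z.1).det ≠ 0) ∧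
      ∀ i, 0 < q i (z.1 i, z.2) := by
    refine Filter.Eventually.and ?_ (Filter.eventually_all.2 ev2)
    exact (continuous_fst.tendsto (x₀, c₀)).eventually
      ((Filter.eventually_mem_set.2 (hV.mem_nhds hxK)).and ev1)
  obtain ⟨ε, hε, hball⟩ := Metric.eventually_nhds_iff_ball.1 ev
  have hprod : ∀ x ∈ Metric.ball x₀ ε, ∀ c ∈ Metric.ball c₀ ε,
      (x ∈ box K ∧ (M x).det ≠ 0) ∧ ∀ i, 0 < q i (x i, c) := fun x hx c hc =>
    hball (x, c) (by rw [← ball_prod_same]; exact ⟨hx, hc⟩)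
  have hc₀C : c₀ ∈ Metric.ball c₀ ε := Metric.mem_ball_self hε
  -- Balls of the sup norm are boxes, so the ball on which all conditions hold is itself an
  -- admissible coordinate box.
  set K' : ι → Set ℝ := fun i => Metric.ball (x₀ i) ε with hK'def
  have hK' : ∀ i, IsOpenInterval (K' i) := fun i => isOpenInterval_ball _ hε
  have hbox : box K' = Metric.ball x₀ ε := box_ball x₀ hε
  have hx₀K' : x₀ ∈ box K' := by rw [hbox]; exact Metric.mem_ball_self hε
  have hupd : ∀ i, ∀ t ∈ K' i, Function.update x₀ i t ∈ Metric.ball x₀ ε := fun i t ht => by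
    rw [← hbox]; exact update_mem_box hx₀K' ht
  have hKK : ∀ i, K' i ⊆ K i := fun i t ht => by
    simpa using mem_box.1 (hprod _ (hupd i t ht) c₀ hc₀C).1.1 i
  have hpos : ∀ i, ∀ t ∈ K' i, ∀ c ∈ Metric.ball c₀ ε, 0 < q i (t, c) := fun i t ht c hc => by
    simpa using (hprod _ (hupd i t ht) c hc).2 i
  have hp : ∀ i, ContDiffOn ℝ ∞ (fun z => Real.sqrt (2 * q i z))
      (K' i ×ˢ Metric.ball c₀ ε) := fun i =>
    (contDiffOn_const.mul ((hq i).mono fun z hz => ⟨hKK i hz.1, trivial⟩)).sqrt fun z hz =>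
      (mul_pos two_pos (hpos i z.1 hz.1 z.2 hz.2)).ne'
  have hderiv : ∀ i, ∀ t ∈ K' i, ∀ c ∈ Metric.ball c₀ ε,
      deriv (fun t => ∫ s in x₀ i..t, Real.sqrt (2 * q i (s, c))) t
        = Real.sqrt (2 * q i (t, c)) := fun i t ht c hc =>
    (hasDerivAt_primitive (hK' i) ((hp i).continuousOn.comp
      (Continuous.prodMk_left c).continuousOn fun s hs => ⟨hs, hc⟩)
      (Metric.mem_ball_self hε) ht).deriv
  refine ⟨K', Metric.ball c₀ ε, fun i t c => ∫ s in x₀ i..t, Real.sqrt (2 * q i (s, c)),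
    fun c => ∑ j, c j * E j, hK', hx₀K', fun x hx => hKU (hprod x (hbox ▸ hx) c₀ hc₀C).1.1,
    Metric.isOpen_ball, ⟨c₀, hc₀C⟩, fun i => contDiffOn_primitive (hK' i) Metric.isOpen_ball
      (hp i) (Metric.mem_ball_self hε), fun x hx c hc => ?_⟩
  have hxi := mem_box.1 hx
  obtain ⟨⟨hxK, hdet⟩, hqpos⟩ := hprod x (hbox ▸ hx) c hc
  constructor
  · rw [hamiltonian_diagMetric fun i => (hg i).2 x (hKU hxK)]
    have h1 : ∀ i, (g i x)⁻¹ * deriv (fun t => ∫ s in x₀ i..t, Real.sqrt (2 * q i (s, c))) (x i) ^ 2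
        = 2 * ∑ j, c j * ((g i x)⁻¹ * u j i (x i)) := by
      intro i
      rw [hderiv i _ (hxi i) c hc, Real.sq_sqrt (mul_pos two_pos (hqpos i)).le, hqdef,
        mul_left_comm, Finset.mul_sum]
      congr 1
      exact Finset.sum_congr rfl fun j _ => by ring
    rw [Finset.sum_congr rfl fun i _ => h1 i, ← Finset.mul_sum, Finset.sum_comm]
    simp only [← Finset.mul_sum]
    rw [Finset.sum_congr rfl fun j _ => congrArg (c j * ·) (hE j x hxK)]
    ring
  · have h1 : ∀ i j, pd j (fun c' =>
        deriv (fun t => ∫ s in x₀ i..t, Real.sqrt (2 * q i (s, c'))) (x i)) c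
        = (Real.sqrt (2 * q i (x i, c)))⁻¹ * M x i j := by
      intro i j
      rw [pd_congr_of_eqOn Metric.isOpen_ball hc fun c' hc' => hderiv i _ (hxi i) c' hc']
      have hs : Real.sqrt (2 * q i (x i, c)) ≠ 0 :=
        (Real.sqrt_pos.2 (mul_pos two_pos (hqpos i))).ne'
      have hd : DifferentiableAt ℝ (fun c' => Real.sqrt (2 * q i (x i, c'))) c :=
        differentiableAt_of_contDiffOn Metric.isOpen_ball ((hp i).comp
          (contDiff_prodMk_right (x i)).contDiffOn fun c' hc' => ⟨hxi i, hc'⟩) hc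
      -- Differentiating the square of the root, which is 2 q_i, instead of the root itself.
      have h2 := pd_mul j hd hd
      have hqd : DifferentiableAt ℝ (fun c' : ι → ℝ => q i (x i, c')) c := by
        simp only [hqdef]
        fun_prop
      rw [pd_congr_of_eqOn Metric.isOpen_ball hc (h := fun c' => 2 * q i (x i, c'))
        (fun c' hc' => Real.mul_self_sqrt (mul_pos two_pos (hpos i _ (hxi i) c' hc')).le),
        pd_const_mul _ _ hqd] at h2
      have h3 : pd j (fun c' : ι → ℝ => q i (x i, c')) c = M x i j :=
        pd_sum_mul_const (fun k => u k i (x i)) c j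
      rw [h3] at h2
      rw [eq_inv_mul_iff_mul_eq₀ hs]
      linarith
    simp only [h1]
    rw [Matrix.det_mul_column]
    exact mul_ne_zero (Finset.prod_ne_zero_iff.2 fun i _ =>
      inv_ne_zero (Real.sqrt_pos.2 (mul_pos two_pos (hqpos i))).ne') hdet

end StaeckelSeparable

end OrthSep

namespace OrthSep

/-! ### Stäckel systems of classified metrics -/

section Classified

variable {ι : Type*} [DecidableEq ι] {J : ι → Set ℝ} {S M : Finset ι}
  {g : ι → (ι → ℝ) → ℝ} {x x₀ : ι → ℝ}

/-- `∑_{i ∈ S} gᵢ dxᵢ²` is a smooth nondegenerate tensor on the box. -/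
def IsOrthMetricOn [Fintype ι] (J : ι → Set ℝ) (S : Finset ι) (g : ι → (ι → ℝ) → ℝ) : Prop :=
  ∀ i ∈ S, ContDiffOn ℝ ∞ (g i) (box J) ∧ ∀ x ∈ box J, g i x ≠ 0

/-- A system of Stäckel functions for `∑_{i ∈ S} gᵢ dxᵢ²`, nondegenerate at `x₀`. -/
def HasStaeckelSystem (J : ι → Set ℝ) (S : Finset ι) (g : ι → (ι → ℝ) → ℝ) (x₀ : ι → ℝ) : Prop :=
  ∃ (u : ι → ι → ℝ → ℝ) (E : ι → ℝ),
    (∀ j ∈ S, ∀ i ∈ S, ContDiffOn ℝ ∞ (u j i) (J i)) ∧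
    (∀ j ∈ S, ∀ x ∈ box J, ∑ i ∈ S, (g i x)⁻¹ * u j i (x i) = E j) ∧
    ∀ c : ι → ℝ, (∀ i ∈ S, ∑ j ∈ S, c j * u j i (x₀ i) = 0) → ∀ j ∈ S, c j = 0

/-- Each `gᵢ` is a product of functions of two variables `xᵢ, xⱼ`. -/
def HasPairFactors (J : ι → Set ℝ) (S : Finset ι) (g : ι → (ι → ℝ) → ℝ) : Prop :=
  ∃ F : ι → ι → ℝ → ℝ → ℝ, ∀ i ∈ S, ∀ x ∈ box J, g i x = ∏ j ∈ S, F i j (x i) (x j)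

/-- The part of `g` outside `M` is a sum of blocks `g^I`, each multiplied by a product of functions
of the single variables `xₐ`, `a ∈ M`. -/
def IsBlockForm (J : ι → Set ℝ) (S M : Finset ι) (P : Finpartition (S \ M))
    (h : Finset ι → ι → (ι → ℝ) → ℝ) (g : ι → (ι → ℝ) → ℝ) (wt : Finset ι → ι → ℝ → ℝ) : Prop :=
  (∀ I ∈ P.parts, ∀ a ∈ M, ContDiffOn ℝ ∞ (wt I a) (J a)) ∧
  (∀ I ∈ P.parts, DependsOnlyOn J I (h I)) ∧
  ∀ x ∈ box J, ∀ I ∈ P.parts, ∀ i ∈ I, g i x = (∏ a ∈ M, wt I a (x a)) * h I i x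

lemma mem_and_notMem_of_mem_parts {P : Finpartition (S \ M)} {I : Finset ι} (hI : I ∈ P.parts)
    {i : ι} (hi : i ∈ I) : i ∈ S ∧ i ∉ M :=
  Finset.mem_sdiff.1 (P.le hI hi)

lemma IsConcircularForm.isBlockForm {P : Finpartition (S \ M)} {h : Finset ι → ι → (ι → ℝ) → ℝ}
    (H : IsConcircularForm J S M P h g) : ∃ wt, IsBlockForm J S M P h g wt := by
  obtain ⟨-, Φ, σ, e, hs, hdep, -, hI⟩ := H
  exact ⟨fun I a t => e I - σ a t, fun I _ a ha => contDiffOn_const.sub (hs a ha).2.1, hdep,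
    fun x hx I hIP i hi => hI x hx I hIP i hi⟩

lemma IsExceptional.isBlockForm {a : ι} {P : Finpartition (S \ {a})}
    {h : Finset ι → ι → (ι → ℝ) → ℝ} (H : IsExceptional J S a P h g) :
    ∃ wt, IsBlockForm J S {a} P h g wt := by
  obtain ⟨-, -, Φ, σ, -, hs, -, hI⟩ := H
  refine ⟨fun I _ => σ I, fun I hIP b hb => ?_, fun I hIP => (hs I hIP).2.2,
    fun x hx I hIP i hi => by simpa using hI x hx I hIP i hi⟩
  rw [Finset.mem_singleton.1 hb]
  exact (hs I hIP).1

/-- A part of a partition contains some i, and a zero of the weight would be a zero of g_i. -/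
lemma IsBlockForm.weight_ne_zero [Fintype ι] {P : Finpartition (S \ M)}
    {h : Finset ι → ι → (ι → ℝ) → ℝ} {wt : Finset ι → ι → ℝ → ℝ}
    (H : IsBlockForm J S M P h g wt) (hg : IsOrthMetricOn J S g) {I : Finset ι}
    (hI : I ∈ P.parts) (hx : x ∈ box J) : ∏ a ∈ M, wt I a (x a) ≠ 0 := by
  obtain ⟨i, hi⟩ := P.nonempty_of_mem_parts hI
  have h1 := (hg i (mem_and_notMem_of_mem_parts hI hi).1).2 x hx
  rw [H.2.2 x hx I hI i hi] at h1
  exact left_ne_zero_of_mul h1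

lemma IsBlockForm.contDiffOn_weight [Fintype ι] {P : Finpartition (S \ M)}
    {h : Finset ι → ι → (ι → ℝ) → ℝ} {wt : Finset ι → ι → ℝ → ℝ}
    (H : IsBlockForm J S M P h g wt) {I : Finset ι} (hI : I ∈ P.parts) :
    ContDiffOn ℝ ∞ (fun x : ι → ℝ => ∏ a ∈ M, wt I a (x a)) (box J) :=
  contDiffOn_prod fun a ha => contDiffOn_comp_eval (H.1 I hI a ha)

lemma IsBlockForm.isOrthMetricOn [Fintype ι] {P : Finpartition (S \ M)}
    {h : Finset ι → ι → (ι → ℝ) → ℝ} {wt : Finset ι → ι → ℝ → ℝ}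
    (H : IsBlockForm J S M P h g wt) (hg : IsOrthMetricOn J S g) {I : Finset ι}
    (hI : I ∈ P.parts) : IsOrthMetricOn J I (h I) := by
  intro i hi
  have hiS := (mem_and_notMem_of_mem_parts hI hi).1
  constructor
  · refine ((hg i hiS).1.div (H.contDiffOn_weight hI)
      fun x hx => H.weight_ne_zero hg hI hx).congr fun x hx => ?_
    rw [Pi.div_apply, H.2.2 x hx I hI i hi, mul_div_cancel_left₀ _ (H.weight_ne_zero hg hI hx)]
  · intro x hx
    have h1 := (hg i hiS).2 x hx
    rw [H.2.2 x hx I hI i hi] at h1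
    exact right_ne_zero_of_mul h1

lemma sum_eq_sum_add_sum_block (hMS : M ⊆ S) {P : Finpartition (S \ M)} {I : Finset ι}
    (hI : I ∈ P.parts) {f : ι → ℝ} (h0 : ∀ i ∈ S, i ∉ M → i ∉ I → f i = 0) :
    ∑ i ∈ S, f i = ∑ i ∈ M, f i + ∑ i ∈ I, f i := by
  rw [← Finset.sum_sdiff hMS, add_comm]
  congr 1
  refine (Finset.sum_subset (P.le hI) fun i hi hiI => ?_).symm
  exact h0 i (Finset.mem_sdiff.1 hi).1 (Finset.mem_sdiff.1 hi).2 hiI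

/-- Stäckel systems for `M` and for the blocks combine to a Stäckel system for `S`. -/
theorem HasStaeckelSystem.assemble (hMS : M ⊆ S) (P : Finpartition (S \ M))
    {h : Finset ι → ι → (ι → ℝ) → ℝ} {wt : Finset ι → ι → ℝ → ℝ}
    (H : IsBlockForm J S M P h g wt) (hM : HasStaeckelSystem J M g x₀)
    (hP : ∀ I ∈ P.parts, HasStaeckelSystem J I (h I) x₀)
    {v : Finset ι → ι → ℝ → ℝ} {κ : Finset ι → ℝ}
    (hv : ∀ I ∈ P.parts, ∀ a ∈ M, ContDiffOn ℝ ∞ (v I a) (J a))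
    (hκ : ∀ I ∈ P.parts, ∀ x ∈ box J,
      ∑ a ∈ M, (g a x)⁻¹ * v I a (x a) + (∏ a ∈ M, wt I a (x a))⁻¹ = κ I) :
    HasStaeckelSystem J S g x₀ := by
  obtain ⟨u₀, E₀, hu₀, hE₀, hker₀⟩ := hM
  have hP' : ∀ I, ∃ (u : ι → ι → ℝ → ℝ) (E : ι → ℝ), I ∈ P.parts →
      (∀ j ∈ I, ∀ i ∈ I, ContDiffOn ℝ ∞ (u j i) (J i)) ∧
      (∀ j ∈ I, ∀ x ∈ box J, ∑ i ∈ I, (h I i x)⁻¹ * u j i (x i) = E j) ∧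
      ∀ c : ι → ℝ, (∀ i ∈ I, ∑ j ∈ I, c j * u j i (x₀ i) = 0) → ∀ j ∈ I, c j = 0 := by
    intro I
    by_cases hI : I ∈ P.parts
    · obtain ⟨u, E, hu⟩ := hP I hI
      exact ⟨u, E, fun _ => hu⟩
    · exact ⟨0, 0, fun h => absurd h hI⟩
  choose u E huE using hP'
  have hpart : ∀ j ∈ S, j ∉ M → P.part j ∈ P.parts ∧ j ∈ P.part j := fun j hj hjM =>
    ⟨P.part_mem.2 (Finset.mem_sdiff.2 ⟨hj, hjM⟩), P.mem_part (Finset.mem_sdiff.2 ⟨hj, hjM⟩)⟩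
  have hpe : ∀ I ∈ P.parts, ∀ j ∈ I, P.part j = I := fun I hI j hj => P.part_eq_of_mem hI hj
  -- For j in a block I, dividing the block identity by the weight gives E_j times the reciprocal
  -- weight; adding E_j times the functions `v I` in the M-coordinates turns this into the constant
  -- E_j κ_I, by `hκ`. For j in M the system of M is extended by zero. The matrix is block
  -- triangular.
  refine ⟨fun j i t => if j ∈ M then (if i ∈ M then u₀ j i t else 0) else
      if i ∈ M then E (P.part j) j * v (P.part j) i t else
      if i ∈ P.part j then u (P.part j) j i t else 0,
    fun j => if j ∈ M then E₀ j else E (P.part j) j * κ (P.part j), ?_, ?_, ?_⟩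
  · intro j hj i hi
    by_cases hjM : j ∈ M
    · by_cases hiM : i ∈ M
      · simpa only [hjM, hiM, if_true] using hu₀ j hjM i hiM
      · simpa only [hjM, hiM, if_true, if_false] using contDiffOn_const
    · obtain ⟨hI, hjI⟩ := hpart j hj hjM
      by_cases hiM : i ∈ M
      · simpa only [hjM, hiM, if_true, if_false] using contDiffOn_const.mul (hv _ hI i hiM)
      · by_cases hiI : i ∈ P.part j
        · simpa only [hjM, hiM, hiI, if_true, if_false] using (huE _ hI).1 j hjI i hiI
        · simpa only [hjM, hiM, hiI, if_false] using contDiffOn_const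
  · intro j hj x hx
    by_cases hjM : j ∈ M
    · simp only [hjM, if_true]
      rw [← hE₀ j hjM x hx]
      refine (Finset.sum_subset_zero_on_sdiff hMS (fun i hi => ?_) fun i hi => ?_).symm
      · simp [(Finset.mem_sdiff.1 hi).2]
      · simp [hi]
    · obtain ⟨hI, hjI⟩ := hpart j hj hjM
      simp only [hjM, if_false]
      rw [sum_eq_sum_add_sum_block hMS hI fun i _ hiM hiI => by simp [hiM, hiI],
        ← hκ _ hI x hx, mul_add, Finset.mul_sum]
      congr 1
      · refine Finset.sum_congr rfl fun i hi => ?_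
        simp only [hi, if_true]
        ring
      · rw [← (huE _ hI).2.1 j hjI x hx, Finset.sum_mul]
        refine Finset.sum_congr rfl fun i hi => ?_
        simp only [hi, (mem_and_notMem_of_mem_parts hI hi).2, if_true, if_false]
        rw [H.2.2 x hx _ hI i hi, mul_inv]
        ring
  · intro c hc
    -- Block triangularity: for i in a block I, only the indices j in I contribute to the kernel
    -- equation. Once all those coefficients vanish, the equations for i in M involve the system of
    -- M alone.
    have hout : ∀ j ∈ S, j ∉ M → c j = 0 := by
      intro j hj hjM
      obtain ⟨hI, hjI⟩ := hpart j hj hjM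
      refine (huE _ hI).2.2 c (fun i hi => ?_) j hjI
      obtain ⟨hiS, hiM⟩ := mem_and_notMem_of_mem_parts hI hi
      rw [← hc i hiS]
      refine Finset.sum_subset_zero_on_sdiff (fun k hk => (mem_and_notMem_of_mem_parts hI hk).1)
        (fun k hk => ?_) fun k hk => ?_
      · obtain ⟨hkS, hkI⟩ := Finset.mem_sdiff.1 hk
        by_cases hkM : k ∈ M
        · simp [hkM, hiM]
        · have : i ∉ P.part k := fun hik => hkI (by
            rw [P.eq_of_mem_parts hI (hpart k hkS hkM).1 hi hik]
            exact (hpart k hkS hkM).2)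
          simp [hkM, hiM, this]
      · beta_reduce
        rw [hpe _ hI k hk]
        simp [(mem_and_notMem_of_mem_parts hI hk).2, hiM, hi]
    intro j hj
    by_cases hjM : j ∈ M
    · refine hker₀ c (fun i hi => ?_) j hjM
      rw [← hc i (hMS hi)]
      refine Finset.sum_subset_zero_on_sdiff hMS (fun k hk => ?_) fun k hk => ?_
      · rw [hout k (Finset.mem_sdiff.1 hk).1 (Finset.mem_sdiff.1 hk).2, zero_mul]
      · simp [hk, hi]
    · exact hout j hj hjM

/-- A weight is a product of functions of the single variables x_a, a ∈ M, and so only contributes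
the factors F_ia with i in a block; missing pairs get the factor 1. -/
lemma HasPairFactors.assemble (hMS : M ⊆ S) (P : Finpartition (S \ M))
    {h : Finset ι → ι → (ι → ℝ) → ℝ} {wt : Finset ι → ι → ℝ → ℝ}
    (H : IsBlockForm J S M P h g wt) (hM : HasPairFactors J M g)
    (hP : ∀ I ∈ P.parts, HasPairFactors J I (h I)) : HasPairFactors J S g := by
  obtain ⟨F₀, hF₀⟩ := hM
  have hP' : ∀ I, ∃ F : ι → ι → ℝ → ℝ → ℝ, I ∈ P.parts →
      ∀ i ∈ I, ∀ x ∈ box J, h I i x = ∏ j ∈ I, F i j (x i) (x j) := by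
    intro I
    by_cases hI : I ∈ P.parts
    · obtain ⟨F, hF⟩ := hP I hI
      exact ⟨F, fun _ => hF⟩
    · exact ⟨1, fun h => absurd h hI⟩
  choose F hF using hP'
  refine ⟨fun i j s t => if i ∈ M then (if j ∈ M then F₀ i j s t else 1) else
    if j ∈ M then wt (P.part i) j t else if j ∈ P.part i then F (P.part i) i j s t else 1, ?_⟩
  intro i hi x hx
  by_cases hiM : i ∈ M
  · simp only [hiM, if_true]
    rw [hF₀ i hiM x hx]
    refine Finset.prod_subset_one_on_sdiff hMS (fun k hk => ?_) fun k hk => ?_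
    · simp [(Finset.mem_sdiff.1 hk).2]
    · simp [hk]
  · have hI : P.part i ∈ P.parts := P.part_mem.2 (Finset.mem_sdiff.2 ⟨hi, hiM⟩)
    have hiI : i ∈ P.part i := P.mem_part (Finset.mem_sdiff.2 ⟨hi, hiM⟩)
    simp only [hiM, if_false]
    rw [H.2.2 x hx _ hI i hiI, ← Finset.prod_sdiff hMS, mul_comm]
    congr 1
    · rw [hF _ hI i hiI x hx]
      refine Finset.prod_subset_one_on_sdiff (P.le hI) (fun k hk => ?_) fun k hk => ?_
      · obtain ⟨h1, h2⟩ := Finset.mem_sdiff.1 hk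
        simp [(Finset.mem_sdiff.1 h1).2, h2]
      · simp [(mem_and_notMem_of_mem_parts hI hk).2, hk]
    · exact Finset.prod_congr rfl fun k hk => by simp [hk]

variable {Φ σ : ι → ℝ → ℝ}

lemma injOn_of_vandermonde
    (h0 : ∀ a ∈ M, Φ a (x a) * ∏ b ∈ M.erase a, (σ a (x a) - σ b (x b)) ≠ 0) :
    Set.InjOn (fun a => σ a (x a)) M := by
  intro a ha b hb hab
  by_contra hne
  refine Finset.prod_ne_zero_iff.1 (right_ne_zero_of_mul (h0 a ha)) b
    (Finset.mem_erase.2 ⟨Ne.symm hne, hb⟩) (sub_eq_zero.2 hab)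

/-- The Stäckel system of a metric in Vandermonde form. -/
theorem hasStaeckelSystem_vandermonde
    (hs : ∀ a ∈ M, ContDiffOn ℝ ∞ (Φ a) (J a) ∧ ContDiffOn ℝ ∞ (σ a) (J a))
    (hgM : ∀ x ∈ box J, ∀ a ∈ M,
      g a x = Φ a (x a) * ∏ b ∈ M.erase a, (σ a (x a) - σ b (x b)))
    (h0 : ∀ a ∈ M, ∀ x ∈ box J, g a x ≠ 0) (hx₀ : x₀ ∈ box J) :
    HasStaeckelSystem J M g x₀ := by
  -- Here u_ba = Φ_a Q_b(σ_a), where Q_b is the polynomial with roots σ_c(x₀_c), c ≠ b. Since Q_b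
  -- has degree |M| - 1, Lagrange interpolation identifies ∑_a Q_b(σ_a)/∏(σ_a - σ_c) with its top
  -- coefficient, a constant. Choosing Q_b instead of powers of σ makes the matrix at x₀ diagonal,
  -- with entries g_a(x₀).
  refine ⟨fun b a t => Φ a t * ∏ c ∈ M.erase b, (σ a t - σ c (x₀ c)),
    fun b => (Lagrange.nodal (M.erase b) fun c => σ c (x₀ c)).coeff (M.card - 1), ?_, ?_, ?_⟩
  · intro b _ a ha
    exact (hs a ha).1.mul (contDiffOn_prod fun c _ => (hs a ha).2.sub contDiffOn_const)
  · intro b hb x hx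
    have hne : ∀ a ∈ M, Φ a (x a) * ∏ b ∈ M.erase a, (σ a (x a) - σ b (x b)) ≠ 0 :=
      fun a ha => by rw [← hgM x hx a ha]; exact h0 a ha x hx
    beta_reduce
    rw [Lagrange.coeff_eq_sum (injOn_of_vandermonde hne)]
    · refine Finset.sum_congr rfl fun a ha => ?_
      rw [hgM x hx a ha, Lagrange.eval_nodal]
      have h1 := left_ne_zero_of_mul (hne a ha)
      have h2 := right_ne_zero_of_mul (hne a ha)
      field_simp
    · rw [Lagrange.degree_nodal]
      exact_mod_cast Finset.card_erase_lt_of_mem hb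
  · intro c hc a ha
    have h1 := hc a ha
    rw [Finset.sum_eq_single_of_mem a ha] at h1
    · beta_reduce at h1
      rw [← hgM x₀ hx₀ a ha] at h1
      exact (mul_eq_zero.1 h1).resolve_right (h0 a ha x₀ hx₀)
    · intro b hb hba
      beta_reduce
      rw [Finset.prod_eq_zero (i := a) (Finset.mem_erase.2 ⟨hba.symm, ha⟩) (sub_self _)]
      ring

lemma hasPairFactors_vandermonde
    (hgM : ∀ x ∈ box J, ∀ a ∈ M,
      g a x = Φ a (x a) * ∏ b ∈ M.erase a, (σ a (x a) - σ b (x b))) :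
    HasPairFactors J M g := by
  refine ⟨fun i j s t => if i = j then Φ i s else σ i s - σ j t, fun i hi x hx => ?_⟩
  rw [hgM x hx i hi, ← Finset.mul_prod_erase M _ hi]
  congr 1
  · simp
  · exact Finset.prod_congr rfl fun j hj => by simp [(Finset.ne_of_mem_erase hj).symm]

/-- Partial fractions for `∏ (e - σₐ)⁻¹`. -/
lemma sum_partial_fractions {s : ι → ℝ} (hs : Set.InjOn s M) (hM : M.Nonempty) {e : ℝ}
    (he : ∏ a ∈ M, (e - s a) ≠ 0) :
    ∑ a ∈ M, (∏ b ∈ M.erase a, (s a - s b))⁻¹ * (e - s a)⁻¹ = (∏ a ∈ M, (e - s a))⁻¹ := by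
  have hx : ∀ a ∈ M, e ≠ s a := fun a ha =>
    sub_ne_zero.1 (Finset.prod_ne_zero_iff.1 he a ha)
  have h1 := Lagrange.eval_interpolate_not_at_node (r := (1 : ι → ℝ)) hx
  rw [Lagrange.interpolate_one hs hM, Polynomial.eval_one, Lagrange.eval_nodal] at h1
  rw [← eq_inv_of_mul_eq_one_right h1.symm]
  refine Finset.sum_congr rfl fun a _ => ?_
  simp [Lagrange.nodalWeight]

/-- The gluing condition of `HasStaeckelSystem.assemble` is the partial fraction expansion of ∏ (e_I
- σ_a)⁻¹ over M, which dictates v_a = -Φ_a/(e_I - σ_a). -/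
theorem IsConcircularForm.staeckel [Fintype ι] {P : Finpartition (S \ M)}
    {h : Finset ι → ι → (ι → ℝ) → ℝ} (H : IsConcircularForm J S M P h g)
    (hg : IsOrthMetricOn J S g)
    (hP : ∀ I ∈ P.parts, (∀ x₀ ∈ box J, HasStaeckelSystem J I (h I) x₀) ∧
      HasPairFactors J I (h I)) :
    (∀ x₀ ∈ box J, HasStaeckelSystem J S g x₀) ∧ HasPairFactors J S g := by
  obtain ⟨hMS, Φ, σ, e, hs, hdep, hgM, hI⟩ := H
  have hB : IsBlockForm J S M P h g fun I a t => e I - σ a t :=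
    ⟨fun I _ a ha => contDiffOn_const.sub (hs a ha).2.1, hdep, hI⟩
  have h0 : ∀ a ∈ M, ∀ x ∈ box J, g a x ≠ 0 := fun a ha => (hg a (hMS ha)).2
  constructor
  · intro x₀ hx₀
    have hSM : HasStaeckelSystem J M g x₀ := hasStaeckelSystem_vandermonde
      (fun a ha => ⟨(hs a ha).1, (hs a ha).2.1⟩) hgM h0 hx₀
    refine HasStaeckelSystem.assemble hMS P hB hSM (fun I hI => (hP I hI).1 x₀ hx₀)
      (v := fun I a t => -(Φ a t / (e I - σ a t)))
      -- In the product case M = ∅ the sum over M is empty and the weight is the empty product 1, so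
      -- the constant is 1; otherwise the partial fractions cancel the reciprocal weight.
      (κ := fun _ => if M.Nonempty then 0 else 1) ?_ ?_
    · intro I hI a ha
      refine ((hs a ha).1.div (contDiffOn_const.sub (hs a ha).2.1) fun t ht => ?_).neg
      have := Finset.prod_ne_zero_iff.1
        (hB.weight_ne_zero hg hI (update_mem_box hx₀ (i := a) ht)) a ha
      simpa using this
    · intro I hI x hx
      have hw := hB.weight_ne_zero hg hI hx
      by_cases hM : M.Nonempty
      · have hne : ∀ a ∈ M, Φ a (x a) * ∏ b ∈ M.erase a, (σ a (x a) - σ b (x b)) ≠ 0 :=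
          fun a ha => by rw [← hgM x hx a ha]; exact h0 a ha x hx
        rw [if_pos hM, ← sum_partial_fractions (injOn_of_vandermonde hne) hM hw,
          ← Finset.sum_add_distrib]
        refine Finset.sum_eq_zero fun a ha => ?_
        rw [hgM x hx a ha]
        have h1 := left_ne_zero_of_mul (hne a ha)
        have h2 := right_ne_zero_of_mul (hne a ha)
        have h3 := Finset.prod_ne_zero_iff.1 hw a ha
        field_simp
        ring
      · rw [Finset.not_nonempty_iff_eq_empty.1 hM]
        simp
  · exact HasPairFactors.assemble hMS P hB (hasPairFactors_vandermonde hgM)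
      fun I hI => (hP I hI).2

/-- With the single coordinate a in M, the gluing condition reads Φ⁻¹(-Φ/σ) + 1/σ = 0. A one-element
Vandermonde form contains no differences of σ, so σ = 0 can be used in it. -/
theorem IsExceptional.staeckel [Fintype ι] {a : ι} {P : Finpartition (S \ {a})}
    {h : Finset ι → ι → (ι → ℝ) → ℝ} (H : IsExceptional J S a P h g)
    (hg : IsOrthMetricOn J S g)
    (hP : ∀ I ∈ P.parts, (∀ x₀ ∈ box J, HasStaeckelSystem J I (h I) x₀) ∧
      HasPairFactors J I (h I)) :
    (∀ x₀ ∈ box J, HasStaeckelSystem J S g x₀) ∧ HasPairFactors J S g := by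
  obtain ⟨ha, -, Φ, σ, hΦ, hs, hga, hI⟩ := H
  have hB : IsBlockForm J S {a} P h g fun I _ => σ I := by
    refine ⟨fun I hIP b hb => ?_, fun I hIP => (hs I hIP).2.2,
      fun x hx I hIP i hi => by simpa using hI x hx I hIP i hi⟩
    rw [Finset.mem_singleton.1 hb]
    exact (hs I hIP).1
  have hMS : {a} ⊆ S := Finset.singleton_subset_iff.2 ha
  have hgM : ∀ x ∈ box J, ∀ b ∈ ({a} : Finset ι), g b x
      = (fun _ => Φ) b (x b) * ∏ c ∈ ({a} : Finset ι).erase b,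
        ((fun (_ : ι) (_ : ℝ) => (0 : ℝ)) b (x b) - (fun (_ : ι) (_ : ℝ) => (0 : ℝ)) c (x c)) := by
    intro x hx b hb
    obtain rfl := Finset.mem_singleton.1 hb
    simpa using hga x hx
  constructor
  · intro x₀ hx₀
    have hSM : HasStaeckelSystem J {a} g x₀ := by
      refine hasStaeckelSystem_vandermonde (Φ := fun _ => Φ) (σ := fun _ _ => 0)
        (fun b hb => ?_) hgM (fun b hb => ?_) hx₀
      · rw [Finset.mem_singleton.1 hb]
        exact ⟨hΦ, contDiffOn_const⟩
      · exact (hg b (hMS hb)).2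
    have hσ : ∀ I ∈ P.parts, ∀ x ∈ box J, σ I (x a) ≠ 0 := fun I hI x hx => by
      simpa using hB.weight_ne_zero hg hI hx
    refine HasStaeckelSystem.assemble hMS P hB hSM (fun I hI => (hP I hI).1 x₀ hx₀)
      (v := fun I _ t => -(Φ t / σ I t)) (κ := fun _ => 0) ?_ ?_
    · intro I hI b hb
      rw [Finset.mem_singleton.1 hb]
      refine (hΦ.div (hs I hI).1 fun t ht => ?_).neg
      simpa using hσ I hI _ (update_mem_box hx₀ (i := a) ht)
    · intro I hI x hx
      have h1 := hσ I hI x hx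
      have h2 := (hg a ha).2 x hx
      rw [hga x hx] at h2
      simp only [Finset.sum_singleton, Finset.prod_singleton]
      rw [hga x hx]
      field_simp
      ring
  · exact HasPairFactors.assemble hMS P hB
      (hasPairFactors_vandermonde (Φ := fun _ => Φ) (σ := fun _ _ => 0) hgM)
      fun I hI => (hP I hI).2

/-- Induction over the classification. Blocks inherit smoothness and nondegeneracy from g because
the weights are smooth and nowhere zero. -/
theorem IsClassified.staeckel [Fintype ι] (hcl : IsClassified J S g)
    (hg : IsOrthMetricOn J S g) :
    (∀ x₀ ∈ box J, HasStaeckelSystem J S g x₀) ∧ HasPairFactors J S g := by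
  induction hcl with
  | irreducible H =>
    obtain ⟨P, h, H⟩ := H
    refine H.staeckel hg fun I hI => ?_
    obtain ⟨i, hi⟩ := P.nonempty_of_mem_parts hI
    exact absurd (mem_and_notMem_of_mem_parts hI hi).1 (mem_and_notMem_of_mem_parts hI hi).2
  | product P h H _ ih =>
    obtain ⟨wt, hB⟩ := H.2.isBlockForm
    exact H.2.staeckel hg fun I hI => ih I hI (hB.isOrthMetricOn hg hI)
  | warped M P h H _ ih =>
    obtain ⟨wt, hB⟩ := H.2.2.isBlockForm
    exact H.2.2.staeckel hg fun I hI => ih I hI (hB.isOrthMetricOn hg hI)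
  | exceptional a P h H _ ih =>
    obtain ⟨wt, hB⟩ := H.isBlockForm
    exact H.staeckel hg fun I hI => ih I hI (hB.isOrthMetricOn hg hI)

end Classified

end OrthSep

namespace OrthSep

/-! ### The differential system of separable metrics with diagonal curvature -/

section System

variable {ι : Type*} [Fintype ι] [DecidableEq ι] {J : ι → Set ℝ} {S : Finset ι}
  {g : ι → (ι → ℝ) → ℝ} {x y : ι → ℝ}

/-- The Levi-Civita equations together with diagonal curvature, in terms of the logarithmic
derivatives of the components. -/
structure SepDiagSystem (J : ι → Set ℝ) (S : Finset ι) (g : ι → (ι → ℝ) → ℝ) : Prop where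
  metric : IsOrthMetricOn J S g
  dependsOnlyOn : DependsOnlyOn J S g
  pd_logpd : ∀ i ∈ S, ∀ j ∈ S, i ≠ j → ∀ x ∈ box J,
    pd i (logpd g i j) x = -(logpd g i j x * logpd g j i x)
  dep : ∀ i ∈ S, ∀ j ∈ S, i ≠ j → Dep J {i, j} (logpd g i j)
  mul_eq : ∀ i ∈ S, ∀ j ∈ S, ∀ k ∈ S, i ≠ j → i ≠ k → j ≠ k → ∀ x ∈ box J,
    logpd g i j x * logpd g i k x
      = logpd g i j x * logpd g j k x + logpd g i k x * logpd g k j x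

/-- For distinct indices the Levi-Civita equation reads ∂_k A_ij = Q and diagonal curvature reads 2
∂_k A_ij = -Q with the same quadratic Q. Therefore ∂_k A_ij = 0 and Q = 0. -/
theorem sepDiagSystem_of_isOrthSepDiag (hJ : ∀ i, IsOpenInterval (J i))
    (hg : IsOrthSepDiag (box J) g) : SepDiagSystem J Finset.univ g := by
  obtain ⟨hm, hsep, hcurv⟩ := hg
  have hU := isOpen_box hJ
  have hLC := fun x hx => (staeckelAt_of_isSeparable (x₀ := x) hm hsep hx).leviCivita hU hm hx
  rw [hasDiagonalCurvature_iff hU hm] at hcurv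
  refine ⟨fun i _ => hm i, fun i _ x _ y _ hxy => ?_, fun i _ j _ hij x hx => ?_,
    fun i _ j _ hij => ?_, fun i _ j _ k _ hij hik hjk x hx => ?_⟩
  · rw [show x = y from funext fun j => hxy j (Finset.mem_univ j)]
  · rw [hLC x hx i hij.symm]
    ring
  · refine dep_of_pd_eq_zero hJ (contDiffOn_logpd hU (hm i).1 (hm i).2 j) fun k hk z hz => ?_
    simp only [Finset.mem_insert, Finset.mem_singleton, not_or] at hk
    have h1 := hLC z hz i (Ne.symm hk.2)
    have h2 := hcurv z hz i j k hij (Ne.symm hk.1) (Ne.symm hk.2)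
    linarith
  · have h1 := hLC x hx i hjk
    have h2 := hcurv x hx i j k hij hik hjk
    linarith

/-- Multiplying a component by a function that does not involve `xₖ` does not change its
logarithmic derivative with respect to `xₖ`. -/
lemma logpd_eq_of_eq_mul (hJ : ∀ i, IsOpenInterval (J i)) {h : ι → (ι → ℝ) → ℝ} {i : ι}
    (hh : ContDiffOn ℝ ∞ (h i) (box J)) {w : (ι → ℝ) → ℝ} (hw : ContDiffOn ℝ ∞ w (box J))
    (hw0 : ∀ x ∈ box J, w x ≠ 0) {T : Finset ι} (hwT : Dep J T w) {k : ι} (hk : k ∉ T)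
    (hgh : ∀ x ∈ box J, g i x = w x * h i x) (hx : x ∈ box J) :
    logpd g i k x = logpd h i k x := by
  have hU := isOpen_box hJ
  rw [logpd, logpd, pd_congr_of_eqOn hU hx (fun z hz => hgh z hz),
    pd_mul k (differentiableAt_of_contDiffOn hU hw hx) (differentiableAt_of_contDiffOn hU hh hx),
    hwT.pd_eq_zero hJ hw hk hx, hgh x hx, zero_mul, zero_add,
    mul_div_mul_left _ _ (hw0 x hx)]

/-- Blocks of a solution, divided by functions of the other variables, are solutions. -/
theorem SepDiagSystem.block (hJ : ∀ i, IsOpenInterval (J i)) (H : SepDiagSystem J S g)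
    {I T : Finset ι} (hIS : I ⊆ S) (hIT : Disjoint I T) {h : ι → (ι → ℝ) → ℝ}
    (hh : IsOrthMetricOn J I h) (hdep : DependsOnlyOn J I h) {w : (ι → ℝ) → ℝ}
    (hw : ContDiffOn ℝ ∞ w (box J)) (hw0 : ∀ x ∈ box J, w x ≠ 0) (hwT : Dep J T w)
    (hgh : ∀ i ∈ I, ∀ x ∈ box J, g i x = w x * h i x) : SepDiagSystem J I h := by
  have hU := isOpen_box hJ
  have key : ∀ i ∈ I, ∀ k ∈ I, ∀ x ∈ box J, logpd h i k x = logpd g i k x :=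
    fun i hi k hk x hx => (logpd_eq_of_eq_mul hJ (hh i hi).1 hw hw0 hwT
      (Finset.disjoint_left.1 hIT hk) (hgh i hi) hx).symm
  refine ⟨hh, hdep, fun i hi j hj hij x hx => ?_, fun i hi j hj hij x hx y hy hxy => ?_,
    fun i hi j hj k hk hij hik hjk x hx => ?_⟩
  · rw [pd_congr_of_eqOn hU hx (key i hi j hj), key i hi j hj x hx, key j hj i hi x hx]
    exact H.pd_logpd i (hIS hi) j (hIS hj) hij x hx
  · rw [key i hi j hj x hx, key i hi j hj y hy]
    exact H.dep i (hIS hi) j (hIS hj) hij x hx y hy hxy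
  · rw [key i hi j hj x hx, key i hi k hk x hx, key j hj k hk x hx, key k hk j hj x hx]
    exact H.mul_eq i (hIS hi) j (hIS hj) k (hIS hk) hij hik hjk x hx

theorem IsBlockForm.sepDiagSystem (hJ : ∀ i, IsOpenInterval (J i)) (H : SepDiagSystem J S g)
    {M : Finset ι} {P : Finpartition (S \ M)} {h : Finset ι → ι → (ι → ℝ) → ℝ}
    {wt : Finset ι → ι → ℝ → ℝ} (hB : IsBlockForm J S M P h g wt) {I : Finset ι}
    (hI : I ∈ P.parts) : SepDiagSystem J I (h I) :=
  H.block hJ (T := M) (fun _ hi => (mem_and_notMem_of_mem_parts hI hi).1)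
    (Finset.disjoint_left.2 fun _ hi => (mem_and_notMem_of_mem_parts hI hi).2)
    (hB.isOrthMetricOn H.metric hI) (hB.2.1 I hI) (hB.contDiffOn_weight hI)
    (fun _ hx => hB.weight_ne_zero H.metric hI hx) (dep_prod_comp_eval (wt I))
    fun i hi x hx => hB.2.2 x hx I hI i hi

/-- Products of functions of two variables have logarithmic derivatives in two variables. -/
lemma HasPairFactors.dep (hJ : ∀ i, IsOpenInterval (J i)) (hg : IsOrthMetricOn J S g)
    (hF : HasPairFactors J S g) {i k : ι} (hi : i ∈ S) (hk : k ∈ S) (hik : i ≠ k) :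
    Dep J {i, k} (logpd g i k) := by
  obtain ⟨F, hF⟩ := hF
  intro x hx y hy hxy
  have hxi : x i = y i := hxy i (by simp)
  have hxk : x k = y k := hxy k (by simp)
  have hU := isOpen_box hJ
  have hd : ∀ z ∈ box J, DifferentiableAt ℝ (g i) z := fun z hz =>
    differentiableAt_of_contDiffOn hU (hg i hi).1 hz
  set R : (ι → ℝ) → ℝ := fun z => ∏ j ∈ S.erase k, F i j (z i) (z j) with hR
  have hline : ∀ z ∈ box J, ∀ t ∈ J k,
      g i (Function.update z k t) = F i k (z i) t * R z := by
    intro z hz t ht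
    rw [hF i hi _ (update_mem_box hz ht), ← Finset.mul_prod_erase S _ hk, hR]
    congr 1
    · simp [hik]
    · refine Finset.prod_congr rfl fun j hj => ?_
      simp [hik, Finset.ne_of_mem_erase hj]
  have hR0 : ∀ z ∈ box J, R z ≠ 0 := fun z hz h0 => by
    have h1 := hline z hz (z k) (mem_box.1 hz k)
    rw [h0, mul_zero, Function.update_eq_self] at h1
    exact (hg i hi).2 z hz h1
  have h1 := hasDerivAt_comp_update k (hd x hx)
  have h2 := (hasDerivAt_comp_update k (hd y hy)).const_mul (R x / R y)
  rw [← hxk] at h2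
  have hpd : pd k (g i) x = R x / R y * pd k (g i) y := by
    refine h1.unique (h2.congr_of_eventuallyEq ?_)
    filter_upwards [(hJ k).1.mem_nhds (mem_box.1 hx k)] with t ht
    rw [hline x hx t ht, hline y hy t ht, hxi]
    have := hR0 y hy
    field_simp
  have hval : g i x = R x / R y * g i y := by
    have e1 := hline x hx (x k) (mem_box.1 hx k)
    have e2 := hline y hy (y k) (mem_box.1 hy k)
    rw [Function.update_eq_self] at e1 e2
    rw [e1, e2, hxi, hxk]
    have := hR0 y hy
    field_simp
  rw [logpd, logpd, hpd, hval, mul_div_mul_left _ _ (div_ne_zero (hR0 x hx) (hR0 y hy))]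

end System

/-! ### Separability and diagonal curvature from Stäckel systems with pair factors -/

section Synthesis

variable {ι : Type} [Fintype ι] [DecidableEq ι] {J : ι → Set ℝ} {g : ι → (ι → ℝ) → ℝ}

lemma leviCivitaEquations_of_logpd {U : Set (ι → ℝ)} (hU : IsOpen U) (hg : IsOrthMetric U g)
    (h : ∀ x ∈ U, ∀ i k l : ι, k ≠ l → pd l (logpd g i k) x = logpd g i k x * logpd g i l x
      - logpd g l k x * logpd g i l x - logpd g k l x * logpd g i k x) :
    LeviCivitaEquations U g := by
  have hlog : ∀ i j, ∀ x ∈ U, pd j (fun x => Real.log |g i x|) x = logpd g i j x := by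
    intro i j x hx
    have hd := differentiableAt_of_contDiffOn hU (hg i).1 hx
    simp only [Real.log_abs, pd]
    rw [fderiv.log hd ((hg i).2 x hx), logpd, pd]
    simp [div_eq_inv_mul]
  intro x hx
  beta_reduce
  refine ⟨fun i j hij => ?_, fun i j k hij hik hjk => ?_⟩
  · rw [pd_congr_of_eqOn hU hx (hlog i j), hlog i j x hx, hlog j i x hx, h x hx i j i hij.symm]
    ring
  · rw [pd_congr_of_eqOn hU hx (hlog i k), hlog i k x hx, hlog i j x hx, hlog j k x hx,
      hlog k j x hx, h x hx i k j hjk.symm]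
    ring

/-- A metric with Stäckel systems whose components are products of functions of two variables is
orthogonally separable with diagonal curvature. -/
theorem isOrthSepDiag_of_staeckel (hJ : ∀ i, IsOpenInterval (J i)) (hg : IsOrthMetric (box J) g)
    (hS : ∀ x₀ ∈ box J, HasStaeckelSystem J Finset.univ g x₀)
    (hF : HasPairFactors J Finset.univ g) :
    LeviCivitaEquations (box J) g ∧ IsOrthSepDiag (box J) g := by
  have hU := isOpen_box hJ
  have hSt : ∀ x₀ ∈ box J, StaeckelAt (box J) g x₀ := by
    intro x₀ hx₀
    obtain ⟨u, E, hu, hE, hker⟩ := hS x₀ hx₀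
    exact ⟨J, u, E, hJ, hx₀, subset_rfl, fun j i => hu j (by simp) i (by simp),
      fun j x hx => hE j (by simp) x hx,
      fun c hc => funext fun j => hker c (fun i _ => hc i) j (by simp)⟩
  have hLC := fun x hx => (hSt x hx).leviCivita hU hg hx
  refine ⟨leviCivitaEquations_of_logpd hU hg fun x hx i k l hkl => hLC x hx i hkl, hg,
    isSeparable_of_staeckelAt hg hSt, ?_⟩
  rw [hasDiagonalCurvature_iff hU hg]
  intro x hx i j k hij hik hjk
  -- Pair factors make A_ij independent of x_k; Levi-Civita then makes the quadratic expression
  -- vanish, and both sides of the curvature condition are zero.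
  have h1 : pd k (logpd g i j) x = 0 :=
    (hF.dep hJ (fun i _ => hg i) (Finset.mem_univ i) (Finset.mem_univ j) hij).pd_eq_zero hJ
      (contDiffOn_logpd hU (hg i).1 (hg i).2 j) (by simp [hik.symm, hjk.symm]) hx
  have h2 := hLC x hx i hjk
  rw [h1] at h2 ⊢
  linarith

/-- A classified block pulls back to an orthogonally separable metric with diagonal curvature. -/
theorem IsClassified.blockIsOrthSepDiag (hJ : ∀ i, IsOpenInterval (J i)) {I : Finset ι}
    {h : ι → (ι → ℝ) → ℝ} (hcl : IsClassified J I h) (hh : IsOrthMetricOn J I h) :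
    BlockIsOrthSepDiag J I h := by
  intro x₀ hx₀
  obtain ⟨hS, F, hF⟩ := hcl.staeckel hh
  set ext : (I → ℝ) → ι → ℝ := fun y j => if hj : j ∈ I then y ⟨j, hj⟩ else x₀ j with hext
  have hext_mem : ∀ y ∈ box (fun i : I => J i), ext y ∈ box J := by
    intro y hy
    rw [mem_box] at *
    intro j
    by_cases hj : j ∈ I
    · simpa [hext, hj] using hy ⟨j, hj⟩
    · simpa [hext, hj] using hx₀ j
  have hext_apply : ∀ y (i : I), ext y i = y i := fun y i => by simp [hext]
  have hext_smooth : ContDiff ℝ ∞ ext := by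
    refine contDiff_pi.2 fun j => ?_
    by_cases hj : j ∈ I
    · simpa [hext, hj] using contDiff_apply ℝ ℝ (⟨j, hj⟩ : I)
    · simpa [hext, hj] using contDiff_const
  refine (isOrthSepDiag_of_staeckel (J := fun i : I => J i) (g := pullback I x₀ h)
    (fun i => hJ i) (fun i => ⟨?_, fun y hy => ?_⟩)
    (fun y₀ hy₀ => ?_) ?_).2
  · exact (hh i i.2).1.comp hext_smooth.contDiffOn hext_mem
  · exact (hh i i.2).2 _ (hext_mem y hy)
  · obtain ⟨u, E, hu, hE, hker⟩ := hS _ (hext_mem y₀ hy₀)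
    refine ⟨fun j i => u j i, fun j => E j, fun j _ i _ => hu j j.2 i i.2, fun j _ y hy => ?_,
      fun c hc j _ => ?_⟩
    · beta_reduce
      rw [← hE j j.2 _ (hext_mem y hy), ← Finset.sum_coe_sort I]
      exact Finset.sum_congr rfl fun i _ => by rw [hext_apply]; rfl
    · have := hker (fun j => if hj : j ∈ I then c ⟨j, hj⟩ else 0) (fun i hi => ?_) j j.2
      · simpa using this
      · rw [← hc ⟨i, hi⟩ (Finset.mem_univ _), ← Finset.sum_coe_sort I]
        refine Finset.sum_congr rfl fun k _ => ?_
        rw [hext_apply y₀ ⟨i, hi⟩]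
        simp
  · refine ⟨fun i j => F i j, fun i _ y hy => ?_⟩
    have h1 := hF i i.2 _ (hext_mem y hy)
    rw [← Finset.prod_coe_sort I] at h1
    refine h1.trans (Finset.prod_congr rfl fun j _ => ?_)
    rw [hext_apply, hext_apply]

end Synthesis

end OrthSep

namespace OrthSep

/-! ### Dependence between coordinates -/

section Arrows

variable {ι : Type*} [Fintype ι] [DecidableEq ι] {J : ι → Set ℝ} {S : Finset ι}
  {g : ι → (ι → ℝ) → ℝ} {x y b : ι → ℝ} {i j k o : ι}

/-- The component `gᵢ` depends on the coordinate `xⱼ`. -/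
def Involves (J : ι → Set ℝ) (g : ι → (ι → ℝ) → ℝ) (i j : ι) : Prop :=
  i ≠ j ∧ ∃ x ∈ box J, logpd g i j x ≠ 0

lemma Involves.not_iff_of_ne (hij : i ≠ j) :
    ¬ Involves J g i j ↔ ∀ x ∈ box J, logpd g i j x = 0 := by
  simp [Involves, hij]

lemma SepDiagSystem.contDiffOn_logpd (hJ : ∀ i, IsOpenInterval (J i)) (H : SepDiagSystem J S g)
    (hi : i ∈ S) (j : ι) :
    ContDiffOn ℝ ∞ (logpd g i j) (box J) :=
  OrthSep.contDiffOn_logpd (isOpen_box hJ) (H.metric i hi).1 (H.metric i hi).2 j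

lemma SepDiagSystem.differentiableAt_logpd (hJ : ∀ i, IsOpenInterval (J i))
    (H : SepDiagSystem J S g) (hi : i ∈ S) (j : ι) (hx : x ∈ box J) :
    DifferentiableAt ℝ (logpd g i j) x :=
  differentiableAt_of_contDiffOn (isOpen_box hJ) (H.contDiffOn_logpd hJ hi j) hx

lemma SepDiagSystem.differentiableAt (hJ : ∀ i, IsOpenInterval (J i)) (H : SepDiagSystem J S g)
    (hi : i ∈ S) (hx : x ∈ box J) :
    DifferentiableAt ℝ (g i) x :=
  differentiableAt_of_contDiffOn (isOpen_box hJ) (H.metric i hi).1 hx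

/-- Whether `∂ⱼ log |gᵢ|` vanishes at a point is decided by the coordinate `xⱼ` alone. -/
lemma SepDiagSystem.logpd_ne_zero (hJ : ∀ i, IsOpenInterval (J i)) (H : SepDiagSystem J S g)
    (hi : i ∈ S) (hj : j ∈ S) (hij : i ≠ j) (hx : x ∈ box J)
    (hy : y ∈ box J) (hxy : y j = x j) (h : logpd g i j x ≠ 0) : logpd g i j y ≠ 0 := by
  -- A_ij g_j is independent of x_i: the term -A_ij A_ji g_j from ∂_i A_ij cancels A_ij ∂_i g_j.
  have hf : ∀ z ∈ box J, pd i (fun z => logpd g i j z * g j z) z = 0 := by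
    intro z hz
    rw [pd_mul i (H.differentiableAt_logpd hJ hi j hz) (H.differentiableAt hJ hj hz),
      H.pd_logpd i hi j hj hij z hz, pd_eq_logpd ((H.metric j hj).2 z hz)]
    ring
  have h1 := update_eq_of_pd_eq_zero hJ ((H.contDiffOn_logpd hJ hi j).mul (H.metric j hj).1) hf hx
    (mem_box.1 hy i)
  have hz := update_mem_box hx (mem_box.1 hy i)
  have h2 : logpd g i j y = logpd g i j (Function.update x i (y i)) := by
    refine H.dep i hi j hj hij y hy _ hz fun l hl => ?_
    simp only [Finset.mem_insert, Finset.mem_singleton] at hl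
    rcases hl with rfl | rfl
    · simp
    · simp [hij.symm, hxy]
  intro h0
  rw [h2] at h0
  rw [h0, zero_mul] at h1
  exact mul_ne_zero h ((H.metric j hj).2 x hx) h1.symm

/-- If A_ik vanished identically, the quadratic relation would leave A_ij A_jk = 0. As the zeros of
these factors are governed by x_j and x_k respectively, one point can be chosen where neither
vanishes. -/
lemma SepDiagSystem.involves_trans (hJ : ∀ i, IsOpenInterval (J i)) (H : SepDiagSystem J S g)
    (hi : i ∈ S) (hj : j ∈ S) (hk : k ∈ S) (hik : i ≠ k)
    (h1 : Involves J g i j) (h2 : Involves J g j k) : Involves J g i k := by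
  obtain ⟨hij, x, hx, hxn⟩ := h1
  obtain ⟨hjk, y, hy, hyn⟩ := h2
  by_contra hcon
  rw [Involves.not_iff_of_ne hik] at hcon
  have hz := update_mem_box hx (mem_box.1 hy k)
  have e := H.mul_eq i hi j hj k hk hij hik hjk _ hz
  rw [hcon _ hz, mul_zero, zero_mul, add_zero] at e
  exact mul_ne_zero (H.logpd_ne_zero hJ hi hj hij hx hz (by simp [hjk]) hxn)
    (H.logpd_ne_zero hJ hj hk hjk hy hz (by simp) hyn) e.symm

/-- If A_jk and A_kj both vanished identically, the quadratic relation would force A_ij A_ik = 0,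
and again one point can be chosen where neither factor vanishes. -/
lemma SepDiagSystem.involves_or (hJ : ∀ i, IsOpenInterval (J i)) (H : SepDiagSystem J S g)
    (hi : i ∈ S) (hj : j ∈ S) (hk : k ∈ S) (hjk : j ≠ k)
    (h1 : Involves J g i j) (h2 : Involves J g i k) : Involves J g j k ∨ Involves J g k j := by
  obtain ⟨hij, x, hx, hxn⟩ := h1
  obtain ⟨hik, y, hy, hyn⟩ := h2
  by_contra! hcon
  obtain ⟨h3, h4⟩ := hcon
  rw [Involves.not_iff_of_ne hjk] at h3
  rw [Involves.not_iff_of_ne hjk.symm] at h4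
  have hz := update_mem_box hx (mem_box.1 hy k)
  have e := H.mul_eq i hi j hj k hk hij hik hjk _ hz
  rw [h3 _ hz, h4 _ hz, mul_zero, mul_zero, add_zero] at e
  exact mul_ne_zero (H.logpd_ne_zero hJ hi hj hij hx hz (by simp [hjk]) hxn)
    (H.logpd_ne_zero hJ hi hk hik hy hz (by simp) hyn) e

/-- There is a coordinate on which everything its component depends on depends in turn. -/
lemma SepDiagSystem.exists_terminal (hJ : ∀ i, IsOpenInterval (J i)) (H : SepDiagSystem J S g)
    (hS : S.Nonempty) :
    ∃ o ∈ S, ∀ j ∈ S, Involves J g o j → Involves J g j o := by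
  classical
  -- Minimise the size of the set consisting of i and its targets. If o → j, transitivity puts the
  -- set of j inside that of o, and minimality makes them equal, so j → o.
  obtain ⟨o, ho, hmin⟩ := Finset.exists_min_image S
    (fun i => (S.filter fun j => j = i ∨ Involves J g i j).card) hS
  refine ⟨o, ho, fun j hj hoj => ?_⟩
  have hsub : (S.filter fun k => k = j ∨ Involves J g j k) ⊆
      S.filter fun k => k = o ∨ Involves J g o k := by
    intro k hk
    simp only [Finset.mem_filter] at hk ⊢
    refine ⟨hk.1, ?_⟩
    rcases hk.2 with rfl | hjk
    · exact Or.inr hoj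
    · by_cases hko : k = o
      · exact Or.inl hko
      · exact Or.inr (H.involves_trans hJ ho hj hk.1 (Ne.symm hko) hoj hjk)
  have heq := Finset.eq_of_subset_of_card_le hsub (hmin j hj)
  have hmem : o ∈ S.filter fun k => k = j ∨ Involves J g j k := by
    rw [heq]
    simp [ho]
  rcases (Finset.mem_filter.1 hmem).2 with h | h
  · exact absurd h hoj.1
  · exact h

lemma SepDiagSystem.pd_eq_zero_of_notMem (hJ : ∀ i, IsOpenInterval (J i)) (H : SepDiagSystem J S g)
    (hi : i ∈ S) (hk : k ∉ S) (hx : x ∈ box J) :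
    pd k (g i) x = 0 :=
  Dep.pd_eq_zero hJ (H.metric i hi).1 (fun x hx y hy h => H.dependsOnlyOn i hi x hx y hy h) hk hx

/-- Dividing a block by a weight with the same logarithmic derivatives. -/
theorem SepDiagSystem.div (hJ : ∀ i, IsOpenInterval (J i)) (H : SepDiagSystem J S g)
    {I M : Finset ι} (hIS : I ⊆ S) (hIM : Disjoint I M)
    {w : (ι → ℝ) → ℝ} (hw : ContDiffOn ℝ ∞ w (box J)) (hw0 : ∀ x ∈ box J, w x ≠ 0)
    (hwM : Dep J M w)
    (hlog : ∀ i ∈ I, ∀ k ∈ M, ∀ x ∈ box J, pd k w x = logpd g i k x * w x)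
    (hout : ∀ i ∈ I, ∀ k ∈ S, k ∉ M → k ∉ I → ∀ x ∈ box J, logpd g i k x = 0) :
    SepDiagSystem J I fun i x => g i x / w x := by
  have hsm : ∀ i ∈ I, ContDiffOn ℝ ∞ (fun x => g i x / w x) (box J) := fun i hi =>
    (H.metric i (hIS hi)).1.div hw hw0
  refine H.block hJ hIS hIM
    (fun i hi => ⟨hsm i hi,
      fun x hx => div_ne_zero ((H.metric i (hIS hi)).2 x hx) (hw0 x hx)⟩)
    (fun i hi => dep_of_pd_eq_zero hJ (hsm i hi) fun k hkI z hz => ?_) hw hw0 hwM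
    fun i hi x hx => (mul_div_cancel₀ _ (hw0 x hx)).symm
  have hiS := hIS hi
  rw [pd_div k (H.differentiableAt hJ hiS hz)
    (differentiableAt_of_contDiffOn (isOpen_box hJ) hw hz) (hw0 z hz)]
  have hgk : pd k (g i) z * w z = g i z * pd k w z := by
    by_cases hkM : k ∈ M
    · rw [hlog i hi k hkM z hz, pd_eq_logpd ((H.metric i hiS).2 z hz)]
      ring
    · rw [hwM.pd_eq_zero hJ hw hkM hz, mul_zero]
      by_cases hkS : k ∈ S
      · rw [pd_eq_logpd ((H.metric i hiS).2 z hz), hout i hi k hkS hkM hkI z hz]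
        ring
      · rw [H.pd_eq_zero_of_notMem hJ hiS hkS hz, zero_mul]
  rw [hgk, sub_self, zero_div]

end Arrows

/-! ### The partition of a finite set into the fibres of a function -/

lemma exists_finpartition_fibres {ι β : Type*} [DecidableEq ι] (s : Finset ι) (f : ι → β) :
    ∃ P : Finpartition s, (∀ I ∈ P.parts, ∀ i ∈ I, ∀ k ∈ s, k ∈ I ↔ f k = f i) ∧
      ∀ i ∈ s, ∃ I ∈ P.parts, i ∈ I := by
  classical
  let c : ι → Finset ι := fun i => s.filter fun k => f k = f i
  have hdis : ∀ i j, f i ≠ f j → Disjoint (c i) (c j) := fun i j hij =>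
    Finset.disjoint_left.2 fun k hk hk' => hij <| by
      rw [← (Finset.mem_filter.1 hk).2, ← (Finset.mem_filter.1 hk').2]
  have hceq : ∀ i j, f i = f j → c i = c j := fun i j hij => by simp only [c, hij]
  let P : Finpartition s :=
    { parts := s.image c
      supIndep := by
        rw [Finset.supIndep_iff_pairwiseDisjoint]
        intro I hI I' hI' hne
        obtain ⟨i, -, rfl⟩ := Finset.mem_image.1 hI
        obtain ⟨j, -, rfl⟩ := Finset.mem_image.1 hI'
        exact hdis i j fun h => hne (hceq i j h)
      sup_parts := by
        ext k
        simp only [Finset.mem_sup, id_eq, Finset.mem_image]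
        constructor
        · rintro ⟨I, ⟨i, -, rfl⟩, hk⟩
          exact (Finset.mem_filter.1 hk).1
        · exact fun hk => ⟨c k, ⟨k, hk, rfl⟩, Finset.mem_filter.2 ⟨hk, rfl⟩⟩
      bot_notMem := by
        intro h
        obtain ⟨i, hi, hci⟩ := Finset.mem_image.1 h
        have : i ∈ c i := Finset.mem_filter.2 ⟨hi, rfl⟩
        rw [hci] at this
        exact absurd this (Finset.notMem_empty i) }
  refine ⟨P, fun I hI i hi k hk => ?_, fun i hi =>
    ⟨c i, Finset.mem_image_of_mem c hi, Finset.mem_filter.2 ⟨hi, rfl⟩⟩⟩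
  obtain ⟨l, -, rfl⟩ := Finset.mem_image.1 hI
  rw [(Finset.mem_filter.1 hi).2]
  simp [c, hk]

end OrthSep

namespace OrthSep

/-! ### The eigenfunctions of the concircular tensor -/

section Sigma

variable {ι : Type*} [Fintype ι] [DecidableEq ι] {J : ι → Set ℝ} {S : Finset ι}
  {f : (ι → ℝ) → ℝ} {g : ι → (ι → ℝ) → ℝ} {x y b : ι → ℝ} {i j k o : ι}

lemma contDiffOn_comp_update_left {t : ℝ} (hf : ContDiffOn ℝ ∞ f (box J)) (ht : t ∈ J j) :
    ContDiffOn ℝ ∞ (fun x => f (Function.update x j t)) (box J) := by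
  refine hf.comp (ContDiff.contDiffOn (contDiff_pi.2 fun l => ?_)) fun x hx =>
    update_mem_box hx ht
  by_cases h : l = j
  · subst h; simpa using contDiff_const
  · simpa [h] using contDiff_apply ℝ ℝ l

lemma pd_comp_update_left (hJ : ∀ i, IsOpenInterval (J i)) {t : ℝ}
    (hf : ContDiffOn ℝ ∞ f (box J)) (ht : t ∈ J j) (hx : x ∈ box J) (hoj : o ≠ j) :
    pd o (fun x => f (Function.update x j t)) x = pd o f (Function.update x j t) := by
  have hU := isOpen_box hJ
  have h1 := hasDerivAt_comp_update o
    (differentiableAt_of_contDiffOn hU (contDiffOn_comp_update_left hf ht) hx)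
  have h2 := hasDerivAt_comp_update o
    (differentiableAt_of_contDiffOn hU hf (update_mem_box hx ht))
  rw [Function.update_of_ne hoj] at h2
  refine h1.unique ?_
  simpa only [Function.update_comm hoj] using h2

lemma pd_comp_update_left_self (hJ : ∀ i, IsOpenInterval (J i)) {t : ℝ}
    (hf : ContDiffOn ℝ ∞ f (box J)) (ht : t ∈ J j) (hx : x ∈ box J) :
    pd j (fun x => f (Function.update x j t)) x = 0 := by
  have h1 := hasDerivAt_comp_update j
    (differentiableAt_of_contDiffOn (isOpen_box hJ) (contDiffOn_comp_update_left hf ht) hx)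
  simp only [Function.update_idem] at h1
  exact h1.unique (hasDerivAt_const _ _)

lemma SepDiagSystem.logpd_congr (H : SepDiagSystem J S g) (hi : i ∈ S) (hk : k ∈ S)
    (hik : i ≠ k) (hx : x ∈ box J) (hy : y ∈ box J) (h1 : x i = y i) (h2 : x k = y k) : logpd g i k x = logpd g i k y := by
  refine H.dep i hi k hk hik x hx y hy fun l hl => ?_
  simp only [Finset.mem_insert, Finset.mem_singleton] at hl
  rcases hl with rfl | rfl
  · exact h1
  · exact h2

/-- For a pair of coordinates there is a Liouville factor `G` with `∂ⱼ G = G ∂ⱼ log |gₒ|` and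
`∂ₒ G = G ∂ₒ log |gⱼ|`, which is a function of `xⱼ` plus a function independent of `xⱼ`. -/
lemma SepDiagSystem.exists_liouville (hJ : ∀ i, IsOpenInterval (J i)) (H : SepDiagSystem J S g)
    (ho : o ∈ S) (hj : j ∈ S) (hoj : o ≠ j) (hb : b ∈ box J) :
    ∃ G : (ι → ℝ) → ℝ,
      (∀ x ∈ box J, logpd g j o x * G x = pd o (g j) (Function.update x j (b j))) ∧
      ∀ x ∈ box J, ∀ t ∈ J o, G x - g j (Function.update x j (b j))
        = G (Function.update x o t) - g j (Function.update (Function.update x o t) j (b j)) := by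
  have hU := isOpen_box hJ
  have hbj := mem_box.1 hb j
  obtain ⟨hos, ho0⟩ := H.metric o ho
  obtain ⟨hjs, hj0⟩ := H.metric j hj
  set R : (ι → ℝ) → ℝ := fun x => g j x / g o x with hRdef
  have hRs : ContDiffOn ℝ ∞ R (box J) := hjs.div hos ho0
  have hRu := contDiffOn_comp_update_left hRs hbj
  -- G is g_o normalised to agree with g_j at x_j = b_j. The correction factor does not involve x_j,
  -- so ∂_j log G = A_oj.
  set G : (ι → ℝ) → ℝ := fun x => g o x * R (Function.update x j (b j)) with hGdef
  have hGs : ContDiffOn ℝ ∞ G (box J) := hos.mul hRu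
  have hgd : ∀ x ∈ box J, DifferentiableAt ℝ (g o) x := fun x hx => H.differentiableAt hJ ho hx
  have hRd : ∀ x ∈ box J, DifferentiableAt ℝ (fun x => R (Function.update x j (b j))) x :=
    fun x hx => differentiableAt_of_contDiffOn hU hRu hx
  have hGd : ∀ x ∈ box J, DifferentiableAt ℝ G x :=
    fun x hx => differentiableAt_of_contDiffOn hU hGs hx
  -- The mixed derivative ∂_j ∂_o log|g_o/g_j| is zero, because ∂_j A_oo = ∂_o A_oj and ∂_j A_jo
  -- both equal -A_oj A_jo.
  have hdiff : ∀ x ∈ box J, logpd g o o (Function.update x j (b j))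
      - logpd g j o (Function.update x j (b j)) = logpd g o o x - logpd g j o x := by
    intro x hx
    refine update_eq_of_pd_eq_zero hJ (f := fun x => logpd g o o x - logpd g j o x)
      ((H.contDiffOn_logpd hJ ho o).sub (H.contDiffOn_logpd hJ hj o)) (fun z hz => ?_) hx hbj
    rw [pd_sub j (H.differentiableAt_logpd hJ ho o hz) (H.differentiableAt_logpd hJ hj o hz),
      pd_logpd_comm hU hos ho0 hz, H.pd_logpd o ho j hj hoj z hz,
      H.pd_logpd j hj o ho hoj.symm z hz]
    ring
  have hGj : ∀ x ∈ box J, pd j G x = logpd g o j x * G x := by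
    intro x hx
    rw [hGdef, pd_mul j (hgd x hx) (hRd x hx), pd_comp_update_left_self hJ hRs hbj hx,
      pd_eq_logpd (ho0 x hx)]
    ring
  have hGo : ∀ x ∈ box J, pd o G x = logpd g j o x * G x := by
    intro x hx
    have hx' := update_mem_box hx hbj
    have h1 : pd o R (Function.update x j (b j)) = R (Function.update x j (b j)) *
        (logpd g j o (Function.update x j (b j)) - logpd g o o (Function.update x j (b j))) := by
      rw [hRdef, pd_div o (H.differentiableAt hJ hj hx') (hgd _ hx') (ho0 _ hx'),
        pd_eq_logpd (hj0 _ hx'), pd_eq_logpd (ho0 _ hx')]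
      have := ho0 _ hx'
      field_simp
    rw [hGdef, pd_mul o (hgd x hx) (hRd x hx), pd_comp_update_left hJ hRs hbj hx hoj, h1,
      pd_eq_logpd (ho0 x hx)]
    linear_combination (-(g o x * R (Function.update x j (b j)))) * hdiff x hx
  have hGb : ∀ x ∈ box J, logpd g j o x * G x = pd o (g j) (Function.update x j (b j)) := by
    intro x hx
    have hx' := update_mem_box hx hbj
    have h1 := update_eq_of_pd_eq_zero hJ (f := fun x => logpd g j o x * G x)
      ((H.contDiffOn_logpd hJ hj o).mul hGs) (j := j) (fun z hz => ?_) hx hbj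
    · rw [← h1, pd_eq_logpd (hj0 _ hx'), hGdef]
      simp only [Function.update_idem, hRdef]
      rw [mul_div_cancel₀ _ (ho0 _ hx')]
    · rw [pd_mul j (H.differentiableAt_logpd hJ hj o hz) (hGd z hz), hGj z hz,
        H.pd_logpd j hj o ho hoj.symm z hz]
      ring
  refine ⟨G, hGb, fun x hx t ht => ?_⟩
  have hgu := contDiffOn_comp_update_left hjs hbj
  refine (update_eq_of_pd_eq_zero hJ
    (f := fun x => G x - g j (Function.update x j (b j))) (hGs.sub hgu) (fun z hz => ?_) hx ht).symm
  rw [pd_sub o (hGd z hz) (differentiableAt_of_contDiffOn hU hgu hz), hGo z hz, hGb z hz,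
    pd_comp_update_left hJ hjs hbj hz hoj, sub_self]

/-- If all components depend on `xₒ` and all but `gₒ` on `x_{j₀}`, then the logarithmic
derivatives come from functions `σᵢ` of the single variables. -/
theorem SepDiagSystem.exists_sigma (hJ : ∀ i, IsOpenInterval (J i)) (H : SepDiagSystem J S g)
    {j₀ : ι} (ho : o ∈ S) (hj₀ : j₀ ∈ S) (hoj : o ≠ j₀)
    (hallo : ∀ i ∈ S, i ≠ o → Involves J g i o)
    (hallj : ∀ i ∈ S, i ≠ o → i ≠ j₀ → Involves J g i j₀) :
    ∃ σ : ι → ℝ → ℝ, (∀ i ∈ S, ContDiffOn ℝ ∞ (σ i) (J i)) ∧ NonconstOn (σ o) (J o) ∧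
      ∀ i ∈ S, ∀ k ∈ S, i ≠ k → ∀ x ∈ box J,
        logpd g i k x * (σ i (x i) - σ k (x k)) = -deriv (σ k) (x k) := by
  have hU := isOpen_box hJ
  obtain ⟨-, b, hb, hbne⟩ := hallo j₀ hj₀ hoj.symm
  have hbo := mem_box.1 hb o
  set c : ℝ := pd o (g j₀) b with hc
  have hj0 := (H.metric j₀ hj₀).2
  have hc0 : c ≠ 0 := by
    rw [hc, pd_eq_logpd (hj0 b hb)]
    exact mul_ne_zero hbne (hj0 b hb)
  -- One base point serves all i: if A_io vanished at b, moving x_{j₀} to a place where A_{ij₀} is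
  -- nonzero would leave A_{ij₀} A_{j₀o} = 0 in the quadratic relation.
  have hAb : ∀ i ∈ S, i ≠ o → logpd g i o b ≠ 0 := by
    intro i hi hio h0
    by_cases hij : i = j₀
    · subst hij; exact hbne h0
    obtain ⟨-, y, hy, hyn⟩ := hallj i hi hio hij
    have hz := update_mem_box hb (mem_box.1 hy j₀)
    have e := H.mul_eq i hi o ho j₀ hj₀ hio hij hoj _ hz
    rw [H.logpd_congr hi ho hio hz hb (by simp [hij]) (by simp [hoj]), h0] at e
    simp only [zero_mul, zero_add] at e
    exact mul_ne_zero (H.logpd_ne_zero hJ hi hj₀ hij hy hz (by simp) hyn)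
      (H.logpd_ne_zero hJ hj₀ ho hoj.symm hb hz (by simp [hoj]) hbne) e.symm
  have hAo : ∀ i ∈ S, i ≠ o → ∀ x ∈ box J, x o = b o → logpd g i o x ≠ 0 :=
    fun i hi hio x hx hxo => H.logpd_ne_zero hJ hi ho hio hb hx hxo (hAb i hi hio)
  -- The equation sought only determines σ up to an affine change, normalised by σ_o(b_o) = 0 and
  -- σ_o'(b_o) = 1. At x_o = b_o it then forces σ_i = -1/A_io. The formula for σ_o comes from the
  -- Liouville factor of the pair (o, j₀).
  set σ : ι → ℝ → ℝ := fun i t => if i = o then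
    (g j₀ (Function.update b o t) - g j₀ b) / c else -(logpd g i o (Function.update b i t))⁻¹
    with hσ
  have hσo : σ o = fun t => (g j₀ (Function.update b o t) - g j₀ b) / c := by
    funext t; simp [hσ]
  have hσi : ∀ i, i ≠ o → σ i = fun t => -(logpd g i o (Function.update b i t))⁻¹ := by
    intro i hi; funext t; simp [hσ, hi]
  have hline : ∀ i ∈ S, i ≠ o → ∀ t ∈ J i, logpd g i o (Function.update b i t) ≠ 0 :=
    fun i hi hio t ht => hAo i hi hio _ (update_mem_box hb ht) (by simp [hio.symm])
  have hσs : ∀ i ∈ S, ContDiffOn ℝ ∞ (σ i) (J i) := by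
    intro i hi
    by_cases hio : i = o
    · subst hio
      rw [hσo]
      exact ((contDiffOn_comp_update (H.metric j₀ hj₀).1 hb i).sub contDiffOn_const).div_const c
    · rw [hσi i hio]
      exact ((contDiffOn_comp_update (H.contDiffOn_logpd hJ hi o) hb i).inv (hline i hi hio)).neg
  have hσd : ∀ i ∈ S, ∀ x ∈ box J, DifferentiableAt ℝ (σ i) (x i) := fun i hi x hx =>
    differentiableAt_of_contDiffOn (hJ i).1 (hσs i hi) (mem_box.1 hx i)
  have hσo_deriv : ∀ t ∈ J o, deriv (σ o) t = pd o (g j₀) (Function.update b o t) / c := by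
    intro t ht
    rw [hσo]
    exact (((hasDerivAt_comp_update' o (H.differentiableAt hJ hj₀
      (update_mem_box hb ht))).sub_const _).div_const c).deriv
  have hσob : σ o (b o) = 0 := by simp [hσo]
  have hinv : ∀ i ∈ S, i ≠ o → ∀ x ∈ box J, x o = b o → logpd g i o x * σ i (x i) = -1 := by
    intro i hi hio x hx hxo
    have hz := update_mem_box hb (mem_box.1 hx i)
    have h1 := hline i hi hio _ (mem_box.1 hx i)
    rw [H.logpd_congr hi ho hio hx hz (by simp) (by simp [hio.symm, hxo]), hσi i hio]
    simp [h1]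
  -- This is the required equation for the pair (o, k) on the slice x_o = b_o, where σ_o = 0; it
  -- follows by differentiating -1/A_ko in x_k.
  have hder : ∀ k ∈ S, k ≠ o → ∀ x ∈ box J, x o = b o →
      logpd g o k x * σ k (x k) = deriv (σ k) (x k) := by
    intro k hk hko x hx hxo
    have hz := update_mem_box hb (mem_box.1 hx k)
    have h1 := hline k hk hko _ (mem_box.1 hx k)
    have h2 := ((hasDerivAt_comp_update' (x := b) k
      (H.differentiableAt_logpd hJ hk o hz)).fun_inv h1).fun_neg
    rw [hσi k hko, h2.deriv, H.pd_logpd k hk o ho hko _ hz,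
      H.logpd_congr ho hk hko.symm hx hz (by simp [hko.symm, hxo]) (by simp)]
    field_simp
  -- On the (x_o, x_{j₀})-plane through b the Liouville factor is G = c (σ_o - σ_{j₀}), and A_{j₀o}
  -- G = c σ_o'. Evaluating on that plane suffices because A_{j₀o} involves only these two
  -- variables.
  have hpair : ∀ x ∈ box J,
      logpd g j₀ o x * (σ o (x o) - σ j₀ (x j₀)) = deriv (σ o) (x o) := by
    intro x hx
    set z := Function.update (Function.update b j₀ (x j₀)) o (x o) with hzdef
    have hz : z ∈ box J := update_mem_box (update_mem_box hb (mem_box.1 hx j₀)) (mem_box.1 hx o)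
    have hzo : z o = x o := by simp [hzdef]
    have hzj : z j₀ = x j₀ := by simp [hzdef, hoj.symm]
    obtain ⟨G, hG1, hG2⟩ := H.exists_liouville hJ ho hj₀ hoj hb
    have hz1 : Function.update z j₀ (b j₀) = Function.update b o (x o) := by
      rw [hzdef, Function.update_comm hoj, Function.update_idem, Function.update_eq_self]
    set z' := Function.update z o (b o) with hz'def
    have hz' : z' ∈ box J := update_mem_box hz hbo
    have hz'1 : Function.update z' j₀ (b j₀) = b := by
      rw [hz'def, Function.update_comm hoj, hz1, Function.update_idem,
        Function.update_eq_self]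
    have hz'j : z' j₀ = x j₀ := by simp [hz'def, hoj.symm, hzj]
    have e1 := hG1 z hz
    have e2 := hG1 z' hz'
    have e3 := hG2 z hz (b o) hbo
    rw [hz1] at e1
    rw [hz'1] at e2
    rw [hz1, ← hz'def, hz'1] at e3
    have e4 := hinv j₀ hj₀ hoj.symm z' hz' (by simp [hz'def])
    rw [hz'j] at e4
    have hne := hAo j₀ hj₀ hoj.symm z' hz' (by simp [hz'def])
    have e5 : G z' = -(c * σ j₀ (x j₀)) := by
      refine mul_left_cancel₀ hne ?_
      rw [e2]
      linear_combination c * e4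
    have e6 : c * σ o (x o) = g j₀ (Function.update b o (x o)) - g j₀ b := by
      rw [hσo]
      field_simp
    have e7 : G z = c * (σ o (x o) - σ j₀ (x j₀)) := by linear_combination e3 + e5 - e6
    rw [H.logpd_congr hj₀ ho hoj.symm hx hz hzj.symm hzo.symm,
      hσo_deriv _ (mem_box.1 hx o), ← e1, e7]
    field_simp
  -- Given the equation for (k, o), the function A_ok (σ_o - σ_k) has zero x_o-derivative, so its
  -- value is found on the slice x_o = b_o.
  have hrow : ∀ k ∈ S, k ≠ o →
      (∀ x ∈ box J, logpd g k o x * (σ o (x o) - σ k (x k)) = deriv (σ o) (x o)) →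
      ∀ x ∈ box J, logpd g o k x * (σ o (x o) - σ k (x k)) = -deriv (σ k) (x k) := by
    intro k hk hko hkx x hx
    have hs : ∀ l ∈ S, ContDiffOn ℝ ∞ (fun x : ι → ℝ => σ l (x l)) (box J) := fun l hl =>
      contDiffOn_comp_eval (hσs l hl)
    have hx' := update_mem_box hx hbo
    have h1 := update_eq_of_pd_eq_zero hJ
      (f := fun x => logpd g o k x * (σ o (x o) - σ k (x k)))
      ((H.contDiffOn_logpd hJ ho k).mul ((hs o ho).sub (hs k hk))) (j := o)
      (fun z hz => ?_) hx hbo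
    · rw [← h1]
      have h2 := hder k hk hko _ hx' (by simp)
      simp only [Function.update_self, Function.update_of_ne hko, hσob] at h2 ⊢
      linear_combination -h2
    · have hd := fun l hl => differentiableAt_of_contDiffOn hU (hs l hl) hz
      rw [pd_mul o (H.differentiableAt_logpd hJ ho k hz) ((hd o ho).fun_sub (hd k hk)),
        pd_sub o (hd o ho) (hd k hk), pd_comp_eval_self o (hσd o ho z hz),
        pd_comp_eval_of_ne hko.symm (hσd k hk z hz), H.pd_logpd o ho k hk hko.symm z hz]
      linear_combination (-logpd g o k z) * hkx z hz
  -- The pair (i, o) is reached through the triple (i, o, j₀). Its quadratic relation at x_o = b_o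
  -- yields the equation for (i, j₀); at the original x_o it then yields the one for (i, o), after
  -- dividing by A_{ij₀}, which is nonzero for a suitable x_{j₀}.
  have hcol : ∀ i ∈ S, i ≠ o → ∀ x ∈ box J,
      logpd g i o x * (σ o (x o) - σ i (x i)) = deriv (σ o) (x o) := by
    intro i hi hio x hx
    by_cases hij : i = j₀
    · subst hij; exact hpair x hx
    obtain ⟨-, y, hy, hyn⟩ := hallj i hi hio hij
    set z := Function.update x j₀ (y j₀) with hzdef
    have hz : z ∈ box J := update_mem_box hx (mem_box.1 hy j₀)
    have hzi : z i = x i := by simp [hzdef, hij]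
    have hzo : z o = x o := by simp [hzdef, hoj]
    set z' := Function.update z o (b o) with hz'def
    have hz' : z' ∈ box J := update_mem_box hz hbo
    have hz'o : z' o = b o := by simp [hz'def]
    have hz'i : z' i = x i := by simp [hz'def, hio, hzi]
    have hz'j : z' j₀ = z j₀ := by simp [hz'def, hoj.symm]
    have hq : logpd g i j₀ z ≠ 0 := H.logpd_ne_zero hJ hi hj₀ hij hy hz (by simp [hzdef]) hyn
    have c1 := H.mul_eq i hi o ho j₀ hj₀ hio hij hoj z hz
    have c2 := H.mul_eq i hi o ho j₀ hj₀ hio hij hoj z' hz'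
    rw [H.logpd_congr hi hj₀ hij hz' hz (by simp [hz'def, hio]) hz'j] at c2
    have d1 := hrow j₀ hj₀ hoj.symm hpair z hz
    have d2 := hpair z hz
    have d3 := hder j₀ hj₀ hoj.symm z' hz' hz'o
    have d4 := hinv j₀ hj₀ hoj.symm z' hz' hz'o
    have d5 := hinv i hi hio z' hz' hz'o
    rw [hz'j] at d3 d4
    rw [hz'i] at d5
    rw [hzo] at d1 d2
    rw [H.logpd_congr hi ho hio hx hz hzi.symm hzo.symm]
    have key : deriv (σ j₀) (z j₀) = logpd g i j₀ z * (σ j₀ (z j₀) - σ i (x i)) := by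
      linear_combination (σ i (x i) * σ j₀ (z j₀)) * c2 - d3
        - (logpd g i j₀ z * σ j₀ (z j₀) - logpd g o j₀ z' * σ j₀ (z j₀)) * d5
        + (logpd g i j₀ z * σ i (x i)) * d4
    refine mul_left_cancel₀ hq ?_
    linear_combination (σ o (x o) - σ j₀ (z j₀)) * c1 + logpd g i o z * d1
      + logpd g i j₀ z * d2 - logpd g i o z * key
  refine ⟨σ, hσs, ?_, fun i hi k hk hik x hx => ?_⟩
  · by_contra hcon
    have hconst : ∀ t ∈ J o, σ o t = σ o (b o) := fun t ht => by
      by_contra hne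
      exact hcon ⟨t, ht, b o, hbo, hne⟩
    have h1 : deriv (σ o) (b o) = 0 := by
      refine (Filter.EventuallyEq.deriv_eq (f := fun _ => σ o (b o)) ?_).trans (deriv_const _ _)
      exact Filter.eventuallyEq_of_mem ((hJ o).1.mem_nhds hbo) hconst
    rw [hσo_deriv _ hbo, Function.update_eq_self, div_self hc0] at h1
    exact one_ne_zero h1
  · by_cases hio : i = o
    · subst hio
      exact hrow k hk hik.symm (hcol k hk hik.symm) x hx
    by_cases hko : k = o
    · subst hko
      linear_combination -hcol i hi hio x hx
    -- A_ik does not involve x_o, so the relation for (i, o, k) may be read on the slice x_o = b_o,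
    -- where A_io = -1/σ_i and A_ko = -1/σ_k.
    set z := Function.update x o (b o) with hzdef
    have hz : z ∈ box J := update_mem_box hx hbo
    have hzo : z o = b o := by simp [hzdef]
    have hzi : z i = x i := by simp [hzdef, hio]
    have hzk : z k = x k := by simp [hzdef, hko]
    have c1 := H.mul_eq i hi o ho k hk hio hik (Ne.symm hko) z hz
    have d3 := hder k hk hko z hz hzo
    have d4 := hinv k hk hko z hz hzo
    have d5 := hinv i hi hio z hz hzo
    rw [hzk] at d3 d4
    rw [hzi] at d5
    rw [H.logpd_congr hi hk hik hx hz hzi.symm hzk.symm]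
    linear_combination (σ i (x i) * σ k (x k)) * c1 - d3
        - (logpd g i k z * σ k (x k) - logpd g o k z * σ k (x k)) * d5
        + (logpd g i k z * σ i (x i)) * d4

end Sigma

end OrthSep

namespace OrthSep

/-! ### Classification -/

section Structure

variable {ι : Type*} [Fintype ι] [DecidableEq ι] {J : ι → Set ℝ} {S : Finset ι}
  {g : ι → (ι → ℝ) → ℝ} {x : ι → ℝ} {o : ι}

lemma pd_prod {κ : Type*} [DecidableEq κ] (N : Finset κ) {F : κ → (ι → ℝ) → ℝ} (k : ι)
    (hF : ∀ b ∈ N, DifferentiableAt ℝ (F b) x) :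
    pd k (fun y => ∏ b ∈ N, F b y) x = ∑ b ∈ N, (∏ c ∈ N.erase b, F c x) * pd k (F b) x := by
  unfold pd
  rw [(HasFDerivAt.finsetProd fun b hb => (hF b hb).hasFDerivAt).fderiv]
  simp

lemma pd_prod_sub_comp_eval {N : Finset ι} {c : (ι → ℝ) → ℝ} {σ : ι → ℝ → ℝ} {k : ι}
    (hc : DifferentiableAt ℝ c x) (hck : pd k c x = 0)
    (hσ : ∀ b ∈ N, DifferentiableAt ℝ (σ b) (x b)) (hk : k ∈ N) :
    pd k (fun y => ∏ b ∈ N, (c y - σ b (y b))) x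
      = -deriv (σ k) (x k) * ∏ b ∈ N.erase k, (c x - σ b (x b)) := by
  have hd : ∀ b ∈ N, DifferentiableAt ℝ (fun y : ι → ℝ => σ b (y b)) x := fun b hb =>
    differentiableAt_comp_eval (hσ b hb)
  rw [pd_prod N k fun b hb => hc.fun_sub (hd b hb), Finset.sum_eq_single_of_mem k hk]
  · rw [pd_sub k hc (hd k hk), hck, pd_comp_eval_self k (hσ k hk)]
    ring
  · intro b hb hbk
    rw [pd_sub k hc (hd b hb), hck, pd_comp_eval_of_ne hbk.symm (hσ b hb)]
    ring

/-- Functions `σᵢ` as in `SepDiagSystem.exists_sigma` bring the metric into concircular form. -/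
theorem SepDiagSystem.exists_isConcircularForm (hJ : ∀ i, IsOpenInterval (J i))
    (H : SepDiagSystem J S g) (ho : o ∈ S) {σ : ι → ℝ → ℝ}
    (hσs : ∀ i ∈ S, ContDiffOn ℝ ∞ (σ i) (J i)) (hσo : NonconstOn (σ o) (J o))
    (hσ : ∀ i ∈ S, ∀ k ∈ S, i ≠ k → ∀ x ∈ box J,
      logpd g i k x * (σ i (x i) - σ k (x k)) = -deriv (σ k) (x k)) :
    ∃ (M : Finset ι) (P : Finpartition (S \ M)) (h : Finset ι → ι → (ι → ℝ) → ℝ), M.Nonempty ∧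
      IsConcircularForm J S M P h g ∧ ∀ I ∈ P.parts, SepDiagSystem J I (h I) := by
  classical
  have hU := isOpen_box hJ
  obtain ⟨b, hb⟩ := box_nonempty hJ
  set M := S.filter fun i => NonconstOn (σ i) (J i) with hMdef
  have hMS : M ⊆ S := Finset.filter_subset _ _
  have hσd : ∀ i ∈ S, ∀ x ∈ box J, DifferentiableAt ℝ (σ i) (x i) := fun i hi x hx =>
    differentiableAt_of_contDiffOn (hJ i).1 (hσs i hi) (mem_box.1 hx i)
  have hσe : ∀ i ∈ S, ContDiffOn ℝ ∞ (fun x : ι → ℝ => σ i (x i)) (box J) := fun i hi =>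
    contDiffOn_comp_eval (hσs i hi)
  have hconst : ∀ i ∈ S, i ∉ M → ∀ t ∈ J i, σ i t = σ i (b i) := by
    intro i hi hiM t ht
    by_contra hne
    exact hiM (Finset.mem_filter.2 ⟨hi, t, ht, b i, mem_box.1 hb i, hne⟩)
  have hderiv0 : ∀ i ∈ S, i ∉ M → ∀ t ∈ J i, deriv (σ i) t = 0 := fun i hi hiM t ht =>
    (Filter.EventuallyEq.deriv_eq (f := fun _ => σ i (b i)) (Filter.eventuallyEq_of_mem
      ((hJ i).1.mem_nhds ht) (hconst i hi hiM))).trans (deriv_const _ _)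
  -- (σ_i - σ_k)/g_i is independent of x_k, by the equation for σ. A zero would therefore persist
  -- along the whole x_k-line and make σ_k constant.
  have hsep : ∀ i ∈ S, ∀ k ∈ M, i ≠ k → ∀ x ∈ box J, σ i (x i) - σ k (x k) ≠ 0 := by
    intro i hi k hk hik x hx h0
    have hkS := hMS hk
    have hi0 := (H.metric i hi).2
    have hsub := (hσe i hi).sub (hσe k hkS)
    have hval : ∀ t ∈ J k, σ k t = σ i (x i) := by
      intro t ht
      have h1 := update_eq_of_pd_eq_zero hJ (f := fun x => (σ i (x i) - σ k (x k)) / g i x)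
        (hsub.div (H.metric i hi).1 hi0) (j := k) (fun z hz => ?_) hx ht
      · simp only [Function.update_self, Function.update_of_ne hik, h0, zero_div] at h1
        have h2 := (div_eq_zero_iff.1 h1).resolve_right (hi0 _ (update_mem_box hx ht))
        linarith
      · have hd := fun l hl => differentiableAt_of_contDiffOn hU (hσe l hl) hz
        rw [pd_div k ((hd i hi).fun_sub (hd k hkS)) (H.differentiableAt hJ hi hz) (hi0 z hz),
          pd_sub k (hd i hi) (hd k hkS), pd_comp_eval_of_ne hik.symm (hσd i hi z hz),
          pd_comp_eval_self k (hσd k hkS z hz), pd_eq_logpd (hi0 z hz)]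
        rw [div_eq_zero_iff]
        left
        linear_combination (-g i z) * hσ i hi k hkS hik z hz
    obtain ⟨t, ht, t', ht', hne⟩ := (Finset.mem_filter.1 hk).2
    exact hne ((hval t ht).trans (hval t' ht').symm)
  have hzero : ∀ i ∈ S, ∀ k ∈ S, k ∉ M → i ≠ k → ∀ x ∈ box J, σ i (x i) - σ k (x k) ≠ 0 →
      logpd g i k x = 0 := by
    intro i hi k hk hkM hik x hx hne
    have h1 := hσ i hi k hk hik x hx
    rw [hderiv0 k hk hkM _ (mem_box.1 hx k), neg_zero] at h1
    exact (mul_eq_zero.1 h1).resolve_right hne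
  -- Blocks collect the coordinates with a common constant value e_I of σ. Between different blocks
  -- σ_i - σ_k is nonzero while σ_k' = 0, so A_ik = 0.
  obtain ⟨P, hP, -⟩ := exists_finpartition_fibres (S \ M) fun i => σ i (b i)
  have hE : ∀ I, ∃ e : ℝ, I ∈ P.parts → ∀ i ∈ I, σ i (b i) = e := by
    intro I
    by_cases hI : I ∈ P.parts
    · obtain ⟨i, hi⟩ := P.nonempty_of_mem_parts hI
      exact ⟨σ i (b i), fun _ k hk => (hP I hI i hi k (P.le hI hk)).1 hk⟩
    · exact ⟨0, fun h => absurd h hI⟩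
  choose e he using hE
  have heσ : ∀ I ∈ P.parts, ∀ i ∈ I, ∀ x ∈ box J, σ i (x i) = e I := by
    intro I hI i hi x hx
    obtain ⟨hiS, hiM⟩ := mem_and_notMem_of_mem_parts hI hi
    rw [hconst i hiS hiM _ (mem_box.1 hx i), he I hI i hi]
  have hw0 : ∀ I ∈ P.parts, ∀ x ∈ box J, ∏ a ∈ M, (e I - σ a (x a)) ≠ 0 := by
    intro I hI x hx
    obtain ⟨i, hi⟩ := P.nonempty_of_mem_parts hI
    obtain ⟨hiS, hiM⟩ := mem_and_notMem_of_mem_parts hI hi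
    refine Finset.prod_ne_zero_iff.2 fun a ha => ?_
    rw [← heσ I hI i hi x hx]
    exact hsep i hiS a ha (fun h => hiM (h ▸ ha)) x hx
  have hsys : ∀ I ∈ P.parts,
      SepDiagSystem J I fun i x => g i x / ∏ a ∈ M, (e I - σ a (x a)) := by
    intro I hI
    refine H.div hJ (fun i hi => (mem_and_notMem_of_mem_parts hI hi).1)
      (M := M) (Finset.disjoint_left.2 fun i hi => (mem_and_notMem_of_mem_parts hI hi).2)
      (contDiffOn_prod fun a ha => contDiffOn_const.sub (hσe a (hMS ha))) (hw0 I hI)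
      (dep_prod_comp_eval fun a t => e I - σ a t) (fun i hi k hk x hx => ?_)
      fun i hi k hk hkM hkI x hx => ?_
    · obtain ⟨hiS, hiM⟩ := mem_and_notMem_of_mem_parts hI hi
      have h1 := hσ i hiS k (hMS hk) (fun h => hiM (h ▸ hk)) x hx
      rw [heσ I hI i hi x hx] at h1
      rw [pd_prod_sub_comp_eval (c := fun _ => e I) (differentiableAt_const _) (pd_const _ _)
        (fun a ha => hσd a (hMS ha) x hx) hk, ← Finset.mul_prod_erase M _ hk, ← mul_assoc, h1]
    · obtain ⟨hiS, hiM⟩ := mem_and_notMem_of_mem_parts hI hi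
      refine hzero i hiS k hk hkM (fun h => hkI (h ▸ hi)) x hx fun h0 => hkI ?_
      rw [hP I hI i hi k (Finset.mem_sdiff.2 ⟨hk, hkM⟩), ← hconst k hk hkM _ (mem_box.1 hx k),
        ← hconst i hiS hiM _ (mem_box.1 hx i)]
      linarith
  set W : ι → (ι → ℝ) → ℝ := fun a x => ∏ c ∈ M.erase a, (σ a (x a) - σ c (x c)) with hWdef
  have hWs : ∀ a ∈ M, ContDiffOn ℝ ∞ (W a) (box J) := fun a ha => contDiffOn_prod fun c hc =>
    (hσe a (hMS ha)).sub (hσe c (hMS (Finset.mem_of_mem_erase hc)))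
  have hW0 : ∀ a ∈ M, ∀ x ∈ box J, W a x ≠ 0 := fun a ha x hx =>
    Finset.prod_ne_zero_iff.2 fun c hc => hsep a (hMS ha) c (Finset.mem_of_mem_erase hc)
      (Finset.ne_of_mem_erase hc).symm x hx
  have hWdep : ∀ a ∈ M, Dep J M (W a) := fun a ha x _ y _ hxy =>
    Finset.prod_congr rfl fun c hc => by rw [hxy a ha, hxy c (Finset.mem_of_mem_erase hc)]
  have hΦs : ∀ a ∈ M, ContDiffOn ℝ ∞ (fun x => g a x / W a x) (box J) := fun a ha =>
    (H.metric a (hMS ha)).1.div (hWs a ha) (hW0 a ha)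
  -- The Vandermonde factor W_a has the same logarithmic x_k-derivatives as g_a for all k ≠ a, so
  -- the quotient is a function of x_a, and this is Φ_a.
  have hΦdep : ∀ a ∈ M, Dep J {a} fun x => g a x / W a x := by
    intro a ha
    have haS := hMS ha
    refine dep_of_pd_eq_zero hJ (hΦs a ha) fun k hk z hz => ?_
    have hka : k ≠ a := fun h => hk (Finset.mem_singleton.2 h)
    have ha0 := (H.metric a haS).2 z hz
    rw [pd_div k (H.differentiableAt hJ haS hz)
      (differentiableAt_of_contDiffOn hU (hWs a ha) hz) (hW0 a ha z hz), div_eq_zero_iff]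
    left
    by_cases hkM : k ∈ M
    · have hke := Finset.mem_erase.2 ⟨hka, hkM⟩
      have h1 := hσ a haS k (hMS hkM) hka.symm z hz
      have h2 : pd k (W a) z = -deriv (σ k) (z k) *
          ∏ c ∈ (M.erase a).erase k, (σ a (z a) - σ c (z c)) :=
        pd_prod_sub_comp_eval (c := fun x => σ a (x a))
          (differentiableAt_of_contDiffOn hU (hσe a haS) hz)
          (pd_comp_eval_of_ne hka (hσd a haS z hz))
          (fun c hc => hσd c (hMS (Finset.mem_of_mem_erase hc)) z hz) hke
      have h3 : W a z = (σ a (z a) - σ k (z k)) *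
          ∏ c ∈ (M.erase a).erase k, (σ a (z a) - σ c (z c)) :=
        (Finset.mul_prod_erase (M.erase a) _ hke).symm
      rw [h2, h3, pd_eq_logpd ha0, ← h1]
      ring
    · rw [(hWdep a ha).pd_eq_zero hJ (hWs a ha) hkM hz, mul_zero, sub_zero]
      by_cases hkS : k ∈ S
      · rw [pd_eq_logpd ha0, hzero a haS k hkS hkM hka.symm z hz fun h0 =>
          hsep k hkS a ha hka z hz (by linarith)]
        ring
      · rw [H.pd_eq_zero_of_notMem hJ haS hkS hz, zero_mul]
  refine ⟨M, P, fun I i x => g i x / ∏ a ∈ M, (e I - σ a (x a)),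
    ⟨o, Finset.mem_filter.2 ⟨ho, hσo⟩⟩, ⟨hMS,
    fun a t => g a (Function.update b a t) / W a (Function.update b a t), σ, e, fun a ha =>
      ⟨contDiffOn_comp_update (hΦs a ha) hb a, hσs a (hMS ha), (Finset.mem_filter.1 ha).2⟩,
    fun I hI => (hsys I hI).dependsOnlyOn, fun x hx a ha => ?_, fun x hx I hI i hi => ?_⟩, hsys⟩
  · have h1 := hΦdep a ha x hx _ (update_mem_box hb (mem_box.1 hx a)) (by simp)
    beta_reduce at h1 ⊢
    rw [← h1]
    exact (div_mul_cancel₀ _ (hW0 a ha x hx)).symm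
  · exact (mul_div_cancel₀ _ (hw0 I hI x hx)).symm

/-- If `gₒ` depends on `xₒ` only and all other components depend on `xₒ`, the metric is
exceptional. -/
theorem SepDiagSystem.exists_isExceptional (hJ : ∀ i, IsOpenInterval (J i))
    (H : SepDiagSystem J S g) (ho : o ∈ S) (hne : (S \ {o}).Nonempty)
    (hallo : ∀ i ∈ S, i ≠ o → Involves J g i o) (hnone : ∀ j ∈ S, ¬ Involves J g o j) :
    ∃ (P : Finpartition (S \ {o})) (h : Finset ι → ι → (ι → ℝ) → ℝ),
      IsExceptional J S o P h g ∧ ∀ I ∈ P.parts, SepDiagSystem J I (h I) := by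
  have hU := isOpen_box hJ
  obtain ⟨b, hb⟩ := box_nonempty hJ
  have hbo := mem_box.1 hb o
  have hoz : ∀ j ∈ S, j ≠ o → ∀ x ∈ box J, logpd g o j x = 0 := fun j hj hjo =>
    (Involves.not_iff_of_ne hjo.symm).1 (hnone j hj)
  -- Even x_i drops out: ∂_i A_io = -A_io A_oi, and A_oi = 0.
  have hdep : ∀ i ∈ S, i ≠ o → Dep J {o} (logpd g i o) := by
    intro i hi hio
    refine dep_of_pd_eq_zero hJ (H.contDiffOn_logpd hJ hi o) fun k hk z hz => ?_
    have hko : k ≠ o := fun h => hk (Finset.mem_singleton.2 h)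
    by_cases hki : k = i
    · subst hki
      rw [H.pd_logpd k hi o ho hio z hz, hoz k hi hio z hz, mul_zero, neg_zero]
    · exact (H.dep i hi o ho hio).pd_eq_zero hJ (H.contDiffOn_logpd hJ hi o)
        (by simp [hki, hko]) hz
  -- Coordinates with the same function A_io of x_o ∈ J_o form a block; these share a warping
  -- function, taken below from a representative along the x_o-line through b.
  obtain ⟨P, hP, -⟩ := exists_finpartition_fibres (S \ {o})
    fun i (t : J o) => logpd g i o (Function.update b o t)
  have hmem : ∀ I ∈ P.parts, ∀ i ∈ I, i ∈ S ∧ i ≠ o := fun I hI i hi =>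
    ⟨(mem_and_notMem_of_mem_parts hI hi).1, fun h =>
      (mem_and_notMem_of_mem_parts hI hi).2 (Finset.mem_singleton.2 h)⟩
  have hline : ∀ i ∈ S, i ≠ o → ∀ x ∈ box J,
      logpd g i o x = logpd g i o (Function.update b o (x o)) := fun i hi hio x hx =>
    hdep i hi hio x hx _ (update_mem_box hb (mem_box.1 hx o)) (by simp)
  have hsame : ∀ I ∈ P.parts, ∀ i ∈ I, ∀ k ∈ I, ∀ x ∈ box J, logpd g i o x = logpd g k o x := by
    intro I hI i hi k hk x hx
    have h1 := congrFun ((hP I hI k hk i (P.le hI hi)).1 hi) ⟨x o, mem_box.1 hx o⟩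
    beta_reduce at h1
    rw [hline i (hmem I hI i hi).1 (hmem I hI i hi).2 x hx,
      hline k (hmem I hI k hk).1 (hmem I hI k hk).2 x hx, h1]
  have hrep : ∀ I, ∃ r : ι, I ∈ P.parts → r ∈ I := by
    intro I
    by_cases hI : I ∈ P.parts
    · exact (P.nonempty_of_mem_parts hI).imp fun i hi _ => hi
    · exact ⟨o, fun h => absurd h hI⟩
  choose r hr using hrep
  set w : Finset ι → ℝ → ℝ := fun I t => g (r I) (Function.update b o t) with hwdef
  have hrS : ∀ I ∈ P.parts, r I ∈ S ∧ r I ≠ o := fun I hI => hmem I hI _ (hr I hI)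
  have hws : ∀ I ∈ P.parts, ContDiffOn ℝ ∞ (w I) (J o) := fun I hI =>
    contDiffOn_comp_update (H.metric _ (hrS I hI).1).1 hb o
  have hw0 : ∀ I ∈ P.parts, ∀ x ∈ box J, w I (x o) ≠ 0 := fun I hI x hx =>
    (H.metric _ (hrS I hI).1).2 _ (update_mem_box hb (mem_box.1 hx o))
  have hwd : ∀ I ∈ P.parts, ∀ t ∈ J o,
      HasDerivAt (w I) (pd o (g (r I)) (Function.update b o t)) t := fun I hI t ht =>
    hasDerivAt_comp_update' o (H.differentiableAt hJ (hrS I hI).1 (update_mem_box hb ht))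
  have hsys : ∀ I ∈ P.parts, SepDiagSystem J I fun i x => g i x / w I (x o) := by
    intro I hI
    refine H.div hJ (fun i hi => (hmem I hI i hi).1) (M := {o})
      (Finset.disjoint_left.2 fun i hi => (mem_and_notMem_of_mem_parts hI hi).2)
      (contDiffOn_comp_eval (hws I hI)) (hw0 I hI)
      (fun x _ y _ hxy => by rw [hxy o (by simp)]) (fun i hi k hk x hx => ?_)
      fun i hi k hk hko hkI x hx => ?_
    · rw [Finset.mem_singleton.1 hk]
      have hd := hwd I hI _ (mem_box.1 hx o)
      have hx' := update_mem_box hb (mem_box.1 hx o)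
      rw [pd_comp_eval_self o hd.differentiableAt, hd.deriv,
        pd_eq_logpd ((H.metric _ (hrS I hI).1).2 _ hx'), hsame I hI i hi _ (hr I hI) x hx,
        hline _ (hrS I hI).1 (hrS I hI).2 x hx]
    · obtain ⟨hiS, hio⟩ := hmem I hI i hi
      rw [Finset.mem_singleton] at hko
      have hik : i ≠ k := fun h => hkI (h ▸ hi)
      have hkd : k ∈ S \ {o} := by simp [hk, hko]
      -- For i, k in different blocks the quadratic relation becomes A_ik (A_ko - A_io) = 0. Moving
      -- x_o to a value t where the two functions differ gives A_ik = 0, since A_ik does not involve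
      -- x_o.
      obtain ⟨⟨t, htJ⟩, ht⟩ := Function.ne_iff.1 fun h => hkI ((hP I hI i hi k hkd).2 h)
      have hz := update_mem_box hx htJ
      have e := H.mul_eq i hiS o ho k hk hio hik (Ne.symm hko) _ hz
      rw [hoz k hk hko _ hz, mul_zero, zero_add, hline i hiS hio _ hz,
        hline k hk hko _ hz, Function.update_self,
        H.logpd_congr hiS hk hik hz hx (by simp [hio]) (by simp [hko])] at e
      have e' : logpd g i k x * (logpd g k o (Function.update b o t)
          - logpd g i o (Function.update b o t)) = 0 := by linear_combination -e
      exact (mul_eq_zero.1 e').resolve_right (sub_ne_zero.2 ht)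
  refine ⟨P, fun I i x => g i x / w I (x o), ⟨ho,
    P.parts_nonempty (Finset.nonempty_iff_ne_empty.1 hne),
    fun t => g o (Function.update b o t), w,
    contDiffOn_comp_update (H.metric o ho).1 hb o,
    fun I hI => ⟨hws I hI, ?_, (hsys I hI).dependsOnlyOn⟩, fun x hx => ?_,
    fun x hx I hI i hi => (mul_div_cancel₀ _ (hw0 I hI x hx)).symm⟩, hsys⟩
  · by_contra hcon
    obtain ⟨-, y, hy, hyn⟩ := hallo _ (hrS I hI).1 (hrS I hI).2
    have hyo := mem_box.1 hy o
    rw [hline _ (hrS I hI).1 (hrS I hI).2 y hy] at hyn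
    have h1 : deriv (w I) (y o) = 0 := by
      refine (Filter.EventuallyEq.deriv_eq (f := fun _ => w I (y o)) ?_).trans (deriv_const _ _)
      refine Filter.eventuallyEq_of_mem ((hJ o).1.mem_nhds hyo) fun t ht => ?_
      by_contra hne
      exact hcon ⟨t, ht, y o, hyo, hne⟩
    rw [(hwd I hI _ hyo).deriv] at h1
    exact hyn (by rw [logpd, h1, zero_div])
  · refine dep_of_pd_eq_zero hJ (H.metric o ho).1 (T := {o}) (fun k hk z hz => ?_) x hx _
      (update_mem_box hb (mem_box.1 hx o)) (by simp)
    have hko : k ≠ o := fun h => hk (Finset.mem_singleton.2 h)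
    by_cases hkS : k ∈ S
    · rw [pd_eq_logpd ((H.metric o ho).2 z hz), hoz k hkS hko z hz, zero_mul]
    · exact H.pd_eq_zero_of_notMem hJ ho hkS hz

/-- If no component in `T` depends on coordinates outside `T` and conversely, the metric is a
product. -/
theorem SepDiagSystem.exists_isProduct (hJ : ∀ i, IsOpenInterval (J i)) (H : SepDiagSystem J S g)
    {T : Finset ι} (hTS : T ⊆ S) (hT : T.Nonempty)
    (hne : T ≠ S) (h1 : ∀ i ∈ T, ∀ k ∈ S, k ∉ T → ¬ Involves J g i k)
    (h2 : ∀ i ∈ T, ∀ k ∈ S, k ∉ T → ¬ Involves J g k i) :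
    ∃ (P : Finpartition (S \ ∅)) (h : Finset ι → ι → (ι → ℝ) → ℝ),
      IsProduct J S P h g ∧ ∀ I ∈ P.parts, I ⊂ S ∧ SepDiagSystem J I (h I) := by
  obtain ⟨P, hP, hex⟩ := exists_finpartition_fibres (S \ ∅) fun i => i ∈ T
  simp only [Finset.sdiff_empty, eq_iff_iff] at hP hex
  have hIS : ∀ I ∈ P.parts, I ⊆ S := fun I hI i hi => (mem_and_notMem_of_mem_parts hI hi).1
  obtain ⟨p, hp⟩ := hT
  obtain ⟨q, hq, hqT⟩ := Finset.exists_of_ssubset (hTS.ssubset_of_ne hne)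
  obtain ⟨A, hA, hpA⟩ := hex p (hTS hp)
  obtain ⟨B, hB, hqB⟩ := hex q hq
  have hqA : q ∉ A := fun h => hqT (((hP A hA p hpA q hq).1 h).2 hp)
  have hsys : ∀ I ∈ P.parts, SepDiagSystem J I g := by
    intro I hI
    -- Division by the trivial weight 1 extracts the fact that g restricted to a block depends on
    -- that block's coordinates only.
    have := H.div hJ (hIS I hI) (M := ∅) (by simp) (w := fun _ => 1) contDiffOn_const
      (fun _ _ => one_ne_zero) (fun _ _ _ _ _ => rfl) (by simp) fun i hi k hk _ hkI x hx => ?_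
    · simpa using this
    · have hik : i ≠ k := fun h => hkI (h ▸ hi)
      have hiff := (hP I hI i hi k hk).not.1 hkI
      refine (Involves.not_iff_of_ne hik).1 ?_ x hx
      by_cases hiT : i ∈ T
      · exact h1 i hiT k hk fun hkT => hiff (by simp [hkT, hiT])
      · by_cases hkT : k ∈ T
        · exact h2 k hkT i (hIS I hI hi) hiT
        · exact absurd (by simp [hkT, hiT]) hiff
  refine ⟨P, fun _ => g, ⟨Finset.one_lt_card.2 ⟨A, hA, B, hB, fun h => hqA (h ▸ hqB)⟩,
    Finset.empty_subset _, fun _ _ => 0, fun _ _ => 0, fun _ => 0, by simp,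
    fun I hI => (hsys I hI).dependsOnlyOn, by simp, by simp⟩, fun I hI => ⟨?_, hsys I hI⟩⟩
  refine (hIS I hI).ssubset_of_ne fun h => ?_
  have hpI : p ∈ I := h ▸ hTS hp
  have hqI : q ∈ I := h ▸ hq
  exact hqT (((hP I hI p hpI q hq).1 hqI).2 hp)

/-- With one coordinate no difference of σ occurs, so σ only has to be nonconstant and the identity
will do. -/
lemma SepDiagSystem.isIrreducible_singleton (hJ : ∀ i, IsOpenInterval (J i))
    (H : SepDiagSystem J S g) (hS : S = {o}) : IsIrreducible J S g := by
  subst hS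
  obtain ⟨b, hb⟩ := box_nonempty hJ
  have hbo := mem_box.1 hb o
  have ho : o ∈ ({o} : Finset ι) := by simp
  obtain ⟨P, -, -⟩ := exists_finpartition_fibres (({o} : Finset ι) \ {o}) fun _ => ()
  have hparts : ∀ I, I ∉ P.parts := fun I hI => by
    obtain ⟨i, hi⟩ := P.nonempty_of_mem_parts hI
    exact (mem_and_notMem_of_mem_parts hI hi).2 (mem_and_notMem_of_mem_parts hI hi).1
  refine ⟨P, fun _ => g, subset_rfl, fun a t => g a (Function.update b a t), fun _ t => t,
    fun _ => 0, fun a ha => ?_, fun I hI => absurd hI (hparts I), fun x hx a ha => ?_,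
    fun x hx I hI => absurd hI (hparts I)⟩
  · rw [Finset.mem_singleton.1 ha]
    refine ⟨contDiffOn_comp_update (H.metric o ho).1 hb o, contDiffOn_id, ?_⟩
    obtain ⟨ε, hε, hball⟩ := Metric.isOpen_iff.1 (hJ o).1 _ hbo
    refine ⟨b o, hbo, b o + ε / 2, hball ?_, by linarith⟩
    rw [Real.ball_eq_Ioo]
    constructor <;> linarith
  · obtain rfl := Finset.mem_singleton.1 ha
    simpa using H.dependsOnlyOn a ho x hx _ (update_mem_box hb (mem_box.1 hx a)) (by simp)

end Structure

/-! ### Recursion over sets of coordinates -/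

section Classification

variable {ι : Type*} [Fintype ι] [DecidableEq ι] {J : ι → Set ℝ}

/-- Solutions of the system are classified. -/
theorem SepDiagSystem.isClassified (hJ : ∀ i, IsOpenInterval (J i)) (S : Finset ι) :
    ∀ g : ι → (ι → ℝ) → ℝ, SepDiagSystem J S g → IsClassified J S g := by
  classical
  induction S using Finset.strongInduction with
  | H S ih =>
  intro g H
  rcases S.eq_empty_or_nonempty with rfl | hS
  · obtain ⟨P, -, -⟩ := exists_finpartition_fibres ((∅ : Finset ι) \ ∅) fun _ => ()
    refine .irreducible ⟨P, fun _ => g, subset_rfl, fun _ _ => 0, fun _ _ => 0, fun _ => 0,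
      by simp, fun I hI => ?_, by simp, fun x hx I hI i hi => ?_⟩
    · obtain ⟨i, hi⟩ := P.nonempty_of_mem_parts hI
      exact absurd (mem_and_notMem_of_mem_parts hI hi).1 (Finset.notMem_empty i)
    · exact absurd (mem_and_notMem_of_mem_parts hI hi).1 (Finset.notMem_empty i)
  obtain ⟨o, ho, hterm⟩ := H.exists_terminal hJ hS
  -- If T is not all of S, the metric splits along T. An arrow leaving T would, by the choice of o
  -- or comparability of targets, give its end an arrow to o; an arrow entering T would do so for
  -- its source by transitivity.
  set T := S.filter fun i => i = o ∨ Involves J g i o with hTdef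
  have hTS : T ⊆ S := Finset.filter_subset _ _
  have hoT : o ∈ T := Finset.mem_filter.2 ⟨ho, Or.inl rfl⟩
  by_cases hTeq : T = S
  swap
  · have hkT : ∀ k ∈ S, k ∉ T → k ≠ o ∧ ¬ Involves J g k o := fun k hk hkT => by
      simpa [hTdef, hk] using hkT
    obtain ⟨P, h, hprod, hblocks⟩ := H.exists_isProduct hJ hTS ⟨o, hoT⟩ hTeq
      (fun i hi k hk hk' hik => by
        obtain ⟨hko, hnk⟩ := hkT k hk hk'
        rcases (Finset.mem_filter.1 hi).2 with rfl | hio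
        · exact hnk (hterm k hk hik)
        · rcases H.involves_or hJ (hTS hi) ho hk (Ne.symm hko) hio hik with hok | hko'
          · exact hnk (hterm k hk hok)
          · exact hnk hko')
      (fun i hi k hk hk' hki => by
        obtain ⟨hko, hnk⟩ := hkT k hk hk'
        rcases (Finset.mem_filter.1 hi).2 with rfl | hio
        · exact hnk hki
        · exact hnk (H.involves_trans hJ hk (hTS hi) ho hko hki hio))
    exact .product P h hprod fun I hI => ih I (hblocks I hI).1 _ (hblocks I hI).2
  have hallo : ∀ i ∈ S, i ≠ o → Involves J g i o := fun i hi hio =>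
    ((Finset.mem_filter.1 (hTeq.symm ▸ hi : i ∈ T)).2).resolve_left hio
  have hssub : ∀ (M : Finset ι), M.Nonempty → M ⊆ S → ∀ P : Finpartition (S \ M),
      ∀ I ∈ P.parts, I ⊂ S := by
    intro M hM hMS P I hI
    obtain ⟨a, ha⟩ := hM
    refine Finset.ssubset_iff_subset_ne.2
      ⟨fun i hi => (mem_and_notMem_of_mem_parts hI hi).1, fun h => ?_⟩
    exact (mem_and_notMem_of_mem_parts hI (h ▸ hMS ha : a ∈ I)).2 ha
  by_cases hex : ∃ j ∈ S, Involves J g o j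
  · obtain ⟨j₀, hj₀, hoj⟩ := hex
    -- Every coordinate points at o and o → j₀, so by transitivity every other coordinate points at
    -- j₀ as well.
    obtain ⟨σ, hσs, hσo, hσ⟩ := H.exists_sigma hJ ho hj₀ hoj.1 hallo fun i hi hio hij =>
      H.involves_trans hJ hi ho hj₀ hij (hallo i hi hio) hoj
    obtain ⟨M, P, h, hM, hform, hblocks⟩ := H.exists_isConcircularForm hJ ho hσs hσo hσ
    by_cases hPe : P.parts.Nonempty
    · exact .warped M P h ⟨hM, hPe, hform⟩ fun I hI =>
        ih I (hssub M hM hform.1 P I hI) _ (hblocks I hI)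
    · have hMS : M = S := by
        refine hform.1.antisymm fun i hi => ?_
        by_contra hiM
        exact hPe ⟨P.part i, P.part_mem.2 (Finset.mem_sdiff.2 ⟨hi, hiM⟩)⟩
      subst hMS
      exact .irreducible ⟨P, h, hform⟩
  · push Not at hex
    by_cases hne : (S \ {o}).Nonempty
    · obtain ⟨P, h, hexc, hblocks⟩ := H.exists_isExceptional hJ ho hne hallo hex
      exact .exceptional o P h hexc fun I hI =>
        ih I (hssub {o} (by simp) (by simpa using ho) P I hI) _ (hblocks I hI)
    · refine .irreducible (H.isIrreducible_singleton hJ (o := o) ?_)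
      rw [Finset.not_nonempty_iff_eq_empty, Finset.sdiff_eq_empty_iff_subset] at hne
      exact hne.antisymm (by simpa using ho)

end Classification

end OrthSep

/-! ### The two directions of the theorem -/

theorem mainTheorem3 (n : ℕ) (J : Fin n → Set ℝ) (hJ : ∀ i, OrthSep.IsOpenInterval (J i))
    (g : Fin n → (Fin n → ℝ) → ℝ) (hg : OrthSep.IsOrthMetric (OrthSep.box J) g) :
    (OrthSep.IsSeparable (OrthSep.box J) (OrthSep.diagMetric g) ∧
        OrthSep.HasDiagonalCurvature (OrthSep.box J) (OrthSep.diagMetric g) →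
      OrthSep.IsClassified J Finset.univ g ∧ OrthSep.BlocksAreOrthSepDiag J Finset.univ g) ∧
    (OrthSep.IsClassified J Finset.univ g →
      OrthSep.LeviCivitaEquations (OrthSep.box J) g ∧
        OrthSep.IsSeparable (OrthSep.box J) (OrthSep.diagMetric g) ∧
        OrthSep.HasDiagonalCurvature (OrthSep.box J) (OrthSep.diagMetric g)) := by
  constructor
  · rintro ⟨hsep, hcurv⟩
    have H := OrthSep.sepDiagSystem_of_isOrthSepDiag hJ ⟨hg, hsep, hcurv⟩
    -- The system passes to any block in any decomposition, but separability is not read off from it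
    -- directly: the block is first classified, and its explicit Stäckel systems then give
    -- separability.
    have key : ∀ (M : Finset (Fin n)) (P : Finpartition (Finset.univ \ M))
        (h : Finset (Fin n) → Fin n → (Fin n → ℝ) → ℝ),
        (∃ wt, OrthSep.IsBlockForm J Finset.univ M P h g wt) →
        ∀ I ∈ P.parts, OrthSep.BlockIsOrthSepDiag J I (h I) := by
      rintro M P h ⟨wt, hB⟩ I hI
      have hsys := hB.sepDiagSystem hJ H hI
      exact (OrthSep.SepDiagSystem.isClassified hJ I _ hsys).blockIsOrthSepDiag hJ hsys.metric
    exact ⟨OrthSep.SepDiagSystem.isClassified hJ _ g H,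
      fun P h hp => key _ P h hp.2.isBlockForm,
      fun M P h hp => key _ P h hp.2.2.isBlockForm,
      fun a P h hp => key _ P h hp.isBlockForm⟩
  · intro hcl
    obtain ⟨hS, hF⟩ := hcl.staeckel fun i _ => hg i
    obtain ⟨hLC, -, hsep, hcurv⟩ := OrthSep.isOrthSepDiag_of_staeckel hJ hg hS hF
    exact ⟨hLC, hsep, hcurv⟩
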